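/- Let $\mathbb K$ be a field of characteristic $0$. A CDGA is a graded-commutative differential graded $\mathbb K$-algebra $A=\bigoplus_{p\ge 0}A^p$ with differential of degree $+1$; its cohomology $H(A)$ is a CDGA with zero differential. A functor $A\colon J\to\mathrm{CDGA}$ on a category $J$ is called formal if it is connected to the functor $H(A)$ by a finite zig-zag of natural transformations of functors $J\to\mathrm{CDGA}$ all of whose components are quasi-isomorphisms. Let $A_{PL}(-;\mathbb K)\colon\mathrm{Top}^{op}\to\mathrm{CDGA}$ be Sullivan's functor of piecewise polynomial forms on the singular simplicial set. A diagram of spaces $F\colon J\to\mathrm{Top}$ is called $\mathbb K$-formal if the functor $A_{PL}(F;\mathbb K)\colon J^{op}\to\mathrm{CDGA}$ is formal; in particular, taking $J=\Delta$, this defines $\mathbb K$-formal cosimplicial spaces. The (Bousfield–Kan) cosimplicial replacement of a diagram $F\colon I\to\mathrm{Top}$ over a small category $I$ is the cosimplicial space $\Pi^\bullet F$ with $$\Pi^nF=\prod_{i_0\leftarrow i_1\leftarrow\cdots\leftarrow i_n}F(i_0),$$ the product being over all strings of $n$ composable morphisms of $I$; for an order-preserving map $\theta\colon[n]\to[m]$,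 the component of $\Pi^nF\to\Pi^mF$ at the string $j_0\leftarrow\cdots\leftarrow j_m$ is the projection onto the factor of the string $j_{\theta(0)}\leftarrow\cdots\leftarrow j_{\theta(n)}$ followed by the map $F(j_{\theta(0)})\to F(j_0)$. Proposition. Let $I$ be a finite category (finitely many objects and morphisms) and let $F\colon I\to\mathrm{Top}$ be a diagram of spaces of finite $\mathbb K$-type, that is, $H^n(F(i);\mathbb K)\cong H^n(A_{PL}(F(i);\mathbb K))$ is finite-dimensional over $\mathbb K$ for every object $i$ of $I$ and every $n\ge 0$. If $F$ is $\mathbb K$-formal, then its cosimplicial replacement $\Pi^\bullet F$ is a $\mathbb K$-formal cosimplicial space. -/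

import Mathlib

open CategoryTheory Opposite

universe w v u

/-- A commutative differential graded algebra over `K`: a `K`-algebra `A = ⨁ₙ Aⁿ` graded by the
natural numbers, commutative in the graded sense, with a differential of degree `+1` that is a
graded derivation. The zero algebra is allowed. -/
structure CDGA (K : Type v) [Field K] where
  carrier : Type w
  [ring : Ring carrier]
  [algebra : Algebra K carrier]
  /-- The homogeneous part of each degree. -/
  gr : ℕ → Submodule K carrier
  isInternal : DirectSum.IsInternal gr
  one_mem : (1 : carrier) ∈ gr 0
  mul_mem : ∀ {m n : ℕ} {a b : carrier}, a ∈ gr m → b ∈ gr n → a * b ∈ gr (m + n)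
  gradedComm : ∀ {m n : ℕ} {a b : carrier}, a ∈ gr m → b ∈ gr n →
    a * b = (-1) ^ (m * n) * (b * a)
  /-- The differential. -/
  d : carrier →ₗ[K] carrier
  d_mem : ∀ {n : ℕ} {a : carrier}, a ∈ gr n → d a ∈ gr (n + 1)
  d_d : ∀ a : carrier, d (d a) = 0
  leibniz : ∀ {m : ℕ} {a : carrier} (b : carrier), a ∈ gr m →
    d (a * b) = d a * b + (-1) ^ m * (a * d b)

namespace CDGA

variable {K : Type v} [Field K]

instance : CoeSort (CDGA.{w} K) (Type w) := ⟨CDGA.carrier⟩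

instance (A : CDGA.{w} K) : Ring A := A.ring

instance (A : CDGA.{w} K) : Algebra K A := A.algebra

/-- A morphism of CDGAs: an algebra map that preserves degrees and commutes with `d`. -/
@[ext]
structure Hom (A B : CDGA.{w} K) where
  toAlgHom : A →ₐ[K] B
  map_gr : ∀ {n : ℕ} {a : A}, a ∈ A.gr n → toAlgHom a ∈ B.gr n
  map_d : ∀ a : A, toAlgHom (A.d a) = B.d (toAlgHom a)

instance : Category (CDGA.{w} K) where
  Hom A B := Hom A B
  id A := ⟨AlgHom.id K A, fun h => h, fun _ => rfl⟩
  comp f g := ⟨g.toAlgHom.comp f.toAlgHom, fun h => g.map_gr (f.map_gr h), fun a => by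
    simp [f.map_d, g.map_d]⟩

@[ext]
theorem hom_ext {A B : CDGA.{w} K} {f g : A ⟶ B} (h : ∀ a : A, f.toAlgHom a = g.toAlgHom a) :
    f = g :=
  Hom.ext (AlgHom.ext h)

@[simp]
theorem id_toAlgHom_apply (A : CDGA.{w} K) (a : A) : Hom.toAlgHom (𝟙 A) a = a := rfl

@[simp]
theorem comp_toAlgHom_apply {A B C : CDGA.{w} K} (f : A ⟶ B) (g : B ⟶ C) (a : A) :
    Hom.toAlgHom (f ≫ g) a = g.toAlgHom (f.toAlgHom a) := rfl

section Cohomology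

variable (A : CDGA.{w} K)

/-- The projection of `A` onto its part of degree `n`. -/
noncomputable def proj (n : ℕ) : A →ₗ[K] A :=
  (A.gr n).subtype ∘ₗ DirectSum.component K ℕ (fun i => A.gr i) n ∘ₗ
    (LinearEquiv.ofBijective (DirectSum.coeLinearMap A.gr) A.isInternal).symm.toLinearMap

theorem proj_coe (x : DirectSum ℕ fun i => A.gr i) (n : ℕ) :
    A.proj n (DirectSum.coeLinearMap A.gr x) = x n := by
  have : (LinearEquiv.ofBijective (DirectSum.coeLinearMap A.gr) A.isInternal).symm
      (DirectSum.coeLinearMap A.gr x) = x :=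
    (LinearEquiv.ofBijective (DirectSum.coeLinearMap A.gr) A.isInternal).symm_apply_apply x
  simp [proj, this, DirectSum.component]
  rfl

theorem proj_mem (n : ℕ) (a : A) : A.proj n a ∈ A.gr n := by
  simp [proj]

theorem proj_same {n : ℕ} {a : A} (h : a ∈ A.gr n) : A.proj n a = a := by
  have := A.proj_coe (DirectSum.lof K ℕ (fun i => A.gr i) n ⟨a, h⟩) n
  simpa using this

theorem proj_ne {m n : ℕ} (hmn : m ≠ n) {a : A} (h : a ∈ A.gr m) : A.proj n a = 0 := by
  have := A.proj_coe (DirectSum.lof K ℕ (fun i => A.gr i) m ⟨a, h⟩) n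
  rw [DirectSum.coeLinearMap_lof] at this
  rw [this, DirectSum.lof_eq_of, DirectSum.of_eq_of_ne _ _ _ hmn.symm]
  rfl

theorem homogeneous_induction {P : A → Prop} (a : A) (h0 : P 0)
    (hm : ∀ n, ∀ a ∈ A.gr n, P a) (hadd : ∀ a b, P a → P b → P (a + b)) : P a := by
  have ha : a ∈ ⨆ n, A.gr n := by
    rw [A.isInternal.submodule_iSup_eq_top]; trivial
  exact Submodule.iSup_induction _ (motive := P) ha hm h0 hadd

theorem d_proj (n : ℕ) (a : A) : A.proj (n + 1) (A.d a) = A.d (A.proj n a) := by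
  induction a using homogeneous_induction with
  | h0 => simp
  | hm m a ha =>
    by_cases h : m = n
    · subst h
      rw [A.proj_same ha, A.proj_same (A.d_mem ha)]
    · rw [A.proj_ne h ha, A.proj_ne (by omega) (A.d_mem ha), map_zero]
  | hadd a b iha ihb => simp [iha, ihb]

theorem proj_zero_d (a : A) : A.proj 0 (A.d a) = 0 := by
  induction a using homogeneous_induction with
  | h0 => simp
  | hm m a ha => exact A.proj_ne (by omega) (A.d_mem ha)
  | hadd a b iha ihb => simp [iha, ihb]

theorem exists_sum_proj (a : A) : ∃ s : Finset ℕ, a = ∑ n ∈ s, A.proj n a := by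
  obtain ⟨x, rfl⟩ := A.isInternal.2 a
  classical
  refine ⟨DFinsupp.support x, ?_⟩
  change DirectSum.coeLinearMap A.gr x = ∑ n ∈ _, A.proj n (DirectSum.coeLinearMap A.gr x)
  simp only [proj_coe]
  rw [DirectSum.coeLinearMap_eq_dfinsuppSum, DFinsupp.sum]

theorem d_mul_of_d_eq_zero (a : A) {b : A} (hb : A.d b = 0) : A.d (a * b) = A.d a * b := by
  induction a using homogeneous_induction with
  | h0 => simp
  | hm m a ha => simp [A.leibniz b ha, hb]
  | hadd a b iha ihb => simp [add_mul, iha, ihb]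

theorem exists_mul_d_eq {a : A} (ha : A.d a = 0) (b : A) : ∃ c : A, A.d c = a * A.d b := by
  obtain ⟨s, hs⟩ := A.exists_sum_proj a
  refine ⟨∑ n ∈ s, (-1 : K) ^ n • (A.proj n a * b), ?_⟩
  conv_rhs => rw [hs, Finset.sum_mul]
  rw [map_sum]
  refine Finset.sum_congr rfl fun n _ => ?_
  rw [map_smul, A.leibniz b (A.proj_mem n a), ← A.d_proj, ha, map_zero, zero_mul, zero_add]
  rcases Nat.even_or_odd n with h' | h' <;> simp [h'.neg_one_pow]

/-- The subalgebra of cocycles of `A`. -/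
def cocycles : Subalgebra K A where
  carrier := {a | A.d a = 0}
  mul_mem' {a b} ha hb := by
    have ha' : A.d a = 0 := ha
    have hb' : A.d b = 0 := hb
    simp [A.d_mul_of_d_eq_zero a hb', ha']
  add_mem' {a b} ha hb := by
    have ha' : A.d a = 0 := ha
    have hb' : A.d b = 0 := hb
    simp [ha', hb']
  algebraMap_mem' r := by
    have h := A.leibniz (1 : A) A.one_mem
    simp only [mul_one, pow_zero, one_mul] at h
    have h1 : A.d 1 = 0 := by simpa using h
    simp [Algebra.algebraMap_eq_smul_one, h1]

theorem mem_cocycles {a : A} : a ∈ A.cocycles ↔ A.d a = 0 := Iff.rfl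

/-- The two-sided ideal of coboundaries in the algebra of cocycles. -/
def coboundaries : Ideal A.cocycles where
  carrier := {z | ∃ b : A, A.d b = z}
  add_mem' := by
    rintro x y ⟨b, hb⟩ ⟨c, hc⟩
    exact ⟨b + c, by simp [hb, hc]⟩
  zero_mem' := ⟨0, by simp⟩
  smul_mem' := by
    rintro z x ⟨b, hb⟩
    obtain ⟨c, hc⟩ := A.exists_mul_d_eq z.2 b
    exact ⟨c, by simp [hc, hb]⟩

theorem mem_coboundaries {z : A.cocycles} : z ∈ A.coboundaries ↔ ∃ b : A, A.d b = z := Iff.rfl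

instance : A.coboundaries.IsTwoSided where
  mul_mem_of_left {x} z := by
    rintro ⟨b, hb⟩
    exact ⟨b * z, by simp [A.d_mul_of_d_eq_zero b z.2, hb]⟩

/-- The homogeneous cocycles of degree `n`. -/
def cocyclesGr (n : ℕ) : Submodule K A.cocycles :=
  (A.gr n).comap A.cocycles.val.toLinearMap

theorem mem_cocyclesGr {n : ℕ} {z : A.cocycles} : z ∈ A.cocyclesGr n ↔ (z : A) ∈ A.gr n := Iff.rfl

/-- The cohomology of `A` in degree `n`: the classes of the cocycles of degree `n`. -/
def cohomologyGr (n : ℕ) : Submodule K (A.cocycles ⧸ A.coboundaries) :=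
  (A.cocyclesGr n).map (Ideal.Quotient.mkₐ K A.coboundaries).toLinearMap

theorem mem_cohomologyGr {n : ℕ} {q : A.cocycles ⧸ A.coboundaries} :
    q ∈ A.cohomologyGr n ↔
      ∃ z : A.cocycles, (z : A) ∈ A.gr n ∧ Ideal.Quotient.mk A.coboundaries z = q := Iff.rfl

theorem proj_mem_cocycles (n : ℕ) {a : A} (ha : a ∈ A.cocycles) : A.proj n a ∈ A.cocycles := by
  rw [mem_cocycles] at ha ⊢
  rw [← A.d_proj, ha, map_zero]

theorem iSup_cocyclesGr : ⨆ n, A.cocyclesGr n = ⊤ := by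
  rw [eq_top_iff]
  rintro z -
  obtain ⟨s, hs⟩ := A.exists_sum_proj z
  have : z = ∑ n ∈ s, (⟨A.proj n z, A.proj_mem_cocycles n z.2⟩ : A.cocycles) := by
    apply Subtype.ext
    simpa using hs
  rw [this]
  exact Submodule.sum_mem _ fun n _ =>
    Submodule.mem_iSup_of_mem n (A.mem_cocyclesGr.2 (A.proj_mem n _))

theorem cohomologyGr_isInternal : DirectSum.IsInternal A.cohomologyGr := by
  refine DirectSum.isInternal_submodule_of_iSupIndep_of_iSup_eq_top ?_ ?_
  · rw [iSupIndep_def]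
    intro i
    rw [Submodule.disjoint_def]
    rintro q ⟨z, hz, rfl⟩ hq
    simp only [cohomologyGr, ← Submodule.map_iSup] at hq
    obtain ⟨y, hy, hyz⟩ := hq
    have hpy : A.proj i y = 0 := by
      have : (⨆ j, ⨆ (_ : j ≠ i), A.cocyclesGr j) ≤
          LinearMap.ker (A.proj i ∘ₗ A.cocycles.val.toLinearMap) := by
        refine iSup₂_le fun j hj x hx => ?_
        exact A.proj_ne hj hx
      exact this hy
    have hB : y - z ∈ A.coboundaries := Ideal.Quotient.eq.1 hyz
    obtain ⟨b, hb⟩ := hB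
    have hz' : A.proj i z = z := A.proj_same hz
    have hb' : A.d b = (y : A) - z := by simpa using hb
    have key : (z : A) = - A.proj i (A.d b) := by
      rw [hb', map_sub, hpy, hz']; simp
    refine Ideal.Quotient.eq_zero_iff_mem.2 ?_
    rw [mem_coboundaries]
    cases i with
    | zero => exact ⟨0, by rw [key, A.proj_zero_d]; simp⟩
    | succ i => exact ⟨- A.proj i b, by rw [key, A.d_proj]; simp⟩
  · change ⨆ n, (A.cocyclesGr n).map (Ideal.Quotient.mkₐ K A.coboundaries).toLinearMap = ⊤
    rw [← Submodule.map_iSup, iSup_cocyclesGr, Submodule.map_top]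
    exact LinearMap.range_eq_top.2 Ideal.Quotient.mk_surjective

/-- The cohomology algebra `H(A)` (cocycles modulo coboundaries), as a CDGA with zero
differential. -/
def cohomology : CDGA.{w} K where
  carrier := A.cocycles ⧸ A.coboundaries
  gr := A.cohomologyGr
  isInternal := A.cohomologyGr_isInternal
  one_mem := ⟨1, A.one_mem, rfl⟩
  mul_mem := by
    rintro m n _ _ ⟨x, hx, rfl⟩ ⟨y, hy, rfl⟩
    exact ⟨x * y, A.mul_mem hx hy, rfl⟩
  gradedComm := by
    rintro m n _ _ ⟨x, hx, rfl⟩ ⟨y, hy, rfl⟩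
    have : x * y = (-1) ^ (m * n) * (y * x) := Subtype.ext (by
      simpa using A.gradedComm hx hy)
    exact congrArg (Ideal.Quotient.mkₐ K A.coboundaries) this |>.trans (by simp)
  d := 0
  d_mem _ := Submodule.zero_mem _
  d_d _ := rfl
  leibniz := by intros; simp

end Cohomology

/-- The algebra map induced on cohomology by a morphism of CDGAs. -/
def cohomologyMap {A B : CDGA.{w} K} (f : A ⟶ B) :
    (A.cocycles ⧸ A.coboundaries) →ₐ[K] (B.cocycles ⧸ B.coboundaries) :=
  Ideal.Quotient.liftₐ A.coboundaries
    ((Ideal.Quotient.mkₐ K B.coboundaries).comp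
      ((f.toAlgHom.comp A.cocycles.val).codRestrict B.cocycles fun z => by
        have hz : A.d z = 0 := z.2
        simp [mem_cocycles, ← f.map_d, hz]))
    (by
      rintro z ⟨b, hb⟩
      exact Ideal.Quotient.eq_zero_iff_mem.2
        ⟨f.toAlgHom b, (f.map_d b).symm.trans (congrArg f.toAlgHom hb)⟩)

/-- The functor sending a CDGA to its cohomology algebra, with zero differential. -/
def cohomologyFunctor (K : Type v) [Field K] : CDGA.{w} K ⥤ CDGA.{w} K where
  obj A := A.cohomology
  map f :=
    { toAlgHom := cohomologyMap f
      map_gr := by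
        rintro n _ ⟨z, hz, rfl⟩
        exact ⟨_, f.map_gr hz, rfl⟩
      map_d := fun _ => (map_zero (cohomologyMap f)) }
  map_id A := by
    refine hom_ext fun q => ?_
    obtain ⟨z, rfl⟩ := Ideal.Quotient.mk_surjective q
    rfl
  map_comp f g := by
    refine hom_ext fun q => ?_
    obtain ⟨z, rfl⟩ := Ideal.Quotient.mk_surjective q
    rfl

/-- A quasi-isomorphism: a morphism that is bijective on cohomology. -/
def IsQuasiIso {A B : CDGA.{w} K} (f : A ⟶ B) : Prop :=
  Function.Bijective ((cohomologyFunctor K).map f).toAlgHom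

section Diagrams

variable {J : Type*} [Category J]

/-- One natural quasi-isomorphism between two diagrams of CDGAs. -/
def NatQuasiIso (A B : J ⥤ CDGA.{w} K) : Prop :=
  ∃ η : A ⟶ B, ∀ j, IsQuasiIso (η.app j)

/-- A diagram of CDGAs is formal if a finite zig-zag of natural quasi-isomorphisms, through
diagrams of CDGAs of the same shape, connects it to its cohomology. -/
def IsFormal (A : J ⥤ CDGA.{w} K) : Prop :=
  Relation.EqvGen NatQuasiIso A (A ⋙ cohomologyFunctor K)

end Diagrams

end CDGA
namespace PolyForms

section
variable (K : Type v) [Field K] (n : ℕ)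

/-- The generator `tᵢ` of the free algebra. -/
abbrev freeT (i : Fin (n + 1)) : FreeAlgebra K (Fin (n + 1) ⊕ Fin (n + 1)) :=
  FreeAlgebra.ι K (Sum.inl i)

/-- The generator `dtᵢ` of the free algebra. -/
abbrev freeDT (i : Fin (n + 1)) : FreeAlgebra K (Fin (n + 1) ⊕ Fin (n + 1)) :=
  FreeAlgebra.ι K (Sum.inr i)

/-- The relations between the barycentric coordinates `tᵢ` and their differentials `dtᵢ`: graded
commutativity, `t₀ + ⋯ + tₙ = 1` and `dt₀ + ⋯ + dtₙ = 0`. -/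
inductive Rel : FreeAlgebra K (Fin (n + 1) ⊕ Fin (n + 1)) →
    FreeAlgebra K (Fin (n + 1) ⊕ Fin (n + 1)) → Prop
  | t_t (i j : Fin (n + 1)) : Rel (freeT K n i * freeT K n j) (freeT K n j * freeT K n i)
  | t_dt (i j : Fin (n + 1)) : Rel (freeT K n i * freeDT K n j) (freeDT K n j * freeT K n i)
  | dt_dt (i j : Fin (n + 1)) :
      Rel (freeDT K n i * freeDT K n j) (-(freeDT K n j * freeDT K n i))
  | sum_t : Rel (∑ i, freeT K n i) 1
  | sum_dt : Rel (∑ i, freeDT K n i) 0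

end

end PolyForms

/-- The algebra of polynomial differential forms on the standard `n`-simplex, over a field `K` of
characteristic zero: the free graded commutative algebra on `t₀, …, tₙ` (degree `0`) and
`dt₀, …, dtₙ` (degree `1`), modulo `∑ tᵢ = 1` and `∑ dtᵢ = 0`. -/
def PolyForms (K : Type v) [Field K] (n : ℕ) : Type v :=
  RingQuot (PolyForms.Rel K n)

namespace PolyForms

variable {K : Type v} [Field K] {n : ℕ}

noncomputable instance : Ring (PolyForms K n) := inferInstanceAs (Ring (RingQuot (Rel K n)))

noncomputable instance : Algebra K (PolyForms K n) :=
  inferInstanceAs (Algebra K (RingQuot (Rel K n)))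

/-- The quotient map from the free algebra. -/
noncomputable def mk : FreeAlgebra K (Fin (n + 1) ⊕ Fin (n + 1)) →ₐ[K] PolyForms K n :=
  RingQuot.mkAlgHom K (Rel K n)

/-- The barycentric coordinate `tᵢ`. -/
noncomputable def t (i : Fin (n + 1)) : PolyForms K n := mk (freeT K n i)

/-- The one-form `dtᵢ`. -/
noncomputable def dt (i : Fin (n + 1)) : PolyForms K n := mk (freeDT K n i)

theorem mk_rel {x y : FreeAlgebra K (Fin (n + 1) ⊕ Fin (n + 1))} (h : Rel K n x y) :
    (mk x : PolyForms K n) = mk y :=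
  RingQuot.mkAlgHom_rel K h

theorem t_mul_t (i j : Fin (n + 1)) : (t i * t j : PolyForms K n) = t j * t i := by
  simpa [t] using mk_rel (Rel.t_t (K := K) i j)

theorem t_mul_dt (i j : Fin (n + 1)) : (t i * dt j : PolyForms K n) = dt j * t i := by
  simpa [t, dt] using mk_rel (Rel.t_dt (K := K) i j)

theorem dt_mul_dt (i j : Fin (n + 1)) : (dt i * dt j : PolyForms K n) = -(dt j * dt i) := by
  simpa [dt] using mk_rel (Rel.dt_dt (K := K) i j)

theorem sum_t : ∑ i, (t i : PolyForms K n) = 1 := by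
  simpa [t] using mk_rel (Rel.sum_t (K := K) (n := n))

theorem sum_dt : ∑ i, (dt i : PolyForms K n) = 0 := by
  simpa [dt] using mk_rel (Rel.sum_dt (K := K) (n := n))

@[elab_as_elim]
theorem induction {P : PolyForms K n → Prop} (ω : PolyForms K n)
    (halg : ∀ r : K, P (algebraMap K _ r)) (ht : ∀ i, P (t i)) (hdt : ∀ i, P (dt i))
    (hmul : ∀ a b, P a → P b → P (a * b)) (hadd : ∀ a b, P a → P b → P (a + b)) : P ω := by
  obtain ⟨x, rfl⟩ : ∃ x, mk x = ω := RingQuot.mkAlgHom_surjective K (Rel K n) ω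
  induction x using FreeAlgebra.induction with
  | grade0 r => simpa using halg r
  | grade1 i => exact i.casesOn ht hdt
  | mul a b ha hb => simpa using hmul _ _ ha hb
  | add a b ha hb => simpa using hadd _ _ ha hb

/-- The universal property of the algebra of polynomial forms. -/
noncomputable def lift {B : Type*} [Ring B] [Algebra K B] (T D : Fin (n + 1) → B)
    (hTT : ∀ i j, T i * T j = T j * T i) (hTD : ∀ i j, T i * D j = D j * T i)
    (hDD : ∀ i j, D i * D j = -(D j * D i)) (hT : ∑ i, T i = 1) (hD : ∑ i, D i = 0) :
    PolyForms K n →ₐ[K] B :=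
  RingQuot.liftAlgHom K ⟨FreeAlgebra.lift K (Sum.elim T D), by
    rintro _ _ (⟨i, j⟩ | ⟨i, j⟩ | ⟨i, j⟩ | _ | _)
    · simpa using hTT i j
    · simpa using hTD i j
    · simpa using hDD i j
    · simpa using hT
    · simpa using hD⟩

section lift

variable {B : Type*} [Ring B] [Algebra K B] {T D : Fin (n + 1) → B}
    (hTT : ∀ i j, T i * T j = T j * T i) (hTD : ∀ i j, T i * D j = D j * T i)
    (hDD : ∀ i j, D i * D j = -(D j * D i)) (hT : ∑ i, T i = 1) (hD : ∑ i, D i = 0)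

@[simp]
theorem lift_t (i : Fin (n + 1)) : lift (K := K) T D hTT hTD hDD hT hD (t i) = T i := by
  have := RingQuot.liftAlgHom_mkAlgHom_apply K (FreeAlgebra.lift K (Sum.elim T D))
    (s := Rel K n) (by
      rintro _ _ (⟨i, j⟩ | ⟨i, j⟩ | ⟨i, j⟩ | _ | _)
      · simpa using hTT i j
      · simpa using hTD i j
      · simpa using hDD i j
      · simpa using hT
      · simpa using hD) (freeT K n i)
  exact this.trans (by simp)

@[simp]
theorem lift_dt (i : Fin (n + 1)) : lift (K := K) T D hTT hTD hDD hT hD (dt i) = D i := by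
  have := RingQuot.liftAlgHom_mkAlgHom_apply K (FreeAlgebra.lift K (Sum.elim T D))
    (s := Rel K n) (by
      rintro _ _ (⟨i, j⟩ | ⟨i, j⟩ | ⟨i, j⟩ | _ | _)
      · simpa using hTT i j
      · simpa using hTD i j
      · simpa using hDD i j
      · simpa using hT
      · simpa using hD) (freeDT K n i)
  exact this.trans (by simp)

end lift

theorem algHom_ext {B : Type*} [Ring B] [Algebra K B] {f g : PolyForms K n →ₐ[K] B}
    (ht : ∀ i, f (t i) = g (t i)) (hdt : ∀ i, f (dt i) = g (dt i)) : f = g := by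
  ext ω
  induction ω using PolyForms.induction with
  | halg r => simp
  | ht i => exact ht i
  | hdt i => exact hdt i
  | hmul a b ha hb => simp [ha, hb]
  | hadd a b ha hb => simp [ha, hb]

/-- The grading involution, equal to `(-1)ᵖ` on `p`-forms. -/
noncomputable def invol : PolyForms K n →ₐ[K] PolyForms K n :=
  lift t (fun i => -dt i) t_mul_t (by simp [t_mul_dt]) (fun i j => by simpa using dt_mul_dt i j)
    sum_t (by simp [sum_dt])

@[simp] theorem invol_t (i : Fin (n + 1)) : invol (t i : PolyForms K n) = t i := by simp [invol]

@[simp] theorem invol_dt (i : Fin (n + 1)) : invol (dt i : PolyForms K n) = -dt i := by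
  simp [invol]

/-- The algebra map `ω ↦ !![invol ω, d ω; 0, ω]`. Multiplicativity of this map is the graded
Leibniz rule for `d`. -/
noncomputable def dMatrix : PolyForms K n →ₐ[K] Matrix (Fin 2) (Fin 2) (PolyForms K n) :=
  lift (fun i => !![t i, dt i; 0, t i]) (fun i => !![-dt i, 0; 0, dt i])
    (fun i j => by
      simp [t_mul_t i j, t_mul_dt i j, ← t_mul_dt j i, add_comm])
    (fun i j => by simp [t_mul_dt, dt_mul_dt i j])
    (fun i j => by
      rw [Matrix.mul_fin_two, Matrix.mul_fin_two]
      ext a b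
      fin_cases a <;> fin_cases b <;> simp [dt_mul_dt i j])
    (by
      ext a b
      fin_cases a <;> fin_cases b <;> simp [Matrix.sum_apply, sum_t, sum_dt])
    (by
      ext a b
      fin_cases a <;> fin_cases b <;> simp [Matrix.sum_apply, sum_dt])

/-- The exterior differential: the graded derivation with `d tᵢ = dtᵢ` and `d dtᵢ = 0`. -/
noncomputable def d : PolyForms K n →ₗ[K] PolyForms K n where
  toFun ω := dMatrix ω 0 1
  map_add' a b := by simp
  map_smul' r a := by simp

theorem dMatrix_eq (ω : PolyForms K n) : dMatrix ω = !![invol ω, d ω; 0, ω] := by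
  have h : dMatrix ω 0 0 = invol ω ∧ dMatrix ω 1 0 = 0 ∧ dMatrix ω 1 1 = ω := by
    induction ω using PolyForms.induction with
    | halg r => simp [Matrix.algebraMap_matrix_apply]
    | ht i => simp [dMatrix]
    | hdt i => simp [dMatrix]
    | hmul a b ha hb => simp [Matrix.mul_apply, ha, hb]
    | hadd a b ha hb => simp [ha, hb]
  ext a b
  fin_cases a <;> fin_cases b
  · exact h.1
  · rfl
  · exact h.2.1
  · exact h.2.2

@[simp] theorem d_t (i : Fin (n + 1)) : d (t i : PolyForms K n) = dt i := by simp [d, dMatrix]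

@[simp] theorem d_dt (i : Fin (n + 1)) : d (dt i : PolyForms K n) = 0 := by simp [d, dMatrix]

@[simp] theorem d_algebraMap (r : K) : d (algebraMap K (PolyForms K n) r) = 0 := by
  simp [d, Matrix.algebraMap_matrix_apply]

theorem d_mul (a b : PolyForms K n) : d (a * b) = d a * b + invol a * d b := by
  have h := congrFun (congrFun (map_mul dMatrix a b) 0) 1
  rw [dMatrix_eq, dMatrix_eq, dMatrix_eq] at h
  simpa [Matrix.mul_fin_two, add_comm] using h

theorem invol_invol (ω : PolyForms K n) : invol (invol ω) = ω := by
  induction ω using PolyForms.induction with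
  | halg r => simp
  | ht i => simp
  | hdt i => simp
  | hmul a b ha hb => simp [ha, hb]
  | hadd a b ha hb => simp [ha, hb]

theorem d_invol (ω : PolyForms K n) : d (invol ω) = -invol (d ω) := by
  induction ω using PolyForms.induction with
  | halg r => simp
  | ht i => simp
  | hdt i => simp
  | hmul a b ha hb => simp [d_mul, ha, hb, add_comm]
  | hadd a b ha hb => simp [ha, hb, add_comm]

theorem d_d (ω : PolyForms K n) : d (d ω) = 0 := by
  induction ω using PolyForms.induction with
  | halg r => simp
  | ht i => simp
  | hdt i => simp
  | hmul a b ha hb => simp [d_mul, d_invol, ha, hb]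
  | hadd a b ha hb => simp [ha, hb]

/-- The polynomial functions on the simplex, the subalgebra generated by the `tᵢ`. -/
noncomputable def functions (K : Type v) [Field K] (n : ℕ) : Subalgebra K (PolyForms K n) :=
  Algebra.adjoin K (Set.range t)

/-- The `K`-span of the `dtᵢ`. -/
noncomputable def constOneForms (K : Type v) [Field K] (n : ℕ) : Submodule K (PolyForms K n) :=
  Submodule.span K (Set.range dt)

/-- The `p`-forms: the sums of products `f dt_{i₁} ⋯ dt_{iₚ}` with `f` a polynomial function. -/
noncomputable def gr (K : Type v) [Field K] (n p : ℕ) : Submodule K (PolyForms K n) :=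
  Subalgebra.toSubmodule (functions K n) * constOneForms K n ^ p

theorem commute_functions {f : PolyForms K n} (hf : f ∈ functions K n) (ω : PolyForms K n) :
    f * ω = ω * f := by
  have ht : ∀ i, (t i : PolyForms K n) * ω = ω * t i := by
    intro i
    induction ω using PolyForms.induction with
    | halg r => exact (Algebra.commutes r _).symm
    | ht j => exact t_mul_t i j
    | hdt j => exact t_mul_dt i j
    | hmul a b ha hb => rw [← mul_assoc, ha, mul_assoc, hb, mul_assoc]
    | hadd a b ha hb => rw [mul_add, add_mul, ha, hb]
  induction hf using Algebra.adjoin_induction with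
  | mem x hx => obtain ⟨i, rfl⟩ := hx; exact ht i
  | algebraMap r => exact Algebra.commutes r _
  | add x y _ _ hx hy => rw [mul_add, add_mul, hx, hy]
  | mul x y _ _ hx hy => rw [mul_assoc, hy, ← mul_assoc, hx, mul_assoc]

theorem functions_mul_comm (M : Submodule K (PolyForms K n)) :
    Subalgebra.toSubmodule (functions K n) * M = M * Subalgebra.toSubmodule (functions K n) :=
  Submodule.mul_comm_of_commute fun _ hf ω _ => commute_functions hf ω

theorem gr_mul_gr (p q : ℕ) : gr K n p * gr K n q = gr K n (p + q) := by
  rw [gr, gr, gr, pow_add]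
  calc _ = Subalgebra.toSubmodule (functions K n) * (constOneForms K n ^ p *
        Subalgebra.toSubmodule (functions K n)) * constOneForms K n ^ q := by
          simp only [mul_assoc]
    _ = _ := by
      rw [← functions_mul_comm, ← mul_assoc, Subalgebra.isIdempotentElem_toSubmodule (functions K n), mul_assoc]

theorem mul_mem_gr {p q : ℕ} {a b : PolyForms K n} (ha : a ∈ gr K n p) (hb : b ∈ gr K n q) :
    a * b ∈ gr K n (p + q) := by
  rw [← gr_mul_gr]; exact Submodule.mul_mem_mul ha hb

theorem functions_le_gr : Subalgebra.toSubmodule (functions K n) ≤ gr K n 0 := by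
  rw [gr, pow_zero, mul_one]

theorem one_mem_gr : (1 : PolyForms K n) ∈ gr K n 0 :=
  functions_le_gr (one_mem (functions K n))

theorem t_mem_gr (i : Fin (n + 1)) : (t i : PolyForms K n) ∈ gr K n 0 :=
  functions_le_gr (Algebra.subset_adjoin ⟨i, rfl⟩)

theorem dt_mem_gr (i : Fin (n + 1)) : (dt i : PolyForms K n) ∈ gr K n 1 := by
  rw [gr, pow_one, ← one_mul (dt i)]
  exact Submodule.mul_mem_mul (one_mem (functions K n)) (Submodule.subset_span ⟨i, rfl⟩)

@[elab_as_elim]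
theorem gr_induction {P : (p : ℕ) → (ω : PolyForms K n) → ω ∈ gr K n p → Prop}
    (hf : ∀ f (hf : f ∈ functions K n), P 0 f (functions_le_gr hf))
    (hdt : ∀ p a i (ha : a ∈ gr K n p), P p a ha →
      P (p + 1) (a * dt i) (mul_mem_gr ha (dt_mem_gr i)))
    (hadd : ∀ p a b (ha : a ∈ gr K n p) (hb : b ∈ gr K n p), P p a ha → P p b hb →
      P p (a + b) (add_mem ha hb))
    (hsmul : ∀ p (r : K) a (ha : a ∈ gr K n p), P p a ha →
      P p (r • a) (Submodule.smul_mem _ r ha)) {p : ℕ} {ω : PolyForms K n}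
    (hω : ω ∈ gr K n p) : P p ω hω := by
  have hz : ∀ p, P p 0 (zero_mem _) := by
    intro p
    induction p with
    | zero => exact hf 0 (zero_mem _)
    | succ p ih => simpa using hdt p 0 0 (zero_mem _) ih
  induction p generalizing ω with
  | zero =>
    have hω' := hω
    rw [gr, pow_zero, mul_one] at hω'
    exact hf ω hω'
  | succ p ih =>
    suffices h : ∃ h, P (p + 1) ω h from h.2
    rw [gr, pow_succ, ← mul_assoc] at hω
    induction hω using Submodule.mul_induction_on' with
    | mem_mul_mem a ha b hb =>
      induction hb using Submodule.span_induction with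
      | mem x hx => obtain ⟨i, rfl⟩ := hx; exact ⟨_, hdt p a i ha (ih ha)⟩
      | zero => rw [mul_zero]; exact ⟨_, hz _⟩
      | add x y _ _ hx hy => rw [mul_add]; exact ⟨_, hadd _ _ _ _ _ hx.2 hy.2⟩
      | smul r x _ hx => rw [mul_smul_comm]; exact ⟨_, hsmul _ _ _ _ hx.2⟩
    | add x _ y _ hx hy => exact ⟨_, hadd _ _ _ _ _ hx.2 hy.2⟩

theorem invol_of_mem {p : ℕ} {a : PolyForms K n} (ha : a ∈ gr K n p) :
    invol a = (-1) ^ p * a := by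
  induction ha using gr_induction with
  | hf f hf =>
    simp only [pow_zero, one_mul]
    induction hf using Algebra.adjoin_induction with
    | mem x hx => obtain ⟨i, rfl⟩ := hx; simp
    | algebraMap r => simp
    | add x y _ _ hx hy => simp [hx, hy]
    | mul x y _ _ hx hy => simp [hx, hy]
  | hdt p a i _ ih => simp [ih, pow_succ, mul_assoc]
  | hadd p a b _ _ iha ihb => simp [iha, ihb, mul_add]
  | hsmul p r a _ ih => simp [ih]

theorem dt_mul_of_mem {p : ℕ} {a : PolyForms K n} (i : Fin (n + 1)) (ha : a ∈ gr K n p) :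
    dt i * a = (-1) ^ p * (a * dt i) := by
  induction ha using gr_induction with
  | hf f hf => simp [commute_functions hf]
  | hdt p a j _ ih =>
    rw [← mul_assoc, ih, mul_assoc, mul_assoc a, dt_mul_dt i j, pow_succ]
    simp [mul_assoc]
  | hadd p a b _ _ iha ihb => simp [iha, ihb, mul_add, add_mul]
  | hsmul p r a _ ih => simp [ih]

theorem gradedComm {p q : ℕ} {a b : PolyForms K n} (ha : a ∈ gr K n p) (hb : b ∈ gr K n q) :
    a * b = (-1) ^ (p * q) * (b * a) := by
  induction ha using gr_induction with
  | hf f hf => simp [commute_functions hf]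
  | hdt p a i _ ih =>
    rw [mul_assoc, dt_mul_of_mem i hb]
    rcases neg_one_pow_eq_or (PolyForms K n) q with h | h
    · rw [h, one_mul, ← mul_assoc, ih, add_mul, pow_add, one_mul, h]
      simp [mul_assoc]
    · rw [h, neg_one_mul, mul_neg, ← mul_assoc, ih, add_mul, pow_add, one_mul, h]
      simp [mul_assoc]
  | hadd p a a' _ _ iha ihb => simp [iha, ihb, mul_add, add_mul]
  | hsmul p r a _ ih => simp [ih]

theorem d_mem_gr {p : ℕ} {a : PolyForms K n} (ha : a ∈ gr K n p) : d a ∈ gr K n (p + 1) := by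
  induction ha using gr_induction with
  | hf f hf =>
    induction hf using Algebra.adjoin_induction with
    | mem x hx => obtain ⟨i, rfl⟩ := hx; simpa using dt_mem_gr i
    | algebraMap r => simp
    | add x y _ _ hx hy => rw [map_add]; exact add_mem hx hy
    | mul x y hx' hy' hx hy =>
      rw [d_mul, invol_of_mem (functions_le_gr hx')]
      refine add_mem ?_ ?_
      · simpa using mul_mem_gr hx (functions_le_gr hy')
      · simpa using mul_mem_gr (functions_le_gr hx') hy
  | hdt p a i ha ih =>
    rw [d_mul, d_dt, mul_zero, add_zero]
    exact mul_mem_gr ih (dt_mem_gr i)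
  | hadd p a b _ _ iha ihb => rw [map_add]; exact add_mem iha ihb
  | hsmul p r a _ ih => rw [map_smul]; exact Submodule.smul_mem _ _ ih

/-- The algebra map that multiplies each `p`-form by `Xᵖ`; it separates the degrees. -/
noncomputable def weight : PolyForms K n →ₐ[K] Polynomial (PolyForms K n) :=
  lift (fun i => Polynomial.C (t i)) (fun i => Polynomial.C (dt i) * Polynomial.X)
    (fun i j => by rw [← Polynomial.C_mul, t_mul_t, Polynomial.C_mul])
    (fun i j => by
      rw [← mul_assoc, ← Polynomial.C_mul, t_mul_dt, Polynomial.C_mul, mul_assoc, mul_assoc,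
        Polynomial.X_mul_C])
    (fun i j => by
      have h : ∀ i j : Fin (n + 1), (Polynomial.C (dt i) * Polynomial.X *
          (Polynomial.C (dt j) * Polynomial.X) : Polynomial (PolyForms K n)) =
          Polynomial.C (dt i * dt j) * Polynomial.X ^ 2 := by
        intro i j
        rw [mul_assoc, ← mul_assoc Polynomial.X, Polynomial.X_mul_C, mul_assoc, ← mul_assoc,
          ← Polynomial.C_mul, sq]
      rw [h, h, dt_mul_dt i j, Polynomial.C_neg, neg_mul])
    (by rw [← map_sum, sum_t, Polynomial.C_1])
    (by rw [← Finset.sum_mul, ← map_sum, sum_dt, Polynomial.C_0, zero_mul])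

theorem weight_of_mem {p : ℕ} {a : PolyForms K n} (ha : a ∈ gr K n p) :
    weight a = Polynomial.monomial p a := by
  induction ha using gr_induction with
  | hf f hf =>
    rw [Polynomial.monomial_zero_left]
    induction hf using Algebra.adjoin_induction with
    | mem x hx => obtain ⟨i, rfl⟩ := hx; simp [weight]
    | algebraMap r => simp
    | add x y _ _ hx hy => simp [hx, hy]
    | mul x y _ _ hx hy => simp [hx, hy]
  | hdt p a i _ ih =>
    rw [map_mul, ih, weight, lift_dt, ← Polynomial.monomial_one_one_eq_X,
      Polynomial.C_mul_monomial, Polynomial.monomial_mul_monomial, mul_one]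
  | hadd p a b _ _ iha ihb => simp [iha, ihb]
  | hsmul p r a _ ih => rw [map_smul, ih, Polynomial.smul_monomial]

/-- The component of degree `p` of a form. -/
noncomputable def proj (p : ℕ) : PolyForms K n →ₗ[K] PolyForms K n where
  toFun ω := (weight ω).coeff p
  map_add' a b := by simp
  map_smul' r a := by simp

theorem proj_same {p : ℕ} {a : PolyForms K n} (ha : a ∈ gr K n p) : proj p a = a := by
  change (weight a).coeff p = a
  rw [weight_of_mem ha]; simp

theorem proj_ne {p q : ℕ} (h : p ≠ q) {a : PolyForms K n} (ha : a ∈ gr K n p) :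
    proj q a = 0 := by
  change (weight a).coeff q = 0
  rw [weight_of_mem ha, Polynomial.coeff_monomial, if_neg h]

/-- The pullback of forms along the affine map of simplices `Δᵐ → Δⁿ` that sends the vertex `j`
to the vertex `θ j`: `tᵢ ↦ ∑_{θ j = i} tⱼ` and `dtᵢ ↦ ∑_{θ j = i} dtⱼ`. -/
noncomputable def pullback {m : ℕ} (θ : Fin (m + 1) → Fin (n + 1)) :
    PolyForms K n →ₐ[K] PolyForms K m :=
  lift (fun i => ∑ j with θ j = i, t j) (fun i => ∑ j with θ j = i, dt j)
    (fun i j => by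
      rw [Finset.sum_mul_sum, Finset.sum_mul_sum, Finset.sum_comm]
      simp only [t_mul_t])
    (fun i j => by
      rw [Finset.sum_mul_sum, Finset.sum_mul_sum, Finset.sum_comm]
      simp only [t_mul_dt])
    (fun i j => by
      rw [Finset.sum_mul_sum, Finset.sum_mul_sum, Finset.sum_comm, ← Finset.sum_neg_distrib]
      refine Finset.sum_congr rfl fun a _ => ?_
      rw [← Finset.sum_neg_distrib]
      exact Finset.sum_congr rfl fun b _ => dt_mul_dt _ _)
    (by rw [Finset.sum_fiberwise, sum_t])
    (by rw [Finset.sum_fiberwise, sum_dt])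

section pullback

variable {m : ℕ} (θ : Fin (m + 1) → Fin (n + 1))

@[simp] theorem pullback_t (i : Fin (n + 1)) :
    pullback θ (t i : PolyForms K n) = ∑ j with θ j = i, t j := by simp [pullback]

@[simp] theorem pullback_dt (i : Fin (n + 1)) :
    pullback θ (dt i : PolyForms K n) = ∑ j with θ j = i, dt j := by simp [pullback]

theorem pullback_id : pullback (K := K) (id : Fin (n + 1) → Fin (n + 1)) = AlgHom.id K _ :=
  algHom_ext (fun i => by simp [Finset.filter_eq']) (fun i => by simp [Finset.filter_eq'])

theorem pullback_pullback {l : ℕ} (ψ : Fin (l + 1) → Fin (m + 1)) (ω : PolyForms K n) :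
    pullback ψ (pullback θ ω) = pullback (θ ∘ ψ) ω := by
  have : ∀ (x : ∀ {k : ℕ}, Fin (k + 1) → PolyForms K k) (i : Fin (n + 1)),
      ∑ j with θ j = i, ∑ k with ψ k = j, (x k : PolyForms K l) =
        ∑ k with (θ ∘ ψ) k = i, x k := by
    intro x i
    rw [Finset.sum_comm' (t' := {k | (θ ∘ ψ) k = i}) (s' := fun k => {ψ k})]
    · simp
    · intro j k
      simp only [Finset.mem_filter_univ, Finset.mem_singleton, Function.comp_apply]
      constructor
      · rintro ⟨h1, h2⟩; exact ⟨h2.symm, by rw [h2, h1]⟩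
      · rintro ⟨h1, h2⟩; exact ⟨by rw [h1, h2], h1.symm⟩
  have h : (pullback ψ).comp (pullback θ) = pullback (K := K) (θ ∘ ψ) :=
    algHom_ext (fun i => by simpa using this t i) (fun i => by simpa using this dt i)
  exact DFunLike.congr_fun h ω

theorem pullback_invol (ω : PolyForms K n) :
    pullback θ (invol ω) = invol (pullback θ ω) := by
  induction ω using PolyForms.induction with
  | halg r => simp
  | ht i => simp
  | hdt i => simp
  | hmul a b ha hb => simp [ha, hb]
  | hadd a b ha hb => simp [ha, hb]

theorem pullback_d (ω : PolyForms K n) : pullback θ (d ω) = d (pullback θ ω) := by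
  induction ω using PolyForms.induction with
  | halg r => simp
  | ht i => simp
  | hdt i => simp
  | hmul a b ha hb => simp [d_mul, ha, hb, pullback_invol]
  | hadd a b ha hb => simp [ha, hb]

end pullback

end PolyForms

namespace APL

variable (K : Type v) [Field K] (X : SSet.{u})

/-- Families of polynomial forms, one on each simplex of `X`, without any compatibility. -/
abbrev Families : Type (max u v) :=
  (a : SimplexCategory) → X.obj (op a) → PolyForms K a.len

/-- The space `A_PL^p(X)` of polynomial `p`-forms on a simplicial set: families of polynomial
`p`-forms, one on each simplex, compatible with all simplicial operators (equivalently, the maps of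
simplicial sets from `X` to the simplicial set of polynomial `p`-forms on standard simplices). -/
noncomputable def gr (p : ℕ) : Submodule K (Families K X) where
  carrier := {f | (∀ a x, f a x ∈ PolyForms.gr K a.len p) ∧
    ∀ (a b : SimplexCategory) (θ : a ⟶ b) (x : X.obj (op b)),
      f a (X.map θ.op x) = PolyForms.pullback θ.toOrderHom (f b x)}
  add_mem' {f g} hf hg := ⟨fun a x => add_mem (hf.1 a x) (hg.1 a x), fun a b θ x => by
    simp [hf.2 a b θ x, hg.2 a b θ x]⟩
  zero_mem' := ⟨fun _ _ => zero_mem _, fun _ _ _ _ => by simp⟩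
  smul_mem' r f hf := ⟨fun a x => Submodule.smul_mem _ r (hf.1 a x), fun a b θ x => by
    simp [hf.2 a b θ x]⟩

variable {K X}

theorem one_mem_gr : (1 : Families K X) ∈ gr K X 0 :=
  ⟨fun _ _ => PolyForms.one_mem_gr, fun _ _ _ _ => by simp⟩

theorem mul_mem_gr {p q : ℕ} {f g : Families K X} (hf : f ∈ gr K X p) (hg : g ∈ gr K X q) :
    f * g ∈ gr K X (p + q) :=
  ⟨fun a x => PolyForms.mul_mem_gr (hf.1 a x) (hg.1 a x), fun a b θ x => by
    simp [hf.2 a b θ x, hg.2 a b θ x]⟩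

variable (K X) in
/-- The algebra `⨁ₚ A_PL^p(X)`, realized as the finite sums of homogeneous forms. -/
noncomputable def total : Subalgebra K (Families K X) where
  carrier := (⨆ p, gr K X p : Submodule K (Families K X))
  mul_mem' {f g} hf hg := by
    refine Submodule.iSup_induction _ (motive := fun f => f * g ∈ ⨆ p, gr K X p) hf ?_ ?_ ?_
    · intro p f hf
      refine Submodule.iSup_induction _ (motive := fun g => f * g ∈ ⨆ p, gr K X p) hg ?_ ?_ ?_
      · intro q g hg
        exact Submodule.mem_iSup_of_mem (p + q) (mul_mem_gr hf hg)
      · simp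
      · intro x y hx hy
        rw [mul_add]
        exact add_mem hx hy
    · simp
    · intro x y hx hy
      rw [add_mul]
      exact add_mem hx hy
  add_mem' hf hg := add_mem hf hg
  algebraMap_mem' r := by
    rw [Algebra.algebraMap_eq_smul_one]
    exact Submodule.smul_mem _ r (Submodule.mem_iSup_of_mem 0 one_mem_gr)

theorem mem_total {f : Families K X} : f ∈ total K X ↔ f ∈ ⨆ p, gr K X p := Iff.rfl

variable (K X) in
/-- The forms of degree `p`, inside the algebra of all forms. -/
noncomputable def totalGr (p : ℕ) : Submodule K (total K X) :=
  (gr K X p).comap (total K X).val.toLinearMap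

theorem mem_totalGr {p : ℕ} {f : total K X} : f ∈ totalGr K X p ↔ (f : Families K X) ∈ gr K X p :=
  Iff.rfl

theorem totalGr_isInternal : DirectSum.IsInternal (totalGr K X) := by
  refine DirectSum.isInternal_submodule_of_iSupIndep_of_iSup_eq_top ?_ ?_
  · rw [iSupIndep_def]
    intro i
    rw [Submodule.disjoint_def]
    intro f hf hf'
    have key : ∀ a x, PolyForms.proj i ((f : Families K X) a x) = 0 := by
      intro a x
      have : (⨆ j, ⨆ (_ : j ≠ i), totalGr K X j) ≤
          LinearMap.ker (PolyForms.proj i ∘ₗ LinearMap.proj (R := K) x ∘ₗ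
            LinearMap.proj (R := K) (φ := fun a : SimplexCategory =>
              X.obj (op a) → PolyForms K a.len) a ∘ₗ (total K X).val.toLinearMap) := by
        refine iSup₂_le fun j hj g hg => ?_
        exact PolyForms.proj_ne hj (hg.1 a x)
      exact this hf'
    refine Subtype.ext (funext fun a => funext fun x => ?_)
    exact (PolyForms.proj_same ((mem_totalGr.1 hf).1 a x)).symm.trans (key a x)
  · rw [eq_top_iff]
    rintro ⟨f, hf⟩ -
    refine Submodule.iSup_induction' _
      (motive := fun f hf => (⟨f, hf⟩ : total K X) ∈ ⨆ p, totalGr K X p) ?_ ?_ ?_ hf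
    · intro p f hf
      exact Submodule.mem_iSup_of_mem p hf
    · exact zero_mem _
    · intro f g hf hg hf' hg'
      exact add_mem hf' hg'

/-- The differential on families, simplex by simplex. -/
noncomputable def familiesD : Families K X →ₗ[K] Families K X where
  toFun f a x := PolyForms.d (f a x)
  map_add' f g := by ext; simp
  map_smul' r f := by ext; simp

theorem familiesD_mem_gr {p : ℕ} {f : Families K X} (hf : f ∈ gr K X p) :
    familiesD f ∈ gr K X (p + 1) :=
  ⟨fun a x => PolyForms.d_mem_gr (hf.1 a x), fun a b θ x => by
    simp [familiesD, hf.2 a b θ x, PolyForms.pullback_d]⟩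

theorem familiesD_mem_total {f : Families K X} (hf : f ∈ total K X) :
    familiesD f ∈ total K X := by
  refine Submodule.iSup_induction _ (motive := fun f => familiesD f ∈ total K X) hf ?_ ?_ ?_
  · intro p f hf
    exact Submodule.mem_iSup_of_mem (p + 1) (familiesD_mem_gr hf)
  · simp
  · intro f g hf hg
    rw [map_add]
    exact add_mem hf hg

variable (K X) in
/-- The CDGA `A_PL(X; K)` of polynomial differential forms on a simplicial set `X`. -/
noncomputable def obj : CDGA.{max u v} K where
  carrier := total K X
  gr := totalGr K X
  isInternal := totalGr_isInternal
  one_mem := one_mem_gr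
  mul_mem hf hg := mul_mem_gr hf hg
  gradedComm {m n f g} hf hg := by
    refine Subtype.ext (funext fun a => funext fun x => ?_)
    simpa using PolyForms.gradedComm (hf.1 a x) (hg.1 a x)
  d :=
    { toFun := fun f => ⟨familiesD f, familiesD_mem_total f.2⟩
      map_add' := fun f g => Subtype.ext (map_add familiesD _ _)
      map_smul' := fun r f => Subtype.ext (map_smul familiesD r _) }
  d_mem hf := familiesD_mem_gr hf
  d_d f := Subtype.ext (funext fun a => funext fun x => PolyForms.d_d _)
  leibniz {m f} g hf := by
    refine Subtype.ext (funext fun a => funext fun x => ?_)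
    have h := PolyForms.d_mul ((f : Families K X) a x) ((g : Families K X) a x)
    rw [PolyForms.invol_of_mem ((mem_totalGr.1 hf).1 a x), mul_assoc] at h
    simpa [familiesD] using h

variable {Y : SSet.{u}}

/-- The pullback of families along a map of simplicial sets. -/
noncomputable def familiesMap (φ : X ⟶ Y) : Families K Y →ₐ[K] Families K X where
  toFun f a x := f a (φ.app (op a) x)
  map_one' := rfl
  map_mul' _ _ := rfl
  map_zero' := rfl
  map_add' _ _ := rfl
  commutes' _ := rfl

theorem familiesMap_mem_gr (φ : X ⟶ Y) {p : ℕ} {f : Families K Y} (hf : f ∈ gr K Y p) :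
    familiesMap φ f ∈ gr K X p :=
  ⟨fun a _ => hf.1 a _, fun a b θ x =>
    (congrArg (f a) (NatTrans.naturality_apply φ θ.op x :)).trans
      (hf.2 a b θ (φ.app (op b) x))⟩

theorem familiesMap_mem_total (φ : X ⟶ Y) {f : Families K Y} (hf : f ∈ total K Y) :
    familiesMap φ f ∈ total K X := by
  refine Submodule.iSup_induction _ (motive := fun f => familiesMap φ f ∈ total K X) hf ?_ ?_ ?_
  · intro p f hf
    exact Submodule.mem_iSup_of_mem p (familiesMap_mem_gr φ hf)
  · simp
  · intro f g hf hg
    rw [map_add]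
    exact add_mem hf hg

/-- The map of CDGAs induced by a map of simplicial sets. -/
noncomputable def map (φ : X ⟶ Y) : obj K Y ⟶ obj K X where
  toAlgHom := ((familiesMap φ).comp (total K Y).val).codRestrict (total K X)
    fun f => familiesMap_mem_total φ f.2
  map_gr hf := familiesMap_mem_gr φ hf
  map_d _ := rfl

end APL

/-- Sullivan's functor of polynomial forms on simplicial sets. -/
noncomputable def APLSSet (K : Type v) [Field K] : SSet.{u}ᵒᵖ ⥤ CDGA.{max u v} K where
  obj X := APL.obj K X.unop
  map φ := APL.map φ.unop
  map_id _ := rfl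
  map_comp _ _ := rfl

/-- Sullivan's functor `A_PL(-; K)` of piecewise polynomial forms on topological spaces: the
polynomial forms on the singular simplicial set. -/
noncomputable def APLTop (K : Type v) [Field K] : TopCat.{u}ᵒᵖ ⥤ CDGA.{max u v} K :=
  TopCat.toSSet.op ⋙ APLSSet K

/-- A diagram of spaces is `K`-formal if the contravariant diagram of CDGAs `A_PL(F; K)` is
formal. -/
def IsFormalDiagram (K : Type v) [Field K] {J : Type*} [Category J] (F : J ⥤ TopCat.{u}) : Prop :=
  CDGA.IsFormal (F.op ⋙ APLTop K)

namespace CosimplicialReplacement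

variable {I : Type u} [SmallCategory I]

variable (I) in
/-- The strings `i₀ ← i₁ ← ⋯ ← iₙ` of composable morphisms of `I`, for `a = [n]`: functors to `I`
from the opposite of the ordered set `{0 < 1 < ⋯ < n}`. -/
abbrev Strings (a : SimplexCategory) : Type u := (Fin (a.len + 1))ᵒᵖ ⥤ I

/-- The action of an order-preserving map on strings:
`(j₀ ← ⋯ ← jₘ) ↦ (j_{θ 0} ← ⋯ ← j_{θ n})`. -/
abbrev Strings.restrict {a b : SimplexCategory} (θ : a ⟶ b) (s : Strings I b) : Strings I a :=
  θ.toOrderHom.monotone.functor.op ⋙ s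

/-- The composite `j_{θ 0} → j₀` of the first morphisms of a string `j₀ ← ⋯ ← jₘ`. -/
abbrev Strings.toFirst {a b : SimplexCategory} (θ : a ⟶ b) (s : Strings I b) :
    (s.restrict θ).obj (op 0) ⟶ s.obj (op 0) :=
  s.map (homOfLE (Fin.zero_le (θ.toOrderHom 0))).op

theorem Strings.toFirst_id {a : SimplexCategory} (s : Strings I a) :
    s.toFirst (𝟙 a) = 𝟙 (s.obj (op 0)) :=
  s.map_id (op 0)

theorem Strings.toFirst_comp {a b c : SimplexCategory} (θ : a ⟶ b) (ψ : b ⟶ c)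
    (s : Strings I c) :
    s.toFirst (θ ≫ ψ) = (s.restrict ψ).toFirst θ ≫ s.toFirst ψ :=
  s.map_comp (homOfLE (ψ.toOrderHom.monotone (Fin.zero_le (θ.toOrderHom 0)))).op
    (homOfLE (Fin.zero_le (ψ.toOrderHom 0))).op

variable (F : I ⥤ TopCat.{u})

/-- The space `Πⁿ F`, the product over all strings `i₀ ← ⋯ ← iₙ` of the spaces `F(i₀)`. -/
abbrev space (a : SimplexCategory) : TopCat.{u} :=
  TopCat.of ((s : Strings I a) → F.obj (s.obj (op 0)))

/-- The structure map of `Π^• F` along `θ : [n] → [m]`: its coordinate at `j₀ ← ⋯ ← jₘ` is the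
coordinate at `j_{θ 0} ← ⋯ ← j_{θ n}` followed by the map `F(j_{θ 0}) → F(j₀)`. -/
def spaceMap {a b : SimplexCategory} (θ : a ⟶ b) : space F a ⟶ space F b :=
  TopCat.ofHom
    { toFun := fun x s => F.map (s.toFirst θ) (x (s.restrict θ))
      continuous_toFun := continuous_pi fun s =>
        (F.map (s.toFirst θ)).hom.continuous.comp (continuous_apply _) }

end CosimplicialReplacement

open CosimplicialReplacement in
/-- The Bousfield–Kan cosimplicial replacement `Π^• F` of a diagram of spaces `F`. -/
def cosimplicialReplacement {I : Type u} [SmallCategory I] (F : I ⥤ TopCat.{u}) :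
    CosimplicialObject TopCat.{u} where
  obj a := space F a
  map θ := spaceMap F θ
  map_id a := by
    ext x s
    have h : F.map (s.toFirst (𝟙 a)) = 𝟙 _ :=
      (congrArg F.map s.toFirst_id).trans (F.map_id _)
    exact ConcreteCategory.congr_hom h (x s)
  map_comp {a b c} θ ψ := by
    ext x s
    have h : F.map (s.toFirst (θ ≫ ψ)) =
        F.map ((s.restrict ψ).toFirst θ) ≫ F.map (s.toFirst ψ) :=
      (congrArg F.map (s.toFirst_comp θ ψ)).trans (F.map_comp _ _)
    exact ConcreteCategory.congr_hom h (x (s.restrict (θ ≫ ψ)))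

open scoped TensorProduct

theorem DirectSum.isInternal_of_projections {K M : Type*} [Field K] [AddCommGroup M] [Module K M]
    (S : ℕ → Submodule K M) (P : ℕ → M →ₗ[K] M) (hsame : ∀ n, ∀ x ∈ S n, P n x = x)
    (hne : ∀ m n, m ≠ n → ∀ x ∈ S m, P n x = 0) (htop : ⨆ n, S n = ⊤) :
    DirectSum.IsInternal S := by
  refine DirectSum.isInternal_submodule_of_iSupIndep_of_iSup_eq_top ?_ htop
  rw [iSupIndep_def]
  intro i
  rw [Submodule.disjoint_def]
  intro x hx hx'
  have : (⨆ j, ⨆ (_ : j ≠ i), S j) ≤ LinearMap.ker (P i) :=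
    iSup₂_le fun j hj y hy => hne j i hj y hy
  rw [← hsame i x hx]
  exact this hx'

/-! ### The tensor product of CDGAs as binary coproduct -/

namespace CDGA

variable {K : Type v} [Field K]

theorem neg_one_pow_mul_eq_smul {R : Type*} [Ring R] [Algebra K R] (n : ℕ) (x : R) :
    (-1) ^ n * x = (-1 : K) ^ n • x := by
  rcases Nat.even_or_odd n with h | h <;> simp [h.neg_one_pow]

theorem neg_one_pow_units_smul {M : Type*} [AddCommGroup M] [Module K M] (n : ℕ) (x : M) :
    ((-1 : ℤˣ) ^ n) • x = (-1 : K) ^ n • x := by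
  rcases Nat.even_or_odd n with h | h <;> simp [h.neg_one_pow]

variable (A B C : CDGA.{w} K)

/-- The grading involution, equal to `(-1)ⁿ` in degree `n`. -/
noncomputable def sign : A →ₗ[K] A :=
  DirectSum.toModule K ℕ A (fun n => (-1 : K) ^ n • (A.gr n).subtype) ∘ₗ
    (LinearEquiv.ofBijective (DirectSum.coeLinearMap A.gr) A.isInternal).symm.toLinearMap

theorem sign_of_mem {n : ℕ} {a : A} (h : a ∈ A.gr n) : A.sign a = (-1 : K) ^ n • a := by
  have h1 : (LinearEquiv.ofBijective (DirectSum.coeLinearMap A.gr) A.isInternal).symm a =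
      DirectSum.lof K ℕ (fun i => A.gr i) n ⟨a, h⟩ := by
    rw [LinearEquiv.symm_apply_eq]
    exact (DirectSum.coeLinearMap_lof A.gr n ⟨a, h⟩).symm
  simp [sign, h1]

theorem sign_sign (a : A) : A.sign (A.sign a) = a := by
  induction a using homogeneous_induction with
  | h0 => simp
  | hm n a ha => simp [A.sign_of_mem ha, smul_smul, ← mul_pow]
  | hadd a b ha hb => simp [ha, hb]

theorem d_sign (a : A) : A.d (A.sign a) = - A.sign (A.d a) := by
  induction a using homogeneous_induction with
  | h0 => simp
  | hm n a ha => simp [A.sign_of_mem ha, A.sign_of_mem (A.d_mem ha), pow_succ]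
  | hadd a b ha hb => simp [ha, hb, add_comm]

/-- `GradedTensorProduct` takes the decomposition into degrees as data, while a CDGA only asserts
that its grading is internal; hence the choice. -/
noncomputable instance : GradedAlgebra A.gr :=
  letI : DirectSum.Decomposition A.gr := A.isInternal.chooseDecomposition
  { one_mem := A.one_mem
    mul_mem := fun _ _ _ _ ha hb => A.mul_mem ha hb }

/-- The underlying algebra of the tensor product of two CDGAs. -/
abbrev TensorCarrier : Type w := GradedTensorProduct K A.gr B.gr

/-- Pure tensors. -/
noncomputable def tmul : A →ₗ[K] B →ₗ[K] TensorCarrier A B :=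
  (TensorProduct.mk K A B).compr₂ (GradedTensorProduct.of K A.gr B.gr).toLinearMap

variable {A B C}

theorem tmul_mul_tmul {i j : ℕ} (a : A) {b : B} {a' : A} (b' : B) (hb : b ∈ B.gr j)
    (ha' : a' ∈ A.gr i) :
    tmul A B a b * tmul A B a' b' = (-1 : K) ^ (j * i) • tmul A B (a * a') (b * b') := by
  have := GradedTensorProduct.tmul_coe_mul_coe_tmul (R := K) A.gr B.gr a ⟨b, hb⟩ ⟨a', ha'⟩ b'
  refine this.trans ?_
  exact neg_one_pow_units_smul _ _

theorem tmul_one_mul (a a' : A) (b' : B) :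
    tmul A B a 1 * tmul A B a' b' = tmul A B (a * a') b' := by
  induction a' using homogeneous_induction with
  | h0 => simp
  | hm n a' ha => simp [tmul_mul_tmul a b' B.one_mem ha]
  | hadd x y hx hy => simp [mul_add, hx, hy]

@[elab_as_elim]
theorem tensor_induction {P : TensorCarrier A B → Prop} (x : TensorCarrier A B)
    (hm : ∀ i j, ∀ a ∈ A.gr i, ∀ b ∈ B.gr j, P (tmul A B a b))
    (hadd : ∀ x y, P x → P y → P (x + y)) : P x := by
  have h0 : P 0 := by
    have := hm 0 0 0 (zero_mem _) 0 (zero_mem _)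
    simpa using this
  have h : ∀ t : A ⊗[K] B, P (GradedTensorProduct.of K A.gr B.gr t) := by
    intro t
    induction t using TensorProduct.induction_on with
    | zero => simpa using h0
    | tmul a b =>
      change P (tmul A B a b)
      induction a using homogeneous_induction with
      | h0 => simpa using h0
      | hm i a ha =>
        induction b using homogeneous_induction with
        | h0 => simpa using h0
        | hm j b hb => exact hm i j a ha b hb
        | hadd x y hx hy => rw [map_add]; exact hadd _ _ hx hy
      | hadd x y hx hy => rw [map_add, LinearMap.add_apply]; exact hadd _ _ hx hy
    | add x y hx hy => rw [map_add]; exact hadd _ _ hx hy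
  exact h ((GradedTensorProduct.of K A.gr B.gr).symm x)

variable (A B) in
/-- The map of tensor products induced by linear maps of the factors. -/
noncomputable def tensorMap (f : A →ₗ[K] A) (g : B →ₗ[K] B) :
    TensorCarrier A B →ₗ[K] TensorCarrier A B :=
  (GradedTensorProduct.of K A.gr B.gr).toLinearMap ∘ₗ TensorProduct.map f g ∘ₗ
    (GradedTensorProduct.of K A.gr B.gr).symm.toLinearMap

@[simp]
theorem tensorMap_tmul (f : A →ₗ[K] A) (g : B →ₗ[K] B) (a : A) (b : B) :
    tensorMap A B f g (tmul A B a b) = tmul A B (f a) (g b) := rfl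

variable (A B) in
/-- The part of degree `n` of the tensor product. -/
noncomputable def tensorGr (n : ℕ) : Submodule K (TensorCarrier A B) :=
  Submodule.span K {x | ∃ i j, i + j = n ∧ ∃ a ∈ A.gr i, ∃ b ∈ B.gr j, tmul A B a b = x}

theorem tmul_mem {i j n : ℕ} (h : i + j = n) {a : A} (ha : a ∈ A.gr i) {b : B} (hb : b ∈ B.gr j) :
    tmul A B a b ∈ tensorGr A B n :=
  Submodule.subset_span ⟨i, j, h, a, ha, b, hb, rfl⟩

@[elab_as_elim]
theorem tensorGr_induction {n : ℕ} {P : (x : TensorCarrier A B) → x ∈ tensorGr A B n → Prop}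
    {x : TensorCarrier A B} (hx : x ∈ tensorGr A B n)
    (hm : ∀ i j (hij : i + j = n) a (ha : a ∈ A.gr i) b (hb : b ∈ B.gr j),
      P (tmul A B a b) (tmul_mem hij ha hb))
    (hadd : ∀ x y hx hy, P x hx → P y hy → P (x + y) (add_mem hx hy))
    (hsmul : ∀ (r : K) x hx, P x hx → P (r • x) (Submodule.smul_mem _ r hx)) : P x hx := by
  induction hx using Submodule.span_induction with
  | mem x h => obtain ⟨i, j, hij, a, ha, b, hb, rfl⟩ := h; exact hm i j hij a ha b hb
  | zero => simpa using hm 0 n (by simp) 0 (zero_mem _) 0 (zero_mem _)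
  | add x y hx' hy' hx hy => exact hadd x y hx' hy' hx hy
  | smul r x hx' hx => exact hsmul r x hx' hx

variable (A B) in
/-- The projection of the tensor product onto its part of degree `n`. -/
noncomputable def tensorProj (n : ℕ) : TensorCarrier A B →ₗ[K] TensorCarrier A B :=
  ∑ p ∈ Finset.HasAntidiagonal.antidiagonal n, tensorMap A B (A.proj p.1) (B.proj p.2)

theorem tensorProj_tmul {i j : ℕ} {a : A} {b : B} (ha : a ∈ A.gr i) (hb : b ∈ B.gr j) (n : ℕ) :
    tensorProj A B n (tmul A B a b) = if i + j = n then tmul A B a b else 0 := by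
  have key : ∀ p ∈ Finset.HasAntidiagonal.antidiagonal n, tensorMap A B (A.proj p.1) (B.proj p.2) (tmul A B a b) =
      if p = (i, j) then tmul A B a b else 0 := by
    rintro ⟨p, q⟩ -
    rw [tensorMap_tmul]
    by_cases hp : i = p
    · by_cases hq : j = q
      · subst hp hq; simp [A.proj_same ha, B.proj_same hb]
      · rw [if_neg (by simp; intro _ h; exact hq h.symm), B.proj_ne hq hb, map_zero]
    · rw [if_neg (by simp; intro h; exact absurd h.symm hp), A.proj_ne hp ha, map_zero,
        LinearMap.zero_apply]
  rw [tensorProj, LinearMap.sum_apply, Finset.sum_congr rfl key, Finset.sum_ite_eq']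
  simp

theorem tensorGr_isInternal : DirectSum.IsInternal (tensorGr A B) := by
  refine DirectSum.isInternal_of_projections _ (tensorProj A B) ?_ ?_ ?_
  · intro n x hx
    induction hx using tensorGr_induction with
    | hm i j hij a ha b hb => rw [tensorProj_tmul ha hb, if_pos hij]
    | hadd x y _ _ hx hy => rw [map_add, hx, hy]
    | hsmul r x _ hx => rw [map_smul, hx]
  · intro m n hmn x hx
    induction hx using tensorGr_induction with
    | hm i j hij a ha b hb => rw [tensorProj_tmul ha hb, if_neg (by omega)]
    | hadd x y _ _ hx hy => rw [map_add, hx, hy, add_zero]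
    | hsmul r x _ hx => rw [map_smul, hx, smul_zero]
  · rw [eq_top_iff]
    rintro x -
    induction x using tensor_induction with
    | hm i j a ha b hb => exact Submodule.mem_iSup_of_mem (i + j) (tmul_mem rfl ha hb)
    | hadd x y hx hy => exact add_mem hx hy

variable (A B) in
/-- The differential of the tensor product. -/
noncomputable def tensorD : TensorCarrier A B →ₗ[K] TensorCarrier A B :=
  tensorMap A B A.d LinearMap.id + tensorMap A B A.sign B.d

theorem tensorD_tmul {i : ℕ} {a : A} (ha : a ∈ A.gr i) (b : B) :
    tensorD A B (tmul A B a b) = tmul A B (A.d a) b + (-1 : K) ^ i • tmul A B a (B.d b) := by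
  simp [tensorD, A.sign_of_mem ha]

theorem d_one : A.d 1 = 0 := A.cocycles.one_mem

variable (A B) in
/-- The tensor product of two CDGAs. -/
noncomputable def tensor : CDGA.{w} K where
  carrier := TensorCarrier A B
  gr := tensorGr A B
  isInternal := tensorGr_isInternal
  one_mem := tmul_mem (i := 0) (j := 0) rfl A.one_mem B.one_mem
  mul_mem {m n x y} hx hy := by
    induction hx using tensorGr_induction with
    | hm i j hij a ha b hb =>
      induction hy using tensorGr_induction with
      | hm i' j' hij' a' ha' b' hb' =>
        rw [tmul_mul_tmul a b' hb ha']
        exact Submodule.smul_mem _ _ (tmul_mem (by omega) (A.mul_mem ha ha') (B.mul_mem hb hb'))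
      | hadd x y _ _ hx hy => rw [mul_add]; exact add_mem hx hy
      | hsmul r x _ hx => rw [mul_smul_comm]; exact Submodule.smul_mem _ _ hx
    | hadd x y _ _ hx hy => rw [add_mul]; exact add_mem hx hy
    | hsmul r x _ hx => rw [smul_mul_assoc]; exact Submodule.smul_mem _ _ hx
  gradedComm {m n x y} hx hy := by
    rw [neg_one_pow_mul_eq_smul (K := K)]
    induction hx using tensorGr_induction with
    | hm i j hij a ha b hb =>
      induction hy using tensorGr_induction with
      | hm i' j' hij' a' ha' b' hb' =>
        rw [tmul_mul_tmul a b' hb ha', tmul_mul_tmul a' b hb' ha, A.gradedComm ha ha',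
          B.gradedComm hb hb', neg_one_pow_mul_eq_smul (K := K), neg_one_pow_mul_eq_smul (K := K)]
        subst hij hij'
        simp only [map_smul, LinearMap.smul_apply, smul_smul]
        congr 1
        -- Both sides are the same tensor up to a sign that depends only on the parities of the four
        -- degrees.
        rcases Nat.even_or_odd i with h1 | h1 <;> rcases Nat.even_or_odd j with h2 | h2 <;>
          rcases Nat.even_or_odd i' with h3 | h3 <;> rcases Nat.even_or_odd j' with h4 | h4 <;>
          simp [pow_mul, pow_add, add_mul, mul_add, h1.neg_one_pow, h2.neg_one_pow, h3.neg_one_pow,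
            h4.neg_one_pow]
      | hadd x y _ _ hx hy => rw [mul_add, add_mul, smul_add, hx, hy]
      | hsmul r x _ hx => rw [mul_smul_comm, hx, smul_mul_assoc, smul_comm]
    | hadd x y _ _ hx hy => rw [mul_add, add_mul, smul_add, hx, hy]
    | hsmul r x _ hx => rw [mul_smul_comm, smul_mul_assoc, hx, smul_comm]
  d := tensorD A B
  d_mem {n x} hx := by
    induction hx using tensorGr_induction with
    | hm i j hij a ha b hb =>
      rw [tensorD_tmul ha]
      exact add_mem (tmul_mem (by omega) (A.d_mem ha) hb)
        (Submodule.smul_mem _ _ (tmul_mem (by omega) ha (B.d_mem hb)))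
    | hadd x y _ _ hx hy => rw [map_add]; exact add_mem hx hy
    | hsmul r x _ hx => rw [map_smul]; exact Submodule.smul_mem _ _ hx
  d_d x := by
    induction x using tensor_induction with
    | hm i j a ha b hb =>
      rw [tensorD_tmul ha, map_add, map_smul, tensorD_tmul ha, tensorD_tmul (A.d_mem ha)]
      simp [A.d_d, B.d_d, pow_succ]
    | hadd x y hx hy => rw [map_add, map_add, hx, hy, add_zero]
  leibniz {m x} y hx := by
    rw [neg_one_pow_mul_eq_smul (K := K)]
    induction hx using tensorGr_induction with
    | hm i j hij a ha b hb =>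
      induction y using tensor_induction with
      | hm i' j' a' ha' b' hb' =>
        rw [tmul_mul_tmul a b' hb ha', map_smul, tensorD_tmul (A.mul_mem ha ha'), tensorD_tmul ha,
          tensorD_tmul ha', add_mul, mul_add, smul_mul_assoc, mul_smul_comm,
          tmul_mul_tmul _ _ hb ha', tmul_mul_tmul _ _ (B.d_mem hb) ha',
          tmul_mul_tmul _ _ hb (A.d_mem ha'), tmul_mul_tmul _ _ hb ha',
          A.leibniz _ ha, B.leibniz _ hb, neg_one_pow_mul_eq_smul (K := K),
          neg_one_pow_mul_eq_smul (K := K)]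
        subst hij
        simp only [map_add, map_smul, LinearMap.add_apply, LinearMap.smul_apply, smul_smul,
          smul_add]
        -- Again only parities matter; the degree of the last factor `b'` does not enter.
        rcases Nat.even_or_odd i with h1 | h1 <;> rcases Nat.even_or_odd j with h2 | h2 <;>
          rcases Nat.even_or_odd i' with h3 | h3 <;>
          simp [pow_mul, pow_add, add_mul, mul_add, h1.neg_one_pow, h2.neg_one_pow,
            h3.neg_one_pow] <;> abel
      | hadd x y hx hy => simp only [mul_add, map_add, smul_add, hx, hy]; abel
    | hadd x y _ _ hx hy => simp only [add_mul, map_add, smul_add, hx, hy]; abel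
    | hsmul r x _ hx => simp only [smul_mul_assoc, map_smul, hx, smul_add, smul_comm r]

variable (A B) in
/-- The inclusion of the left factor. -/
noncomputable def tensorInl : A ⟶ tensor A B where
  toAlgHom := GradedTensorProduct.includeLeft A.gr B.gr
  map_gr {n a} ha := tmul_mem (A := A) (B := B) (add_zero n) ha B.one_mem
  map_d a := by
    change tmul A B (A.d a) 1 = tensorD A B (tmul A B a 1)
    simp [tensorD, d_one]

variable (A B) in
/-- The inclusion of the right factor. -/
noncomputable def tensorInr : B ⟶ tensor A B where
  toAlgHom := GradedTensorProduct.includeRight A.gr B.gr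
  map_gr {n a} ha := tmul_mem (A := A) (B := B) (zero_add n) A.one_mem ha
  map_d a := by
    change tmul A B 1 (B.d a) = tensorD A B (tmul A B 1 a)
    simp [tensorD, d_one, A.sign_of_mem A.one_mem]

theorem tensorInl_mul_tensorInr (a : A) (b : B) :
    (tensorInl A B).toAlgHom a * (tensorInr A B).toAlgHom b = tmul A B a b := by
  refine (tmul_one_mul a 1 b).trans ?_
  rw [mul_one]

/-- The map out of the tensor product given by maps out of the factors. -/
noncomputable def tensorDesc (f : A ⟶ C) (g : B ⟶ C) : tensor A B ⟶ C where
  toAlgHom := GradedTensorProduct.lift A.gr B.gr f.toAlgHom g.toAlgHom fun i j a b => by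
    rw [C.gradedComm (f.map_gr a.2) (g.map_gr b.2), neg_one_pow_mul_eq_smul (K := K), mul_comm i j]
    exact (neg_one_pow_units_smul _ _).symm
  map_gr {n x} hx := by
    change GradedTensorProduct.lift A.gr B.gr _ _ _ x ∈ _
    induction hx using tensorGr_induction with
    | hm i j hij a ha b hb =>
      subst hij
      exact C.mul_mem (f.map_gr ha) (g.map_gr hb)
    | hadd x y _ _ hx hy => rw [map_add]; exact add_mem hx hy
    | hsmul r x _ hx => rw [map_smul]; exact Submodule.smul_mem _ _ hx
  map_d x := by
    change GradedTensorProduct.lift A.gr B.gr _ _ _ (tensorD A B x) = _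
    induction x using tensor_induction with
    | hm i j a ha b hb =>
      rw [tensorD_tmul ha, map_add, map_smul]
      have := C.leibniz (g.toAlgHom b) (f.map_gr ha)
      rw [neg_one_pow_mul_eq_smul (K := K), ← f.map_d, ← g.map_d] at this
      exact this.symm
    | hadd x y hx hy =>
      rw [map_add, map_add, hx, hy, ← map_add]
      exact congrArg C.d (map_add _ x y).symm

@[simp]
theorem tensorInl_desc (f : A ⟶ C) (g : B ⟶ C) : tensorInl A B ≫ tensorDesc f g = f := by
  ext a
  change f.toAlgHom a * g.toAlgHom 1 = _
  simp

@[simp]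
theorem tensorInr_desc (f : A ⟶ C) (g : B ⟶ C) : tensorInr A B ≫ tensorDesc f g = g := by
  ext a
  change f.toAlgHom 1 * g.toAlgHom a = _
  simp

theorem tensor_hom_ext {f g : tensor A B ⟶ C} (hl : tensorInl A B ≫ f = tensorInl A B ≫ g)
    (hr : tensorInr A B ≫ f = tensorInr A B ≫ g) : f = g := by
  refine Hom.ext (GradedTensorProduct.algHom_ext A.gr B.gr ?_ ?_)
  · exact congrArg Hom.toAlgHom hl
  · exact congrArg Hom.toAlgHom hr

variable (A B) in
/-- The tensor product is the coproduct of CDGAs. -/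
noncomputable def tensorIsColimit :
    Limits.IsColimit (Limits.BinaryCofan.mk (tensorInl A B) (tensorInr A B)) :=
  Limits.BinaryCofan.IsColimit.mk _ tensorDesc tensorInl_desc tensorInr_desc
    fun f g _ hf hg => tensor_hom_ext (hf.trans (tensorInl_desc f g).symm)
      (hg.trans (tensorInr_desc f g).symm)

instance : Limits.HasBinaryCoproducts (CDGA.{w} K) :=
  haveI : ∀ {X Y : CDGA.{w} K}, Limits.HasColimit (Limits.pair X Y) :=
    fun {X Y} => ⟨⟨⟨_, tensorIsColimit X Y⟩⟩⟩
  Limits.hasBinaryCoproducts_of_hasColimit_pair _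

end CDGA

/-! ### Cohomology preserves finite coproducts: the algebraic Künneth theorem -/

namespace CDGA

variable {K : Type v} [Field K] {A B C : CDGA.{w} K}

theorem eq_zero_of_mem_gr {m n : ℕ} (hmn : m ≠ n) {a : A} (hm : a ∈ A.gr m) (hn : a ∈ A.gr n) :
    a = 0 := by
  rw [← A.proj_same hn, A.proj_ne hmn hm]

theorem map_proj (f : A ⟶ B) (n : ℕ) (a : A) :
    f.toAlgHom (A.proj n a) = B.proj n (f.toAlgHom a) := by
  induction a using homogeneous_induction with
  | h0 => simp
  | hm m a ha =>
    by_cases h : m = n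
    · subst h; rw [A.proj_same ha, B.proj_same (f.map_gr ha)]
    · rw [A.proj_ne h ha, B.proj_ne h (f.map_gr ha), map_zero]
  | hadd a b ha hb => simp [ha, hb]

/-- The inverse of a bijective morphism of CDGAs. -/
noncomputable def homInv (f : A ⟶ B) (hf : Function.Bijective f.toAlgHom) : B ⟶ A where
  toAlgHom := (AlgEquiv.ofBijective f.toAlgHom hf).symm
  map_gr {n b} hb := by
    obtain ⟨a, rfl⟩ := hf.2 b
    have h : (AlgEquiv.ofBijective f.toAlgHom hf).symm (f.toAlgHom a) = a :=
      (AlgEquiv.ofBijective f.toAlgHom hf).symm_apply_apply a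
    change (AlgEquiv.ofBijective f.toAlgHom hf).symm (f.toAlgHom a) ∈ _
    rw [h]
    -- Morphisms commute with the projections onto degrees, so injectivity identifies `a` with its
    -- component of degree `n`.
    have : A.proj n a = a := hf.1 (by rw [map_proj, B.proj_same hb])
    rw [← this]
    exact A.proj_mem n a
  map_d b := by
    obtain ⟨a, rfl⟩ := hf.2 b
    have h : ∀ a, (AlgEquiv.ofBijective f.toAlgHom hf).symm (f.toAlgHom a) = a :=
      (AlgEquiv.ofBijective f.toAlgHom hf).symm_apply_apply
    change (AlgEquiv.ofBijective f.toAlgHom hf).symm (B.d (f.toAlgHom a)) =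
      A.d ((AlgEquiv.ofBijective f.toAlgHom hf).symm (f.toAlgHom a))
    rw [← f.map_d, h, h]

theorem isIso_of_bijective (f : A ⟶ B) (hf : Function.Bijective f.toAlgHom) : IsIso f :=
  ⟨homInv f hf, hom_ext fun a => (AlgEquiv.ofBijective f.toAlgHom hf).symm_apply_apply a,
    hom_ext fun b => (AlgEquiv.ofBijective f.toAlgHom hf).apply_symm_apply b⟩

theorem bijective_of_isIso (f : A ⟶ B) [IsIso f] : Function.Bijective f.toAlgHom := by
  refine Function.bijective_iff_has_inverse.2 ⟨(inv f).toAlgHom, fun a => ?_, fun b => ?_⟩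
  · rw [← comp_toAlgHom_apply, IsIso.hom_inv_id]; rfl
  · rw [← comp_toAlgHom_apply, IsIso.inv_hom_id]; rfl

theorem isQuasiIso_iff_isIso (f : A ⟶ B) :
    IsQuasiIso f ↔ IsIso ((cohomologyFunctor K).map f) :=
  ⟨isIso_of_bijective _, fun _ => bijective_of_isIso _⟩

/-- A CDGA that consists only of scalars is initial. -/
noncomputable def isInitialOfBijective (A : CDGA.{w} K)
    (h : Function.Bijective (algebraMap K A)) : Limits.IsInitial A :=
  Limits.IsInitial.ofUniqueHom
    (fun B =>
      { toAlgHom := (Algebra.ofId K B).comp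
          (AlgEquiv.ofBijective (Algebra.ofId K A) h).symm.toAlgHom
        map_gr := fun {n a} ha => by
          obtain ⟨r, rfl⟩ := h.2 a
          have h1 : (AlgEquiv.ofBijective (Algebra.ofId K A) h).symm (algebraMap K A r) = r :=
            (AlgEquiv.ofBijective (Algebra.ofId K A) h).symm_apply_apply r
          change algebraMap K B ((AlgEquiv.ofBijective (Algebra.ofId K A) h).symm _) ∈ _
          rw [h1]
          by_cases hn : n = 0
          · subst hn
            rw [Algebra.algebraMap_eq_smul_one]
            exact Submodule.smul_mem _ _ B.one_mem
          -- A scalar also has degree `0`, so it can lie in degree `n ≠ 0` only if it vanishes.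
          · have h0 : algebraMap K A r = 0 := by
              refine eq_zero_of_mem_gr (Ne.symm hn) ?_ ha
              rw [Algebra.algebraMap_eq_smul_one]
              exact Submodule.smul_mem _ _ A.one_mem
            rw [h.1 (h0.trans (map_zero _).symm), map_zero]
            exact zero_mem _
        map_d := fun a => by
          obtain ⟨r, rfl⟩ := h.2 a
          have h1 : (AlgEquiv.ofBijective (Algebra.ofId K A) h).symm (algebraMap K A r) = r :=
            (AlgEquiv.ofBijective (Algebra.ofId K A) h).symm_apply_apply r
          have h2 : ∀ D : CDGA.{w} K, D.d (algebraMap K D r) = 0 := fun D => by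
            rw [Algebra.algebraMap_eq_smul_one, map_smul, d_one, smul_zero]
          change algebraMap K B ((AlgEquiv.ofBijective (Algebra.ofId K A) h).symm _) =
            B.d (algebraMap K B ((AlgEquiv.ofBijective (Algebra.ofId K A) h).symm _))
          rw [h1, h2, h2, map_zero, map_zero] })
    fun B m => hom_ext fun a => by
      obtain ⟨r, rfl⟩ := h.2 a
      exact (AlgHom.commutes _ r).trans (AlgHom.commutes _ r).symm

variable (K) in
/-- The ground field as a CDGA. -/
noncomputable def unit : CDGA.{max u v} K where
  carrier := ULift.{u} K
  gr n := if n = 0 then ⊤ else ⊥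
  isInternal := by
    refine DirectSum.isInternal_of_projections _ (fun n => if n = 0 then LinearMap.id else 0)
      ?_ ?_ ?_
    · intro n x hx
      by_cases h : n = 0 <;> simp_all
    · intro m n hmn x hx
      by_cases h : n = 0 <;> by_cases h' : m = 0 <;> simp_all
    · rw [eq_top_iff]
      exact le_iSup_of_le 0 (by simp)
  one_mem := by simp
  mul_mem {m n a b} ha hb := by
    by_cases h : m = 0 <;> by_cases h' : n = 0 <;> simp_all
  gradedComm {m n a b} ha hb := by
    by_cases h : m = 0 <;> by_cases h' : n = 0 <;> simp_all [mul_comm]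
  d := 0
  d_mem _ := zero_mem _
  d_d _ := rfl
  leibniz := by intros; simp

theorem unit_algebraMap_bijective :
    Function.Bijective (algebraMap K (unit.{v, u} K)) :=
  ULift.up_bijective

variable (A) in
/-- The linear map sending a cocycle to its class. -/
def clsₗ : A.cocycles →ₗ[K] A.cohomology :=
  (Ideal.Quotient.mkₐ K A.coboundaries).toLinearMap

theorem clsₗ_surjective : Function.Surjective (clsₗ A) := Ideal.Quotient.mk_surjective

theorem clsₗ_eq_zero_iff {z : A.cocycles} : clsₗ A z = 0 ↔ ∃ b, A.d b = z :=
  Ideal.Quotient.eq_zero_iff_mem.trans A.mem_coboundaries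

theorem map_mem_cocycles (f : A ⟶ B) {a : A} (ha : a ∈ A.cocycles) :
    f.toAlgHom a ∈ B.cocycles := by
  rw [mem_cocycles] at *
  rw [← f.map_d, ha, map_zero]

/-- The differential is zero, so every element is a cocycle and only `0` is a coboundary. -/
theorem cohomology_unit_bijective :
    Function.Bijective (algebraMap K (unit.{v, u} K).cohomology) := by
  constructor
  · intro r s h
    have h' : clsₗ (unit.{v, u} K) (algebraMap K _ (r - s)) = 0 := by
      have : algebraMap K (unit.{v, u} K).cohomology (r - s) = 0 := by rw [map_sub, h, sub_self]
      exact this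
    obtain ⟨b, hb⟩ := clsₗ_eq_zero_iff.1 h'
    have hb' : (algebraMap K (unit.{v, u} K)) (r - s) = 0 := hb.symm
    have := unit_algebraMap_bijective.1 (hb'.trans (map_zero _).symm)
    exact sub_eq_zero.1 this
  · intro q
    obtain ⟨z, rfl⟩ := clsₗ_surjective q
    obtain ⟨r, hr⟩ := unit_algebraMap_bijective.2 z.1
    exact ⟨r, congrArg (clsₗ (unit.{v, u} K)) (Subtype.ext hr)⟩

/-- A cofan whose comparison map from the tensor product is bijective is a coproduct. -/
theorem nonempty_isColimit_of_bijective (f : A ⟶ C) (g : B ⟶ C)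
    (h : Function.Bijective (tensorDesc f g).toAlgHom) :
    Nonempty (Limits.IsColimit (Limits.BinaryCofan.mk f g)) := by
  have : IsIso (tensorDesc f g) := isIso_of_bijective _ h
  let e : tensor A B ≅ C := asIso (tensorDesc f g)
  exact ⟨(tensorIsColimit A B).ofIsoColimit (Limits.BinaryCofan.ext e (tensorInl_desc f g)
    (tensorInr_desc f g))⟩

/-- The classes of `f x * g (y b)`, for `x` a cocycle of `A`, exhaust the cohomology of `C`
without relations. -/
structure IsKunneth {β : Type*} (f : A ⟶ C) (g : B ⟶ C) (y : β → B) : Prop where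
  surj : ∀ ω : C, C.d ω = 0 → ∃ x : β →₀ A, (∀ b, A.d (x b) = 0) ∧
    ∃ η, ω = (x.sum fun b a => f.toAlgHom a * g.toAlgHom (y b)) + C.d η
  inj : ∀ x : β →₀ A, (∀ b, A.d (x b) = 0) →
    (∃ η, C.d η = x.sum fun b a => f.toAlgHom a * g.toAlgHom (y b)) → ∀ b, ∃ ξ, A.d ξ = x b

theorem exists_clsₗ_section : ∃ σ : A.cohomology →ₗ[K] A.cocycles, ∀ q, clsₗ A (σ q) = q := by
  obtain ⟨σ, hσ⟩ := (clsₗ A).exists_rightInverse_of_surjective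
    (LinearMap.range_eq_top.2 clsₗ_surjective)
  exact ⟨σ, fun q => LinearMap.congr_fun hσ q⟩

/-- The comparison map from the tensor product of the cohomologies. -/
noncomputable def cross (f : A ⟶ C) (g : B ⟶ C) :
    TensorCarrier A.cohomology B.cohomology →ₗ[K] C.cohomology :=
  (tensorDesc (A := A.cohomology) (B := B.cohomology) (C := C.cohomology)
    ((cohomologyFunctor K).map f) ((cohomologyFunctor K).map g)).toAlgHom.toLinearMap

theorem cross_tmul (f : A ⟶ C) (g : B ⟶ C) (x : A.cocycles) (y : B.cocycles) :
    cross f g (tmul A.cohomology B.cohomology (clsₗ A x) (clsₗ B y)) =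
      clsₗ C (⟨f.toAlgHom x, map_mem_cocycles f x.2⟩ * ⟨g.toAlgHom y, map_mem_cocycles g y.2⟩) :=
  rfl

/-- Moves between the comparison map, which lives on cohomology classes, and the sums of
representatives in `C` that occur in `IsKunneth`. -/
theorem cross_sum {β : Type*} (f : A ⟶ C) (g : B ⟶ C) (y : β → B.cocycles)
    (x : β →₀ A.cocycles) :
    ∃ z : C.cocycles,
      cross f g (x.sum fun b a => tmul A.cohomology B.cohomology (clsₗ A a) (clsₗ B (y b))) =
        clsₗ C z ∧
      (z : C) = (x.mapRange (fun a : A.cocycles => (a : A)) rfl).sum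
        fun b a => f.toAlgHom a * g.toAlgHom (y b) := by
  refine ⟨x.sum fun b a => (⟨f.toAlgHom a, map_mem_cocycles f a.2⟩ : C.cocycles) *
        ⟨g.toAlgHom (y b), map_mem_cocycles g (y b).2⟩, ?_, ?_⟩
  · rw [Finsupp.sum, Finsupp.sum, map_sum, map_sum]
    exact Finset.sum_congr rfl fun b _ => cross_tmul f g _ _
  · rw [Finsupp.sum_mapRange_index (by simp), Finsupp.sum, Finsupp.sum]
    push_cast
    rfl

/-- Over a basis of `H(B)` each tensor in `H(A) ⊗ H(B)` has unique coefficients in `H(A)`. Once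
these are represented by cocycles, the two clauses of `IsKunneth` are exactly injectivity and
surjectivity. -/
theorem IsKunneth.cross_bijective {β : Type*} {f : A ⟶ C} {g : B ⟶ C} {y : β → B.cocycles}
    (h : IsKunneth f g fun b => (y b : B)) (bas : Module.Basis β K B.cohomology)
    (hbas : ∀ b, bas b = clsₗ B (y b)) : Function.Bijective (cross f g) := by
  classical
  constructor
  · rw [injective_iff_map_eq_zero]
    intro t ht
    obtain ⟨ξ, hξ⟩ := (TensorProduct.equivFinsuppOfBasisRight (M := A.cohomology) bas).symm.surjective
      ((GradedTensorProduct.of K A.cohomology.gr B.cohomology.gr).symm t)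
    -- `ξ` holds the coefficients of `t` in `H(A)`; the linear section turns them into cocycles
    -- without enlarging the support.
    obtain ⟨σ, hσ⟩ := exists_clsₗ_section (A := A)
    set x : β →₀ A.cocycles := ξ.mapRange σ (map_zero σ) with hx
    have ht' : t = x.sum fun b a =>
        tmul A.cohomology B.cohomology (clsₗ A a) (clsₗ B (y b)) := by
      rw [hx, Finsupp.sum_mapRange_index (by simp)]
      simp only [hσ, ← hbas]
      rw [TensorProduct.equivFinsuppOfBasisRight_symm_apply, LinearEquiv.eq_symm_apply] at hξ
      rw [← hξ, Finsupp.sum, Finsupp.sum, map_sum]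
      rfl
    obtain ⟨z, hz, hz'⟩ := cross_sum f g y x
    rw [ht', hz, clsₗ_eq_zero_iff, hz'] at ht
    have h0 := h.inj (x.mapRange (fun a : A.cocycles => (a : A)) rfl) (fun b => (x b).2) ht
    rw [ht', Finsupp.sum]
    refine Finset.sum_eq_zero fun b _ => ?_
    rw [clsₗ_eq_zero_iff.2 (h0 b), map_zero, LinearMap.zero_apply]
  · intro q
    obtain ⟨ω, rfl⟩ := clsₗ_surjective q
    obtain ⟨x, hx, η, hη⟩ := h.surj ω ω.2
    let x' : β →₀ A.cocycles := Finsupp.onFinset x.support (fun b => ⟨x b, hx b⟩) fun b hb =>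
      Finsupp.mem_support_iff.2 fun h0 => hb (Subtype.ext h0)
    have hx' : x'.mapRange (fun a : A.cocycles => (a : A)) rfl = x := by ext b; rfl
    obtain ⟨z, hz, hz'⟩ := cross_sum f g y x'
    refine ⟨_, hz.trans ?_⟩
    rw [← sub_eq_zero, ← map_sub, clsₗ_eq_zero_iff]
    refine ⟨-η, ?_⟩
    rw [AddSubgroupClass.coe_sub, hz', hx', hη]
    simp

theorem IsKunneth.nonempty_isColimit {β : Type*} {f : A ⟶ C} {g : B ⟶ C} {y : β → B.cocycles}
    (h : IsKunneth f g fun b => (y b : B)) (bas : Module.Basis β K B.cohomology)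
    (hbas : ∀ b, bas b = clsₗ B (y b)) :
    Nonempty (Limits.IsColimit (Limits.BinaryCofan.mk ((cohomologyFunctor K).map f)
      ((cohomologyFunctor K).map g))) :=
  nonempty_isColimit_of_bijective _ _ (h.cross_bijective bas hbas)

/-- A linear deformation of a CDGA onto representatives of its cohomology. -/
theorem exists_contraction (B : CDGA.{w} K) (σ : B.cohomology →ₗ[K] B.cocycles)
    (hσ : ∀ q, clsₗ B (σ q) = q) :
    ∃ (s : B →ₗ[K] B) (p : B →ₗ[K] B.cohomology),
      (∀ b, B.d (s b) + s (B.d b) = b - σ (p b)) ∧ (∀ b, p (B.d b) = 0) ∧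
      ∀ q, p (σ q) = q := by
  -- With `r` a linear section of `d` over its image, `e = 1 - r d` projects onto the cocycles. Then
  -- `p` is the class of `e`, and `s = r (e - σ p)` picks a primitive of the exact part of `e`.
  -- Neither map is required to be homogeneous.
  obtain ⟨r, hr⟩ := B.d.rangeRestrict.exists_rightInverse_of_surjective B.d.range_rangeRestrict
  have hr' : ∀ z : LinearMap.range B.d, B.d (r z) = z := fun z =>
    congrArg Subtype.val (LinearMap.congr_fun hr z)
  let e : B →ₗ[K] B.cocycles :=
    { toFun := fun b => ⟨b - r (B.d.rangeRestrict b), by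
        rw [mem_cocycles, map_sub, hr']; exact sub_self _⟩
      map_add' := fun a b => Subtype.ext (by simp; abel)
      map_smul' := fun c b => Subtype.ext (by simp [smul_sub]) }
  have he : ∀ b, (e b : B) = b - r (B.d.rangeRestrict b) := fun b => rfl
  have hmem : ∀ b, (e b : B) - σ (clsₗ B (e b)) ∈ LinearMap.range B.d := by
    intro b
    have : clsₗ B (e b - σ (clsₗ B (e b))) = 0 := by rw [map_sub, hσ, sub_self]
    exact clsₗ_eq_zero_iff.1 this
  let s : B →ₗ[K] B := r ∘ₗ LinearMap.codRestrict (LinearMap.range B.d)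
    (B.cocycles.val.toLinearMap ∘ₗ (e - σ ∘ₗ clsₗ B ∘ₗ e)) (fun b => by simpa using hmem b)
  have hs : ∀ b, s b = r ⟨(e b : B) - σ (clsₗ B (e b)), hmem b⟩ := fun b => by
    simp only [s, LinearMap.comp_apply]
    congr 1
  have hcl : ∀ b, (e (B.d b) : B) = B.d b := fun b => by
    have : B.d.rangeRestrict (B.d b) = 0 := Subtype.ext (B.d_d b)
    rw [he, this, map_zero, sub_zero]
  have hcl' : ∀ b, clsₗ B (e (B.d b)) = 0 := fun b =>
    clsₗ_eq_zero_iff.2 ⟨b, (hcl b).symm⟩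
  refine ⟨s, clsₗ B ∘ₗ e, fun b => ?_, hcl', fun q => ?_⟩
  · rw [hs, hr', hs]
    have : (⟨(e (B.d b) : B) - σ (clsₗ B (e (B.d b))), hmem _⟩ : LinearMap.range B.d) =
        B.d.rangeRestrict b := Subtype.ext (by
      change (e (B.d b) : B) - σ (clsₗ B (e (B.d b))) = B.d b
      rw [hcl', hcl]; simp)
    rw [this]
    change (e b : B) - _ + _ = b - σ (clsₗ B (e b))
    rw [he]
    abel
  · have h0 : B.d.rangeRestrict (σ q : B) = 0 := Subtype.ext (σ q).2
    have : e (σ q) = σ q := Subtype.ext (by rw [he, h0, map_zero, sub_zero])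
    rw [LinearMap.comp_apply, this, hσ]

/-- The mixed terms of the homotopy `sign ⊗ s` cancel because `d` and `sign` anticommute. What
remains is `1 ⊗ (d s + s d)`, whatever the degree of `s`. -/
theorem tensorD_tensorMap_sign {s π : B →ₗ[K] B} (hs : ∀ b, B.d (s b) + s (B.d b) = b - π b)
    (t : TensorCarrier A B) :
    tensorD A B (tensorMap A B A.sign s t) + tensorMap A B A.sign s (tensorD A B t) =
      t - tensorMap A B LinearMap.id π t := by
  induction t using tensor_induction with
  | hm k l a ha b hb =>
    have h1 : tmul A B a (π b) = tmul A B a b - (tmul A B a (B.d (s b)) +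
        tmul A B a (s (B.d b))) := by
      rw [← map_add, hs, ← map_sub, sub_sub_cancel]
    simp only [tensorD, tensorMap_tmul, LinearMap.add_apply, map_add, sign_sign, d_sign,
      LinearMap.id_apply, map_neg, LinearMap.neg_apply, h1]
    abel
  | hadd x y hx hy =>
    simp only [map_add]
    rw [add_add_add_comm, hx, hy]
    abel

section Coefficients

variable {β : Type*} (bas : Module.Basis β K B.cohomology) (p : B →ₗ[K] B.cohomology)

variable (A) in
/-- The coefficients of the image of a tensor in `A ⊗ H(B)`. -/
noncomputable def tensorCoeffs : TensorCarrier A B →ₗ[K] (β →₀ A) :=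
  TensorProduct.lift (LinearMap.mk₂ K
    (fun (a : A) (b : B) => (bas.repr (p b)).mapRange (fun r => r • a) (zero_smul K a))
    (fun _ _ _ => by ext; simp) (fun _ _ _ => by ext; exact smul_comm _ _ _)
    (fun _ _ _ => by ext; simp [add_smul]) (fun _ _ _ => by ext; simp [mul_smul])) ∘ₗ
    (GradedTensorProduct.of K A.gr B.gr).symm.toLinearMap

theorem tensorCoeffs_tmul (a : A) (b : B) (i : β) :
    tensorCoeffs A bas p (tmul A B a b) i = bas.repr (p b) i • a := rfl

/-- Since `p` kills coboundaries, the term `a ⊗ d b` of the differential contributes nothing: `1 ⊗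
p` is a chain map to `A ⊗ H(B)`. -/
theorem tensorCoeffs_tensorD (hp : ∀ b, p (B.d b) = 0) (t : TensorCarrier A B) (i : β) :
    tensorCoeffs A bas p (tensorD A B t) i = A.d (tensorCoeffs A bas p t i) := by
  induction t using tensor_induction with
  | hm k l a ha b hb =>
    rw [tensorD_tmul ha, map_add, map_smul, Finsupp.add_apply, Finsupp.smul_apply,
      tensorCoeffs_tmul, tensorCoeffs_tmul, tensorCoeffs_tmul, hp]
    simp
  | hadd x y hx hy => simp only [map_add, Finsupp.add_apply, hx, hy]

theorem tensorCoeffs_sum {y : β → B} (hy : ∀ i, p (y i) = bas i) (x : β →₀ A) :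
    tensorCoeffs A bas p (x.sum fun b a => tmul A B a (y b)) = x := by
  classical
  induction x using Finsupp.induction_linear with
  | zero => simp
  | add x y hx hy => rw [Finsupp.sum_add_index' (by simp) (by simp), map_add, hx, hy]
  | single b a =>
    rw [Finsupp.sum_single_index (by simp)]
    ext i
    rw [tensorCoeffs_tmul, hy, Module.Basis.repr_self, Finsupp.single_apply, Finsupp.single_apply]
    split_ifs <;> simp

theorem sum_tensorCoeffs (σ : B.cohomology →ₗ[K] B) (t : TensorCarrier A B) :
    ((tensorCoeffs A bas p t).sum fun b a => tmul A B a (σ (bas b))) =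
      tensorMap A B LinearMap.id (σ ∘ₗ p) t := by
  classical
  induction t using tensor_induction with
  | hm k l a ha b hb =>
    rw [tensorMap_tmul, LinearMap.comp_apply]
    conv_rhs => rw [← bas.linearCombination_repr (p b)]
    rw [Finsupp.linearCombination_apply, map_finsuppSum, map_finsuppSum,
      Finsupp.sum_of_support_subset (s := (bas.repr (p b)).support)]
    · refine Finset.sum_congr rfl fun i _ => ?_
      rw [tensorCoeffs_tmul]
      simp
    · intro i hi
      rw [Finsupp.mem_support_iff] at *
      intro h0
      rw [tensorCoeffs_tmul, h0, zero_smul] at hi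
      exact hi rfl
    · simp
  | hadd x y hx hy =>
    rw [map_add, map_add, Finsupp.sum_add_index' (by simp) (by simp), hx, hy]

end Coefficients

/-- `A ⊗ B` deforms onto `A ⊗ H(B)`: the map `1 ⊗ σ p` is homotopic to the identity through `sign ⊗
s`. The coefficients of a cocycle are therefore cocycles that represent it, and the coefficients of
a primitive are primitives of the coefficients. -/
theorem isKunneth_tensor {β : Type*} (bas : Module.Basis β K B.cohomology)
    (σ : B.cohomology →ₗ[K] B.cocycles) (hσ : ∀ q, clsₗ B (σ q) = q) :
    IsKunneth (tensorInl A B) (tensorInr A B) fun b => (σ (bas b) : B) := by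
  obtain ⟨s, p, hs, hpd, hpσ⟩ := exists_contraction B σ hσ
  have hsum : ∀ x : β →₀ A, (x.sum fun b a => (tensorInl A B).toAlgHom a *
      (tensorInr A B).toAlgHom (σ (bas b) : B)) = x.sum fun b a => tmul A B a (σ (bas b)) := by
    intro x
    simp only [tensorInl_mul_tensorInr]
    rfl
  constructor
  · intro ω hω
    change tensorD A B ω = 0 at hω
    refine ⟨tensorCoeffs A bas p ω, fun b => ?_, tensorMap A B A.sign s ω, ?_⟩
    · refine (tensorCoeffs_tensorD bas p hpd _ b).symm.trans ?_
      rw [hω, map_zero, Finsupp.zero_apply]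
    · rw [hsum]
      have h1 := tensorD_tensorMap_sign (A := A) (π := (B.cocycles.val.toLinearMap ∘ₗ σ) ∘ₗ p) hs ω
      have h2 := sum_tensorCoeffs bas p (B.cocycles.val.toLinearMap ∘ₗ σ) ω
      rw [hω, map_zero, add_zero] at h1
      refine Eq.trans ?_ (congrArg₂ (· + ·) h2.symm h1.symm)
      exact (add_sub_cancel _ _).symm
  · rintro x - ⟨η, hη⟩ b
    refine ⟨tensorCoeffs A bas p η b, ?_⟩
    refine (tensorCoeffs_tensorD bas p hpd _ b).symm.trans ?_
    have h1 := tensorCoeffs_sum bas p (fun i => hpσ (bas i)) x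
    conv_rhs => rw [← h1]
    rw [← hsum, ← hη]
    rfl

/-- The Künneth isomorphism over a field. No finiteness is needed, as any basis of `H(B)` will do.
-/
instance (A B : CDGA.{w} K) : Limits.PreservesColimit (Limits.pair A B) (cohomologyFunctor K) := by
  obtain ⟨σ, hσ⟩ := exists_clsₗ_section (A := B)
  obtain ⟨h⟩ := (isKunneth_tensor (A := A) (Module.Basis.ofVectorSpace K B.cohomology) σ
    hσ).nonempty_isColimit (Module.Basis.ofVectorSpace K B.cohomology) fun b => (hσ _).symm
  exact Limits.preservesColimit_of_preserves_colimit_cocone (tensorIsColimit A B)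
    ((Limits.isColimitMapCoconeBinaryCofanEquiv _ _ _).symm h)

instance : Limits.PreservesColimitsOfShape (Discrete Limits.WalkingPair)
    (cohomologyFunctor.{w} K) where
  preservesColimit {F} :=
    Limits.preservesColimit_of_iso_diagram _ (Limits.diagramIsoPair F).symm

instance : Limits.HasInitial (CDGA.{max u v} K) :=
  (isInitialOfBijective _ unit_algebraMap_bijective.{v, u}).hasInitial

instance : Limits.HasFiniteCoproducts (CDGA.{max u v} K) :=
  hasFiniteCoproducts_of_has_binary_and_initial

instance : Limits.PreservesColimit (Functor.empty.{0} (CDGA.{max u v} K))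
    (cohomologyFunctor K) :=
  Limits.preservesInitial_of_iso _
    (((isInitialOfBijective (K := K) _ cohomology_unit_bijective.{v, u}).uniqueUpToIso
      Limits.initialIsInitial).symm ≪≫ (cohomologyFunctor K).mapIso
        ((isInitialOfBijective _ unit_algebraMap_bijective.{v, u}).uniqueUpToIso
          Limits.initialIsInitial))

instance : Limits.PreservesFiniteCoproducts (cohomologyFunctor.{max u v} K) :=
  haveI : Limits.PreservesColimitsOfShape (Discrete PEmpty.{1}) (cohomologyFunctor.{max u v} K) :=
    Limits.preservesColimitsOfShape_pempty_of_preservesInitial _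
  ⟨fun _ => PreservesFiniteCoproducts.of_preserves_binary_and_initial _ _⟩

end CDGA

/-! ### The simplicial replacement of a diagram by coproducts -/

namespace CosimplicialReplacement

open Limits

section Coproducts

variable {I : Type u} [SmallCategory I] [FinCategory I] {C : Type*} [Category C]
  [HasFiniteCoproducts C]

/-- A string is determined by its objects and its morphisms, of which a finite category has finitely
many. Pairs of positions without a morphism are filled with a dummy value, so that strings embed
into a plain finite type. -/
instance (a : SimplexCategory) : Finite (Strings I a) := by
  let e : Strings I a → Sigma fun o : Fin (a.len + 1) → I =>
      ∀ i j : Fin (a.len + 1), (o j ⟶ o i) ⊕ PUnit.{u + 1} := fun s =>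
    ⟨fun i => s.obj (op i), fun i j =>
      if h : i ≤ j then Sum.inl (s.map (homOfLE h).op) else Sum.inr ⟨⟩⟩
  refine Finite.of_injective e fun s t h => ?_
  obtain ⟨h1, h2⟩ := Sigma.mk.inj_iff.1 h
  refine CategoryTheory.Functor.ext (fun i => congrFun h1 i.unop) fun i j f => ?_
  have ho : s.obj = t.obj := by ext i; exact congrFun h1 i.unop
  obtain ⟨so, sm, _, _⟩ := s
  obtain ⟨to', tm, _, _⟩ := t
  obtain rfl : so = to' := ho
  have h3 := congrFun (congrFun (eq_of_heq h2) j.unop) i.unop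
  have hij : j.unop ≤ i.unop := leOfHom f.unop
  simp only [dif_pos hij, Sum.inl.injEq] at h3
  have hf : f = (homOfLE hij).op := Subsingleton.elim _ _
  subst hf
  simpa using h3

/-- The simplicial replacement of a contravariant diagram: in degree `n`, the coproduct over all
strings `i₀ ← ⋯ ← iₙ` of the objects `A(i₀)`. -/
noncomputable def coproductReplacement (A : Iᵒᵖ ⥤ C) : SimplexCategoryᵒᵖ ⥤ C where
  obj a := ∐ fun s : Strings I a.unop => A.obj (op (s.obj (op 0)))
  map {a b} θ := Sigma.desc fun s : Strings I a.unop =>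
    A.map (s.toFirst θ.unop).op ≫
      Sigma.ι (fun s : Strings I b.unop => A.obj (op (s.obj (op 0)))) (s.restrict θ.unop)
  map_id a := by
    refine Sigma.hom_ext _ _ fun s => ?_
    rw [Sigma.ι_desc]
    have h : A.map (s.toFirst (𝟙 a.unop)).op = 𝟙 _ :=
      (congrArg (fun f => A.map (Quiver.Hom.op f)) s.toFirst_id).trans (A.map_id _)
    refine Eq.trans ?_ (Category.comp_id _).symm
    exact (congrArg (· ≫ Sigma.ι (fun s : Strings I a.unop => A.obj (op (s.obj (op 0)))) s) h).trans
      (Category.id_comp _)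
  map_comp {a b c} θ ψ := by
    refine Sigma.hom_ext _ _ fun s => ?_
    rw [Sigma.ι_desc, Sigma.ι_desc_assoc, Category.assoc, Sigma.ι_desc]
    have h : A.map (s.toFirst (θ ≫ ψ).unop).op =
        A.map (s.toFirst θ.unop).op ≫ A.map ((s.restrict θ.unop).toFirst ψ.unop).op :=
      (congrArg (fun f => A.map (Quiver.Hom.op f)) (s.toFirst_comp ψ.unop θ.unop)).trans
        (A.map_comp _ _)
    exact (congrArg (· ≫ Sigma.ι (fun s : Strings I c.unop => A.obj (op (s.obj (op 0))))
      ((s.restrict θ.unop).restrict ψ.unop)) h).trans (Category.assoc _ _ _)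

/-- The simplicial replacement is functorial in the diagram. -/
noncomputable def coproductReplacementMap {A B : Iᵒᵖ ⥤ C} (η : A ⟶ B) :
    coproductReplacement A ⟶ coproductReplacement B where
  app a := Sigma.desc fun s : Strings I a.unop =>
    η.app (op (s.obj (op 0))) ≫
      Sigma.ι (fun s : Strings I a.unop => B.obj (op (s.obj (op 0)))) s
  naturality {a b} θ := by
    refine Sigma.hom_ext _ _ fun s => ?_
    simp only [coproductReplacement, Sigma.ι_desc_assoc, Sigma.ι_desc, Category.assoc,
      NatTrans.naturality_assoc]

/-- A compatible family of maps out of the objects `A(i₀)` gives a map out of the simplicial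
replacement. -/
noncomputable def coproductReplacementDesc {A : Iᵒᵖ ⥤ C} {G : SimplexCategoryᵒᵖ ⥤ C}
    (φ : ∀ (a : SimplexCategory) (s : Strings I a), A.obj (op (s.obj (op 0))) ⟶ G.obj (op a))
    (hφ : ∀ {a b : SimplexCategory} (θ : a ⟶ b) (s : Strings I b),
      φ b s ≫ G.map θ.op = A.map (s.toFirst θ).op ≫ φ a (s.restrict θ)) :
    coproductReplacement A ⟶ G where
  app a := Sigma.desc fun s => φ a.unop s
  naturality {a b} θ := by
    refine Sigma.hom_ext _ _ fun s => ?_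
    simp only [coproductReplacement, Sigma.ι_desc_assoc, Sigma.ι_desc, Category.assoc]
    exact (hφ θ.unop s).symm

end Coproducts

end CosimplicialReplacement

/-! ### Reduction to the cohomology of the finite products `Πⁿ F` -/

namespace CDGA

open Limits CosimplicialReplacement

variable {K : Type v} [Field K]

theorem isIso_sigma_desc {C : Type*} [Category C] {ι : Type*} {A : ι → C} [HasCoproduct A] {P : C}
    (φ : ∀ i, A i ⟶ P) (h : IsColimit (Cofan.mk P φ)) : IsIso (Sigma.desc φ) := by
  have : Sigma.desc φ = ((coproductIsCoproduct A).coconePointUniqueUpToIso h).hom := by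
    refine Sigma.hom_ext _ _ fun i => ?_
    rw [Sigma.ι_desc]
    exact ((coproductIsCoproduct A).comp_coconePointUniqueUpToIso_hom h ⟨i⟩).symm
  rw [this]
  infer_instance

theorem isQuasiIso_of_isIso {A B : CDGA.{w} K} (f : A ⟶ B) [IsIso f] : IsQuasiIso f := by
  rw [isQuasiIso_iff_isIso]
  infer_instance

/-- Cohomology preserves the finite coproduct, so `H(∐ A i)` and `H(P)` are coproducts of the same
objects, and the map between them is the canonical comparison. -/
theorem isQuasiIso_sigma_desc {ι : Type*} [Finite ι] {A : ι → CDGA.{max u v} K}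
    {P : CDGA.{max u v} K} (φ : ∀ i, A i ⟶ P)
    (h : IsColimit (Cofan.mk ((cohomologyFunctor K).obj P)
      fun i => (cohomologyFunctor K).map (φ i))) : IsQuasiIso (Sigma.desc φ) := by
  rw [isQuasiIso_iff_isIso]
  have h' := isColimitCofanMkObjOfIsColimit (cohomologyFunctor K) _ _ (coproductIsCoproduct A)
  have : (cohomologyFunctor K).map (Sigma.desc φ) = (h'.coconePointUniqueUpToIso h).hom := by
    refine Cofan.IsColimit.hom_ext h' _ _ fun i => ?_
    refine Eq.trans ?_ (h'.comp_coconePointUniqueUpToIso_hom h ⟨i⟩).symm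
    change (cohomologyFunctor K).map (Sigma.ι A i) ≫ (cohomologyFunctor K).map (Sigma.desc φ) =
      (cohomologyFunctor K).map (φ i)
    rw [← Functor.map_comp, Sigma.ι_desc]
  rw [this]
  infer_instance

variable {I : Type u} [SmallCategory I] [FinCategory I]

/-- A coproduct cofan precomposed with isomorphisms. -/
noncomputable def isColimitCofanPrecomp {C : Type*} [Category C] {ι : Type*} {A B : ι → C} {P : C}
    (e : ∀ i, A i ⟶ B i) [∀ i, IsIso (e i)] (g : ∀ i, B i ⟶ P) (h : IsColimit (Cofan.mk P g)) :
    IsColimit (Cofan.mk P fun i => e i ≫ g i) :=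
  Cofan.IsColimit.mk _ (fun c => Cofan.IsColimit.desc h fun s => inv (e s) ≫ c.inj s)
    (fun c s => by
      change (e s ≫ g s) ≫ _ = _
      rw [Category.assoc]
      refine (congrArg (e s ≫ ·) (Cofan.IsColimit.fac h _ s)).trans ?_
      simp)
    fun c m hm => Cofan.IsColimit.hom_ext h _ _ fun s => by
      refine Eq.trans ?_ (Cofan.IsColimit.fac h _ s).symm
      rw [IsIso.eq_inv_comp, ← hm s]
      exact (Category.assoc _ _ _).symm

theorem isQuasiIso_sigma_map {ι : Type*} [Finite ι] {A B : ι → CDGA.{max u v} K}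
    (f : ∀ i, A i ⟶ B i) (hf : ∀ i, IsQuasiIso (f i)) :
    IsQuasiIso (Sigma.desc fun i => f i ≫ Sigma.ι B i) := by
  refine isQuasiIso_sigma_desc _ ?_
  simp only [Functor.map_comp]
  have : ∀ i, IsIso ((cohomologyFunctor K).map (f i)) :=
    fun i => (isQuasiIso_iff_isIso _).1 (hf i)
  exact isColimitCofanPrecomp (fun i => (cohomologyFunctor K).map (f i)) _
    (isColimitCofanMkObjOfIsColimit (cohomologyFunctor K) _ _ (coproductIsCoproduct B))

theorem NatQuasiIso.coproductReplacement {A B : Iᵒᵖ ⥤ CDGA.{max u v} K} (h : NatQuasiIso A B) :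
    NatQuasiIso (coproductReplacement A) (coproductReplacement B) := by
  obtain ⟨η, hη⟩ := h
  exact ⟨coproductReplacementMap η, fun a =>
    isQuasiIso_sigma_map (fun s : Strings I a.unop => η.app (op (s.obj (op 0)))) fun s => hη _⟩

theorem eqvGen_coproductReplacement {A B : Iᵒᵖ ⥤ CDGA.{max u v} K}
    (h : Relation.EqvGen NatQuasiIso A B) :
    Relation.EqvGen NatQuasiIso (coproductReplacement A) (coproductReplacement B) := by
  induction h with
  | rel _ _ h => exact .rel _ _ h.coproductReplacement
  | refl => exact .refl _
  | symm _ _ _ ih => exact .symm _ _ ih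
  | trans _ _ _ _ _ ih ih' => exact .trans _ _ _ ih ih'

/-- The projection of `Πⁿ F` onto the factor of a string. -/
def spaceProj (F : I ⥤ TopCat.{u}) (a : SimplexCategory) (s : Strings I a) :
    space F a ⟶ F.obj (s.obj (op 0)) :=
  TopCat.ofHom ⟨fun x => x s, continuous_apply s⟩

/-- The zig-zag runs `A_PL(Π^• F) ← ∐ A_PL(F(i₀)) ~ ∐ H(A_PL(F(i₀))) → H(A_PL(Π^• F))`. The middle
part is the image of the zig-zag of `F`; `hcol` serves at both ends. -/
theorem isFormalDiagram_cosimplicialReplacement {F : I ⥤ TopCat.{u}} (hF : IsFormalDiagram K F)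
    (hcol : ∀ a : SimplexCategory, Nonempty (IsColimit (Cofan.mk
      ((cohomologyFunctor K).obj ((APLTop K).obj (op (space F a))))
      fun s => (cohomologyFunctor K).map ((APLTop K).map (spaceProj F a s).op)))) :
    IsFormalDiagram K (cosimplicialReplacement F) := by
  -- This is `A_PL` of the formula for the coordinates of the structure maps of `Π^• F`; it makes
  -- both end maps natural.
  have hcomm : ∀ {a b : SimplexCategory} (θ : a ⟶ b) (s : Strings I b),
      (APLTop K).map (spaceProj F b s).op ≫
        (APLTop K).map ((cosimplicialReplacement F).map θ).op =
      (APLTop K).map (F.map (s.toFirst θ)).op ≫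
        (APLTop K).map (spaceProj F a (s.restrict θ)).op := by
    intro a b θ s
    exact ((APLTop K).map_comp _ _).symm.trans ((APLTop K).map_comp _ _)
  have h1 : NatQuasiIso (coproductReplacement (F.op ⋙ APLTop K))
      ((cosimplicialReplacement F).op ⋙ APLTop K) :=
    ⟨coproductReplacementDesc (fun a s => (APLTop K).map (spaceProj F a s).op) hcomm,
      fun a => isQuasiIso_sigma_desc _ (hcol a.unop).some⟩
  have h2 : NatQuasiIso (coproductReplacement ((F.op ⋙ APLTop K) ⋙ cohomologyFunctor K))
      (((cosimplicialReplacement F).op ⋙ APLTop K) ⋙ cohomologyFunctor K) := by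
    refine ⟨coproductReplacementDesc
      (fun a s => (cohomologyFunctor K).map ((APLTop K).map (spaceProj F a s).op))
      fun {a b} θ s => ?_, fun a => ?_⟩
    · exact ((cohomologyFunctor K).map_comp _ _).symm.trans
        ((congrArg (cohomologyFunctor K).map (hcomm θ s)).trans ((cohomologyFunctor K).map_comp _ _))
    · exact @isQuasiIso_of_isIso _ _ _ _ _ (isIso_sigma_desc _ (hcol a.unop).some)
  exact .trans _ _ _ (.symm _ _ (.rel _ _ h1))
    (.trans _ _ _ (eqvGen_coproductReplacement hF) (.rel _ _ h2))

end CDGA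

/-! ### Extendable simplicial modules: from exactness on simplices to exactness on simplicial sets
-/

/-- A simplicial `K`-module. -/
structure SimplicialModule (K : Type v) [Field K] where
  obj : SimplexCategory → Type w
  [addCommGroup : ∀ a, AddCommGroup (obj a)]
  [module : ∀ a, Module K (obj a)]
  /-- The simplicial operators. -/
  map {a b : SimplexCategory} (θ : a ⟶ b) : obj b →ₗ[K] obj a
  map_id (a : SimplexCategory) (x : obj a) : map (𝟙 a) x = x
  map_comp {a b c : SimplexCategory} (θ : a ⟶ b) (ψ : b ⟶ c) (x : obj c) :
    map (θ ≫ ψ) x = map θ (map ψ x)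

namespace SimplicialModule

variable {K : Type v} [Field K]

instance (E : SimplicialModule.{w} K) (a : SimplexCategory) : AddCommGroup (E.obj a) :=
  E.addCommGroup a

instance (E : SimplicialModule.{w} K) (a : SimplexCategory) : Module K (E.obj a) :=
  E.module a

variable (E : SimplicialModule.{w} K)

open Simplicial SimplexCategory

theorem map_eq_of_comp_eq {a b b' c : SimplexCategory} {θ : a ⟶ b} {ψ : b ⟶ c} {θ' : a ⟶ b'}
    {ψ' : b' ⟶ c} (h : θ ≫ ψ = θ' ≫ ψ') (x : E.obj c) :
    E.map θ (E.map ψ x) = E.map θ' (E.map ψ' x) := by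
  rw [← E.map_comp, h, E.map_comp]

theorem map_map_of_comp_eq_id {a b : SimplexCategory} {θ : a ⟶ b} {ψ : b ⟶ a} (h : θ ≫ ψ = 𝟙 a)
    (x : E.obj a) : E.map θ (E.map ψ x) = x := by
  rw [← E.map_comp, h, E.map_id]

/-- A simplicial submodule. -/
structure Sub where
  carrier (a : SimplexCategory) : Submodule K (E.obj a)
  map_mem {a b : SimplexCategory} (θ : a ⟶ b) {x : E.obj b} (hx : x ∈ carrier b) :
    E.map θ x ∈ carrier a

/-- A family of elements indexed by the simplices of `X` that is compatible with the simplicial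
operators. -/
def IsNatural (X : SSet.{u}) (f : ∀ a : SimplexCategory, X.obj (op a) → E.obj a) : Prop :=
  ∀ (a b : SimplexCategory) (θ : a ⟶ b) (x : X.obj (op b)), f a (X.map θ.op x) = E.map θ (f b x)

variable {E}

/-- Every compatible family on the boundary of a simplex extends to the simplex. -/
def Sub.Extendable (S : E.Sub) : Prop :=
  ∀ (n : ℕ) (f : ∀ a : SimplexCategory, (∂Δ[n] : SSet.{w}).obj (op a) → E.obj a),
    E.IsNatural _ f → (∀ a x, f a x ∈ S.carrier a) →
    ∃ e ∈ S.carrier ⦋n⦌, ∀ a (x : (∂Δ[n] : SSet.{w}).obj (op a)),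
      E.map (SSet.stdSimplex.objEquiv x.1) e = f a x

/-- The simplicial subset underlying a simplicial submodule. -/
def Sub.toSSet (S : E.Sub) : SSet.{w} where
  obj a := S.carrier a.unop
  map θ := TypeCat.ofHom fun x => ⟨E.map θ.unop x.1, S.map_mem _ x.2⟩
  map_id a := by
    ext x
    exact E.map_id _ _
  map_comp θ ψ := by
    ext x
    exact E.map_comp _ _ _

/-- A natural endomorphism of a simplicial module. -/
structure End (E : SimplicialModule.{w} K) where
  app (a : SimplexCategory) : E.obj a →ₗ[K] E.obj a
  naturality {a b : SimplexCategory} (θ : a ⟶ b) (x : E.obj b) :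
    app a (E.map θ x) = E.map θ (app b x)

/-- The elements of a simplicial submodule killed by an endomorphism. -/
def Sub.ker (S : E.Sub) (D : E.End) : E.Sub where
  carrier a := S.carrier a ⊓ LinearMap.ker (D.app a)
  map_mem θ x hx := ⟨S.map_mem θ hx.1, by
    have : D.app _ x = 0 := hx.2
    change D.app _ (E.map θ x) = 0
    rw [D.naturality, this, map_zero]⟩

/-- The map of simplicial sets induced by an endomorphism. -/
def Sub.mapSSet {S T : E.Sub} (D : E.End)
    (h : ∀ a, ∀ x ∈ S.carrier a, D.app a x ∈ T.carrier a) : S.toSSet ⟶ T.toSSet where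
  app a := TypeCat.ofHom fun x => ⟨D.app _ x.1, h _ _ x.2⟩
  naturality a b θ := by
    ext x
    exact Subtype.ext (D.naturality _ _)

/-- It is enough to lift against `∂Δ[n] ⟶ Δ[n]`. Any preimage `c` of the given simplex differs from
the prescribed boundary by a family in the kernel of `D`. That family extends to some `e`, and `c +
e` is the lift. -/
theorem Sub.mapSSet_rlp {S T : E.Sub} (D : E.End)
    (h : ∀ a, ∀ x ∈ S.carrier a, D.app a x ∈ T.carrier a)
    (hsurj : ∀ a, ∀ y ∈ T.carrier a, ∃ x ∈ S.carrier a, D.app a x = y)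
    (hker : (S.ker D).Extendable) :
    (MorphismProperty.monomorphisms SSet.{w}).rlp (Sub.mapSSet D h) := by
  rw [SSet.rlp_monomorphisms]
  rintro _ _ _ ⟨n⟩
  refine ⟨fun {f g} sq => ⟨?_⟩⟩
  obtain ⟨c, hc, hcg⟩ := hsurj ⦋n⦌ (SSet.yonedaEquiv g).1 (SSet.yonedaEquiv g).2
  have hg : ∀ a (x : (Δ[n] : SSet.{w}).obj (op a)),
      ((g.app (op a)) x).1 = E.map (SSet.stdSimplex.objEquiv x) (D.app _ c) := by
    intro a x
    have h1 : (SSet.yonedaEquiv.symm (SSet.yonedaEquiv g)).app (op a) x = g.app (op a) x := by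
      rw [Equiv.symm_apply_apply]
    rw [← h1, hcg]
    rfl
  have hfg : ∀ a (x : (∂Δ[n] : SSet.{w}).obj (op a)),
      D.app a ((f.app (op a)) x).1 = E.map (SSet.stdSimplex.objEquiv x.1) (D.app _ c) := by
    intro a x
    rw [← hg]
    exact congrArg Subtype.val (ConcreteCategory.congr_hom (congr_app sq.w (op a)) x)
  -- The defect of `c` on the boundary; `hfg` says that `D` annihilates it.
  obtain ⟨e, he, hef⟩ := hker n
    (fun a x => ((f.app (op a)) x).1 - E.map (SSet.stdSimplex.objEquiv x.1) c) (by
      intro a b θ x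
      rw [map_sub, ← E.map_comp]
      exact congrArg (· - _) (congrArg Subtype.val (NatTrans.naturality_apply f θ.op x)))
    (fun a x => ⟨sub_mem ((f.app (op a)) x).2 (S.map_mem _ hc), by
      change D.app a (_ - _) = 0
      rw [map_sub, hfg, D.naturality, sub_self]⟩)
  refine ⟨
    { l := (SSet.yonedaEquiv (X := S.toSSet) (n := ⦋n⦌)).symm
        (⟨c + e, add_mem hc he.1⟩ : S.carrier ⦋n⦌)
      fac_left := ?_
      fac_right := ?_ }⟩
  · ext a x
    refine Subtype.ext ?_
    change E.map (SSet.stdSimplex.objEquiv x.1) (c + e) = ((f.app a) x).1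
    rw [map_add, hef a.unop x]
    exact add_sub_cancel _ _
  · ext a x
    refine Subtype.ext ?_
    change D.app _ (E.map (SSet.stdSimplex.objEquiv x) (c + e)) = ((g.app a) x).1
    have he' : D.app _ e = 0 := he.2
    rw [D.naturality, map_add, he', add_zero]
    exact (hg a.unop x).symm

/-- A compatible family over `X` with values in `T` is a map of simplicial sets from `X`, and
lifting it along `D` is a lifting problem against the monomorphism `∅ ⟶ X`. -/
theorem Sub.exists_lift {S T : E.Sub} (D : E.End)
    (h : ∀ a, ∀ x ∈ S.carrier a, D.app a x ∈ T.carrier a)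
    (hsurj : ∀ a, ∀ y ∈ T.carrier a, ∃ x ∈ S.carrier a, D.app a x = y)
    (hker : (S.ker D).Extendable) (X : SSet.{w})
    (f : ∀ a : SimplexCategory, X.obj (op a) → E.obj a) (hf : E.IsNatural X f)
    (hfT : ∀ a x, f a x ∈ T.carrier a) :
    ∃ g : ∀ a : SimplexCategory, X.obj (op a) → E.obj a, E.IsNatural X g ∧
      (∀ a x, g a x ∈ S.carrier a) ∧ ∀ a x, D.app a (g a x) = f a x := by
  let F : X ⟶ T.toSSet :=
    { app := fun a => TypeCat.ofHom fun x => ⟨f a.unop x, hfT _ _⟩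
      naturality := fun a b θ => by
        ext x
        exact Subtype.ext (hf _ _ θ.unop x) }
  have hlift := Sub.mapSSet_rlp D h hsurj hker (⊥ : X.Subcomplex).ι
    (inferInstanceAs (Mono (⊥ : X.Subcomplex).ι))
  have sq : CommSq (SSet.Subcomplex.isInitialBot.to S.toSSet) (⊥ : X.Subcomplex).ι
    (Sub.mapSSet D h) F := ⟨SSet.Subcomplex.isInitialBot.hom_ext _ _⟩
  refine ⟨fun a x => ((sq.lift.app (op a)) x).1, fun a b θ x => ?_,
    fun a x => ((sq.lift.app (op a)) x).2, fun a x => ?_⟩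
  · exact congrArg Subtype.val (NatTrans.naturality_apply sq.lift θ.op x)
  · exact congrArg Subtype.val (ConcreteCategory.congr_hom (congr_app sq.fac_right (op a)) x)

/-- A complex of extendable simplicial modules that is exact in each simplicial degree stays exact
after evaluation on any simplicial set. -/
theorem exists_preimage (D : E.End) (C : ℕ → E.Sub)
    (hD : ∀ k a, ∀ x ∈ (C k).carrier a, D.app a x ∈ (C (k + 1)).carrier a)
    (hDD : ∀ a x, D.app a (D.app a x) = 0) (hext : ∀ k, (C k).Extendable)
    (hzero : ∀ a, ∀ x ∈ (C 0).carrier a, D.app a x = 0 → x = 0)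
    (hexact : ∀ k a, ∀ x ∈ (C (k + 1)).carrier a, D.app a x = 0 →
      ∃ y ∈ (C k).carrier a, D.app a y = x) (X : SSet.{w}) (k : ℕ)
    (f : ∀ a : SimplexCategory, X.obj (op a) → E.obj a) (hf : E.IsNatural X f)
    (hfC : ∀ a x, f a x ∈ (C (k + 1)).carrier a) (hfD : ∀ a x, D.app a (f a x) = 0) :
    ∃ g : ∀ a : SimplexCategory, X.obj (op a) → E.obj a, E.IsNatural X g ∧
      (∀ a x, g a x ∈ (C k).carrier a) ∧ ∀ a x, D.app a (g a x) = f a x := by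
  -- The cocycles are extendable, by induction on the degree. In degree `0` they vanish. In degree
  -- `k + 1`, a family of cocycles on `∂Δ[n]` lifts along `D` to `C k` by the previous case, the
  -- lift extends to `Δ[n]`, and `D` of the extension is the required cocycle.
  have hext' : ∀ k, ((C k).ker D).Extendable := by
    intro k
    induction k with
    | zero =>
      intro n f _ hf
      exact ⟨0, zero_mem _, fun a x => by rw [map_zero, hzero a _ (hf a x).1 (hf a x).2]⟩
    | succ k ih =>
      intro n f hf hfC
      obtain ⟨g, hg, hgC, hgf⟩ := Sub.exists_lift (S := C k) (T := (C (k + 1)).ker D) D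
        (fun a x hx => ⟨hD k a x hx, hDD a x⟩) (fun a y hy => hexact k a y hy.1 hy.2) ih _ f hf hfC
      obtain ⟨e, he, heg⟩ := hext k n g hg hgC
      refine ⟨D.app _ e, ⟨hD k _ e he, hDD _ e⟩, fun a x => ?_⟩
      rw [← D.naturality, heg, hgf]
  exact Sub.exists_lift (S := C k) (T := (C (k + 1)).ker D) D
    (fun a x hx => ⟨hD k a x hx, hDD a x⟩) (fun a y hy => hexact k a y hy.1 hy.2) (hext' k) X f hf
    fun a x => ⟨hfC a x, hfD a x⟩

end SimplicialModule

/-! ### Extension from the boundary by means of barycentric coordinates -/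

namespace SimplicialModule

variable {K : Type v} [Field K] {E : SimplicialModule.{w} K}

open Simplicial SimplexCategory

/-- Simplicial modules satisfy the Kan condition, here for the horn without face `0`. Starting from
`0`, the faces are corrected from the last one downwards. Adding `σ j` of the error at face `j + 1`
repairs that face. It does not disturb the higher faces, because they already match and so the
corresponding faces of the error vanish. -/
theorem exists_horn_filler (S : E.Sub) {n : ℕ} (φ : Fin (n + 3) → E.obj ⦋n + 1⦌)
    (hφ : ∀ i, φ i ∈ S.carrier _)
    (hcomp : ∀ i j : Fin (n + 2), i ≤ j →
      E.map (δ i) (φ j.succ) = E.map (δ j) (φ i.castSucc)) :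
    ∃ w ∈ S.carrier ⦋n + 2⦌, ∀ i : Fin (n + 2), E.map (δ i.succ) w = φ i.succ := by
  suffices h : ∀ k : ℕ, ∃ w ∈ S.carrier ⦋n + 2⦌, ∀ i : Fin (n + 2), n + 2 ≤ i.val + k →
      E.map (δ i.succ) w = φ i.succ by
    obtain ⟨w, hw, h⟩ := h (n + 2)
    exact ⟨w, hw, fun i => h i (by omega)⟩
  intro k
  induction k with
  | zero => exact ⟨0, zero_mem _, fun i hi => absurd i.2 (by omega)⟩
  | succ k ih =>
    obtain ⟨w, hw, h⟩ := ih
    by_cases hk : n + 1 < k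
    · exact ⟨w, hw, fun i _ => h i (by omega)⟩
    -- The last `k` faces already match, so face `j + 1 = n + 2 - k` comes next.
    let j : Fin (n + 2) := ⟨n + 1 - k, by omega⟩
    refine ⟨w + E.map (σ j) (φ j.succ - E.map (δ j.succ) w),
      add_mem hw (S.map_mem _ (sub_mem (hφ _) (S.map_mem _ hw))), fun i hi => ?_⟩
    rcases eq_or_lt_of_le (show j ≤ i from Fin.le_def.2 (by simp [j]; omega)) with hij | hij
    · subst hij
      rw [map_add, E.map_map_of_comp_eq_id (δ_comp_σ_succ), add_sub_cancel]
    · have hjn : j.val < n + 1 := by have := Fin.lt_def.1 hij; omega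
      obtain ⟨j₀, hj₀⟩ : ∃ j₀ : Fin (n + 1), j = j₀.castSucc := ⟨⟨j, hjn⟩, rfl⟩
      have hi' : E.map (δ i.succ) w = φ i.succ := h i (by
        have := Fin.lt_def.1 hij
        simp only [j] at this
        omega)
      have hz : E.map (δ i) (φ j.succ - E.map (δ j.succ) w) = 0 := by
        have hle : j₀.succ ≤ i := by
          rw [hj₀] at hij
          exact Fin.castSucc_lt_iff_succ_le.1 hij
        have hs : j.succ = j₀.succ.castSucc := by rw [hj₀, Fin.succ_castSucc]
        rw [map_sub, hs, ← hcomp _ _ hle, E.map_eq_of_comp_eq (δ_comp_δ hle).symm, hi', sub_self]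
      rw [map_add, hi', hj₀, E.map_eq_of_comp_eq (δ_comp_σ_of_gt (hj₀ ▸ hij)), ← hj₀, hz, map_zero,
        add_zero]

/-- Multiplication by barycentric coordinates on a simplicial module. -/
structure Bary (E : SimplicialModule.{w} K) where
  act (a : SimplexCategory) (i : Fin (a.len + 1)) : E.obj a →ₗ[K] E.obj a
  sum_act (a : SimplexCategory) (x : E.obj a) : ∑ i, act a i x = x
  map_act {a b : SimplexCategory} (θ : a ⟶ b) (i : Fin (b.len + 1)) (x : E.obj b) :
    E.map θ (act b i x) = ∑ j with θ.toOrderHom j = i, act a j (E.map θ x)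

namespace Bary

variable (T : E.Bary)

theorem map_sum_act {a b : SimplexCategory} (θ : a ⟶ b) (s : Finset (Fin (b.len + 1)))
    (x : E.obj b) :
    E.map θ (∑ i ∈ s, T.act b i x) = ∑ j with θ.toOrderHom j ∈ s, T.act a j (E.map θ x) := by
  classical
  rw [map_sum]
  simp only [T.map_act]
  rw [← Finset.sum_fiberwise_of_maps_to (s := Finset.univ.filter fun j => θ.toOrderHom j ∈ s)
    (t := s) (g := fun j => θ.toOrderHom j) (by simp)]
  refine Finset.sum_congr rfl fun i hi => Finset.sum_congr ?_ fun _ _ => rfl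
  ext j
  simp only [Finset.mem_filter, Finset.mem_univ, true_and]
  exact ⟨fun h => ⟨h ▸ hi, h⟩, fun h => h.2⟩

/-- The sum of the barycentric coordinates from the `k`-th on. -/
def tail {n : ℕ} (k : ℕ) (x : E.obj ⦋n⦌) : E.obj ⦋n⦌ :=
  ∑ i : Fin (n + 1) with k ≤ i.val, T.act ⦋n⦌ i x

/-- The map `δ i` omits the value `i`, so the thresholds `i` and `i + 1` select the same vertices,
those `j` with `i ≤ j`. -/
theorem map_δ_tail {n : ℕ} (i : Fin (n + 2)) (k : ℕ) (hk : k = i.val ∨ k = i.val + 1)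
    (x : E.obj ⦋n + 1⦌) : E.map (δ i) (T.tail k x) = T.tail i.val (E.map (δ i) x) := by
  refine (T.map_sum_act (δ i) _ x).trans ?_
  refine Finset.sum_congr ?_ fun _ _ => rfl
  ext j
  simp only [Finset.mem_filter, Finset.mem_univ, true_and]
  change k ≤ (i.succAbove j).val ↔ _
  rcases lt_or_ge j.castSucc i with h | h
  · rw [Fin.succAbove_of_castSucc_lt _ _ h]
    rw [Fin.lt_def] at h
    simp only [Fin.val_castSucc] at *
    omega
  · rw [Fin.succAbove_of_le_castSucc _ _ h]
    rw [Fin.le_def] at h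
    simp only [Fin.val_castSucc, Fin.val_succ] at *
    omega

/-- The filler is the alternating sum of the degeneracies `σ j ψ`, each multiplied by the sum of the
coordinates after the `j`-th. Face `k` sees only the terms `j = k` and `j = k - 1`, both equal to
`tail k ψ` up to opposite signs. They cancel for inner `k`. For `k = 0` one term is left, `tail 0 ψ
= ψ`, as the coordinates sum to `1`; for the last face the one term left is an empty sum. The
hypothesis concerns faces of degeneracies rather than faces of `ψ` so that it makes sense for `n =
0`. -/
theorem exists_filler_of_faces_eq_zero {S : E.Sub}
    (hS : ∀ a i, ∀ x ∈ S.carrier a, T.act a i x ∈ S.carrier a) {n : ℕ} {ψ : E.obj ⦋n⦌}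
    (hψS : ψ ∈ S.carrier ⦋n⦌)
    (hψ : ∀ (k : Fin (n + 2)) (j : Fin (n + 1)), k ≠ j.castSucc → k ≠ j.succ →
      E.map (δ k) (E.map (σ j) ψ) = 0) :
    ∃ ω ∈ S.carrier ⦋n + 1⦌, E.map (δ 0) ω = ψ ∧ ∀ k : Fin (n + 1), E.map (δ k.succ) ω = 0 := by
  have htail : ∀ (m : ℕ) (k : ℕ) (x : E.obj ⦋m⦌), x ∈ S.carrier _ → T.tail k x ∈ S.carrier _ :=
    fun m k x hx => sum_mem fun i _ => hS _ i x hx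
  let ω : E.obj ⦋n + 1⦌ :=
    ∑ j : Fin (n + 1), (-1 : K) ^ j.val • T.tail (j.val + 1) (E.map (σ j) ψ)
  have hω : ∀ k : Fin (n + 2), E.map (δ k) ω =
      ∑ j : Fin (n + 1), (-1 : K) ^ j.val •
        if k = j.castSucc ∨ k = j.succ then T.tail k.val ψ else 0 := by
    intro k
    rw [map_sum]
    refine Finset.sum_congr rfl fun j _ => ?_
    rw [map_smul]
    congr 1
    split_ifs with h
    · rw [T.map_δ_tail k _ (by rcases h with rfl | rfl <;> simp)]
      rcases h with rfl | rfl
      · rw [E.map_map_of_comp_eq_id δ_comp_σ_self]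
      · rw [E.map_map_of_comp_eq_id δ_comp_σ_succ]
    · push Not at h
      refine (T.map_sum_act (δ k) _ _).trans ?_
      rw [hψ k j h.1 h.2]
      simp
  refine ⟨ω, sum_mem fun j _ => Submodule.smul_mem _ _ (htail _ _ _ (S.map_mem _ hψS)), ?_,
    fun k => ?_⟩
  · rw [hω, Finset.sum_eq_single 0]
    · simpa [tail] using T.sum_act ⦋n⦌ ψ
    · intro j _ hj
      rw [if_neg, smul_zero]
      rintro (h | h)
      · exact hj (Fin.castSucc_injective _ h.symm)
      · exact Fin.succ_ne_zero j h.symm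
    · simp
  · rw [hω]
    induction k using Fin.lastCases with
    | last =>
      have : T.tail (Fin.last n).succ.val ψ = 0 := by
        refine Finset.sum_eq_zero fun i hi => ?_
        have := i.2
        simp at hi
        omega
      simp only [this, ite_self, smul_zero, Finset.sum_const_zero]
    | cast k =>
      obtain ⟨m, rfl⟩ : ∃ m, n = m + 1 := ⟨n - 1, by have := k.2; omega⟩
      rw [Finset.sum_eq_add_of_mem k.castSucc k.succ (Finset.mem_univ _) (Finset.mem_univ _)
        (Fin.castSucc_lt_succ).ne]
      · rw [if_pos (Or.inr rfl), if_pos (Or.inl (Fin.succ_castSucc k))]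
        simp [pow_succ]
      · rintro j - ⟨h1, h2⟩
        rw [if_neg, smul_zero]
        rintro (h | h)
        · exact h2 (Fin.castSucc_injective _ (h.symm.trans (Fin.succ_castSucc k)))
        · exact h1 (Fin.succ_injective _ h.symm)

/-- A horn filler matches all faces except face `0`. The error there has vanishing faces, so
`exists_filler_of_faces_eq_zero` corrects it without changing the other faces. -/
theorem extendable (S : E.Sub) (hS : ∀ a i, ∀ x ∈ S.carrier a, T.act a i x ∈ S.carrier a) :
    S.Extendable := by
  intro n f hf hfS
  obtain _ | n := n
  · exact ⟨0, zero_mem _, fun a x => absurd x.2 (by simp)⟩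
  let face (i : Fin (n + 2)) : (∂Δ[n + 1] : SSet.{w}).obj (op ⦋n⦌) :=
    (SSet.boundary.ι i).app (op ⦋n⦌) (SSet.stdSimplex.objEquiv.symm (𝟙 _))
  have hface : ∀ i, (face i).1 = SSet.stdSimplex.objEquiv.symm (δ i) := fun i => rfl
  -- Every simplex of the boundary factors through a face of codimension one.
  suffices h : ∃ e ∈ S.carrier ⦋n + 1⦌, ∀ i : Fin (n + 2), E.map (δ i) e = f _ (face i) by
    obtain ⟨e, he, h⟩ := h
    refine ⟨e, he, fun a x => ?_⟩
    obtain ⟨i, q, hq⟩ := SimplexCategory.eq_comp_δ_of_not_surjective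
      (SSet.stdSimplex.objEquiv x.1) x.2
    have hx : x = (∂Δ[n + 1] : SSet.{w}).map q.op (face i) :=
      Subtype.ext (SSet.stdSimplex.objEquiv.injective hq)
    rw [hq, E.map_comp, h]
    conv_rhs => rw [hx]
    exact (hf _ _ q (face i)).symm
  obtain _ | n := n
  -- On an interval the degenerate edge at the value on face `1` replaces the horn filler, and the
  -- condition on `ψ` is empty.
  · obtain ⟨ω, hω, h0, h1⟩ := T.exists_filler_of_faces_eq_zero hS
      (ψ := f _ (face 0) - f _ (face 1)) (sub_mem (hfS _ _) (hfS _ _)) (fun k j hk hk' => by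
        fin_cases j; fin_cases k
        · exact absurd rfl hk
        · exact absurd rfl hk')
    refine ⟨E.map (σ 0) (f _ (face 1)) + ω, add_mem (S.map_mem _ (hfS _ _)) hω, fun i => ?_⟩
    rw [map_add]
    fin_cases i
    · change E.map (δ 0) _ + E.map (δ 0) ω = f _ (face 0)
      rw [h0, E.map_map_of_comp_eq_id (δ_comp_σ_self' (j := 0) (i := (0 : Fin 1)) rfl), add_sub_cancel]
    · have h1' : E.map (δ 1) ω = 0 := h1 0
      change E.map (δ 1) _ + E.map (δ 1) ω = f _ (face 1)
      rw [h1', E.map_map_of_comp_eq_id (δ_comp_σ_succ' (j := 1) (i := (0 : Fin 1)) rfl), add_zero]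
  · have hcomp : ∀ i j : Fin (n + 2), i ≤ j →
        E.map (δ i) (f _ (face j.succ)) = E.map (δ j) (f _ (face i.castSucc)) := by
      intro i j hij
      rw [← hf, ← hf]
      congr 1
      exact Subtype.ext (congrArg SSet.stdSimplex.objEquiv.symm (δ_comp_δ hij))
    obtain ⟨w, hw, hwf⟩ := exists_horn_filler S (fun i => f _ (face i)) (fun i => hfS _ _) hcomp
    have hψ : ∀ i : Fin (n + 2), E.map (δ i) (f _ (face 0) - E.map (δ 0) w) = 0 := by
      intro i
      have := hcomp 0 i (Fin.zero_le i)
      rw [Fin.castSucc_zero] at this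
      rw [map_sub, ← this, ← hwf i, sub_eq_zero]
      exact E.map_eq_of_comp_eq (δ_comp_δ (Fin.zero_le i)) w
    -- Away from `k = j` and `k = j + 1`, the simplicial identities turn `δ k` of `σ j` into a
    -- degeneracy of a face of the error, which vanishes by `hψ`.
    obtain ⟨ω, hω, h0, h1⟩ := T.exists_filler_of_faces_eq_zero hS
      (sub_mem (hfS _ (face 0)) (S.map_mem (δ 0) hw)) (fun k j hk hk' => by
        rcases lt_or_gt_of_ne hk with h | h
        · obtain ⟨j, rfl⟩ : ∃ j' : Fin (n + 1), j = j'.succ :=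
            Fin.exists_succ_eq_of_ne_zero (by rintro rfl; simp at h) |>.imp fun _ h => h.symm
          obtain ⟨k, rfl⟩ : ∃ k' : Fin (n + 2), k = k'.castSucc :=
            Fin.exists_castSucc_eq.2 (by rintro rfl; exact absurd (Fin.le_last _) (not_le.2 h))
              |>.imp fun _ h => h.symm
          rw [E.map_eq_of_comp_eq (δ_comp_σ_of_le (by
            rw [Fin.lt_def] at h; rw [Fin.le_def]; simp at *; omega)), hψ, map_zero]
        · obtain ⟨k, rfl⟩ : ∃ k' : Fin (n + 2), k = k'.succ :=
            Fin.exists_succ_eq_of_ne_zero (by rintro rfl; simp at h) |>.imp fun _ h => h.symm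
          have hkj : j < k := by
            rw [Fin.castSucc_lt_succ_iff] at h
            exact lt_of_le_of_ne h (fun h => hk' (h ▸ rfl))
          obtain ⟨j, rfl⟩ : ∃ j' : Fin (n + 1), j = j'.castSucc :=
            Fin.exists_castSucc_eq.2 (by rintro rfl; exact absurd (Fin.le_last _) (not_le.2 hkj))
              |>.imp fun _ h => h.symm
          rw [E.map_eq_of_comp_eq (δ_comp_σ_of_gt hkj), hψ, map_zero])
    refine ⟨w + ω, add_mem hw hω, fun i => ?_⟩
    rw [map_add]
    induction i using Fin.cases with
    | zero => rw [h0, add_sub_cancel]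
    | succ i => rw [h1, add_zero, hwf]

end Bary

end SimplicialModule

/-! ### The Poincaré lemma for polynomial forms on a simplex -/

namespace PolyForms

variable {K : Type v} [Field K] {n : ℕ}

/-- The coordinates `tᵢ - tᵢ(v₀)` centred at the vertex `0`. -/
noncomputable def s (i : Fin (n + 1)) : PolyForms K n := t i - if i = 0 then 1 else 0

theorem s_mem_functions (i : Fin (n + 1)) : (s i : PolyForms K n) ∈ functions K n := by
  refine sub_mem (Algebra.subset_adjoin ⟨i, rfl⟩) ?_
  split_ifs
  exacts [one_mem _, zero_mem _]

theorem s_mul_comm (i : Fin (n + 1)) (ω : PolyForms K n) : s i * ω = ω * s i :=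
  commute_functions (s_mem_functions i) ω

theorem sum_s : ∑ i, (s i : PolyForms K n) = 0 := by
  simp [s, Finset.sum_sub_distrib, sum_t]

@[simp] theorem d_s (i : Fin (n + 1)) : d (s i : PolyForms K n) = dt i := by
  have h1 : d (1 : PolyForms K n) = 0 := by simpa using d_algebraMap (n := n) (1 : K)
  simp only [s, map_sub, d_t]
  split_ifs <;> simp [h1]

@[simp] theorem invol_s (i : Fin (n + 1)) : invol (s i : PolyForms K n) = s i := by
  simp only [s, map_sub, invol_t]
  split_ifs <;> simp

/-- The algebra map `ω ↦ !![invol ω, ι ω; 0, ω]`, with `ι` the contraction with the Euler field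
centred at the vertex `0`. -/
noncomputable def eulerMatrix : PolyForms K n →ₐ[K] Matrix (Fin 2) (Fin 2) (PolyForms K n) :=
  lift (fun i => !![t i, 0; 0, t i]) (fun i => !![-dt i, s i; 0, dt i])
    (fun i j => by simp [t_mul_t i j])
    (fun i j => by simp [t_mul_dt, s_mul_comm j])
    (fun i j => by
      rw [Matrix.mul_fin_two, Matrix.mul_fin_two]
      ext a b
      fin_cases a <;> fin_cases b <;> simp [dt_mul_dt i j, s_mul_comm, add_comm])
    (by
      ext a b
      fin_cases a <;> fin_cases b <;> simp [Matrix.sum_apply, sum_t])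
    (by
      ext a b
      fin_cases a <;> fin_cases b <;> simp [Matrix.sum_apply, sum_dt, sum_s])

/-- The contraction with the Euler field centred at the vertex `0`. -/
noncomputable def euler : PolyForms K n →ₗ[K] PolyForms K n where
  toFun ω := eulerMatrix ω 0 1
  map_add' a b := by simp
  map_smul' r a := by simp

theorem eulerMatrix_eq (ω : PolyForms K n) : eulerMatrix ω = !![invol ω, euler ω; 0, ω] := by
  have h : eulerMatrix ω 0 0 = invol ω ∧ eulerMatrix ω 1 0 = 0 ∧ eulerMatrix ω 1 1 = ω := by
    induction ω using PolyForms.induction with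
    | halg r => simp [Matrix.algebraMap_matrix_apply]
    | ht i => simp [eulerMatrix]
    | hdt i => simp [eulerMatrix]
    | hmul a b ha hb => simp [Matrix.mul_apply, ha, hb]
    | hadd a b ha hb => simp [ha, hb]
  ext a b
  fin_cases a <;> fin_cases b
  · exact h.1
  · rfl
  · exact h.2.1
  · exact h.2.2

@[simp] theorem euler_t (i : Fin (n + 1)) : euler (t i : PolyForms K n) = 0 := by
  simp [euler, eulerMatrix]

@[simp] theorem euler_dt (i : Fin (n + 1)) : euler (dt i : PolyForms K n) = s i := by
  simp [euler, eulerMatrix]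

@[simp] theorem euler_algebraMap (r : K) : euler (algebraMap K (PolyForms K n) r) = 0 := by
  simp [euler, Matrix.algebraMap_matrix_apply]

theorem euler_mul (a b : PolyForms K n) : euler (a * b) = euler a * b + invol a * euler b := by
  have h := congrFun (congrFun (map_mul eulerMatrix a b) 0) 1
  rw [eulerMatrix_eq, eulerMatrix_eq, eulerMatrix_eq] at h
  simpa [Matrix.mul_fin_two, add_comm] using h

theorem euler_invol (ω : PolyForms K n) : euler (invol ω) = -invol (euler ω) := by
  induction ω using PolyForms.induction with
  | halg r => simp
  | ht i => simp
  | hdt i => simp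
  | hmul a b ha hb => simp [euler_mul, ha, hb, add_comm]
  | hadd a b ha hb => simp [ha, hb, add_comm]

theorem euler_of_mem_functions {f : PolyForms K n} (hf : f ∈ functions K n) : euler f = 0 := by
  induction hf using Algebra.adjoin_induction with
  | mem x hx => obtain ⟨i, rfl⟩ := hx; simp
  | algebraMap r => simp
  | add x y _ _ hx hy => simp [hx, hy]
  | mul x y _ _ hx hy => simp [euler_mul, hx, hy]

theorem euler_mem_gr {p : ℕ} {a : PolyForms K n} (ha : a ∈ gr K n (p + 1)) :
    euler a ∈ gr K n p := by
  suffices h : ∀ q (b : PolyForms K n), b ∈ gr K n q → (q = 0 → euler b = 0) ∧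
      ∀ p, q = p + 1 → euler b ∈ gr K n p from (h _ a ha).2 p rfl
  intro q b hb
  induction hb using gr_induction with
  | hf f hf => exact ⟨fun _ => euler_of_mem_functions hf, fun p hp => by omega⟩
  | hdt q a i ha ih =>
    refine ⟨fun h => by omega, fun p hp => ?_⟩
    obtain rfl : q = p := by omega
    rw [euler_mul, euler_dt]
    refine add_mem ?_ ?_
    · obtain _ | q := q
      · simp [ih.1 rfl]
      · exact mul_mem_gr (ih.2 q rfl) (dt_mem_gr i)
    · rw [invol_of_mem ha]
      have h := mul_mem_gr ha (functions_le_gr (s_mem_functions (K := K) i))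
      rcases neg_one_pow_eq_or (PolyForms K n) q with h' | h'
      · simpa [h'] using h
      · simpa [h'] using h
  | hadd q a b ha hb iha ihb =>
    exact ⟨fun h => by simp [iha.1 h, ihb.1 h], fun p hp => by
      rw [map_add]; exact add_mem (iha.2 p hp) (ihb.2 p hp)⟩
  | hsmul q r a ha ih =>
    exact ⟨fun h => by simp [ih.1 h], fun p hp => by
      rw [map_smul]; exact Submodule.smul_mem _ _ (ih.2 p hp)⟩

open Polynomial in
/-- The pullback of forms along the scaling `x ↦ v₀ + X (x - v₀)` towards the vertex `0`. -/
noncomputable def scale : PolyForms K n →ₐ[K] Polynomial (PolyForms K n) :=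
  lift (fun i => C (if i = 0 then 1 else 0) + C (s i) * X) (fun i => C (dt i) * X)
    (fun i j => by
      have h : ∀ x y : PolyForms K n, C x * (C y * X) = (C (x * y) * X : Polynomial _) :=
        fun x y => by rw [C_mul, mul_assoc]
      have h' : ∀ x y : PolyForms K n, C x * X * C y = (C (x * y) * X : Polynomial _) :=
        fun x y => by rw [C_mul, mul_assoc, X_mul_C, mul_assoc]
      have h'' : ∀ x y : PolyForms K n, C x * X * (C y * X) = (C (x * y) * X * X : Polynomial _) :=
        fun x y => by rw [← mul_assoc, h']
      simp only [mul_add, add_mul, h, h', h'', ← C_mul]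
      rw [s_mul_comm i (s j)]
      split_ifs <;> simp <;> abel)
    (fun i j => by
      have h : ∀ x y : PolyForms K n, C x * (C y * X) = (C (x * y) * X : Polynomial _) :=
        fun x y => by rw [C_mul, mul_assoc]
      have h' : ∀ x y : PolyForms K n, C x * X * C y = (C (x * y) * X : Polynomial _) :=
        fun x y => by rw [C_mul, mul_assoc, X_mul_C, mul_assoc]
      have h'' : ∀ x y : PolyForms K n, C x * X * (C y * X) = (C (x * y) * X * X : Polynomial _) :=
        fun x y => by rw [← mul_assoc, h']
      simp only [mul_add, add_mul, h, h', h'']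
      rw [s_mul_comm i (dt j)]
      split_ifs <;> simp)
    (fun i j => by
      have h'' : ∀ x y : PolyForms K n, C x * X * (C y * X) = (C (x * y) * X * X : Polynomial _) :=
        fun x y => by rw [← mul_assoc, C_mul, mul_assoc (C x), X_mul_C, mul_assoc (C x) (C y)]
      rw [h'', h'', dt_mul_dt i j, C_neg, neg_mul, neg_mul])
    (by
      rw [Finset.sum_add_distrib, ← map_sum, ← Finset.sum_mul, ← map_sum, sum_s]
      simp)
    (by rw [← Finset.sum_mul, ← map_sum, sum_dt, C_0, zero_mul])

@[simp] theorem scale_t (i : Fin (n + 1)) : scale (t i : PolyForms K n) =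
    Polynomial.C (if i = 0 then 1 else 0) + Polynomial.C (s i) * Polynomial.X := by simp [scale]

@[simp] theorem scale_dt (i : Fin (n + 1)) : scale (dt i : PolyForms K n) =
    Polynomial.C (dt i) * Polynomial.X := by simp [scale]

theorem coeff_scale_mul (a b : PolyForms K n) (k : ℕ) : (scale (a * b)).coeff k =
    ∑ x ∈ Finset.HasAntidiagonal.antidiagonal k, (scale a).coeff x.1 * (scale b).coeff x.2 := by
  rw [map_mul, Polynomial.coeff_mul]

theorem coeff_scale_algebraMap (r : K) (k : ℕ) :
    (scale (algebraMap K (PolyForms K n) r)).coeff k =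
      algebraMap K _ (if k = 0 then r else 0) := by
  rw [AlgHom.commutes, Polynomial.algebraMap_apply, Polynomial.coeff_C]
  split_ifs <;> simp

theorem coeff_scale_t (i : Fin (n + 1)) (k : ℕ) : (scale (t i : PolyForms K n)).coeff k =
    if k = 0 then (if i = 0 then 1 else 0) else if k = 1 then s i else 0 := by
  rw [scale_t]
  obtain _ | _ | k := k <;> simp only [Polynomial.coeff_add, Polynomial.coeff_C, Polynomial.coeff_C_mul, Polynomial.coeff_X] <;> simp

theorem coeff_scale_dt (i : Fin (n + 1)) (k : ℕ) : (scale (dt i : PolyForms K n)).coeff k =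
    if k = 1 then dt i else 0 := by
  rw [scale_dt, Polynomial.coeff_C_mul, Polynomial.coeff_X]
  simp [eq_comm]

theorem coeff_scale_invol (ω : PolyForms K n) (k : ℕ) :
    (scale (invol ω)).coeff k = invol ((scale ω).coeff k) := by
  induction ω using PolyForms.induction generalizing k with
  | halg r => rw [AlgHom.commutes, coeff_scale_algebraMap, AlgHom.commutes]
  | ht i =>
    rw [invol_t, coeff_scale_t]
    split_ifs <;> simp
  | hdt i =>
    rw [invol_dt, map_neg, Polynomial.coeff_neg, coeff_scale_dt]
    split_ifs <;> simp
  | hmul a b ha hb => rw [map_mul, coeff_scale_mul, coeff_scale_mul]; simp [ha, hb]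
  | hadd a b ha hb => simp [ha, hb]

theorem coeff_scale_d (ω : PolyForms K n) (k : ℕ) :
    (scale (d ω)).coeff k = d ((scale ω).coeff k) := by
  induction ω using PolyForms.induction generalizing k with
  | halg r => rw [coeff_scale_algebraMap]; simp
  | ht i =>
    have h1 : d (1 : PolyForms K n) = 0 := by simpa using d_algebraMap (n := n) (1 : K)
    rw [d_t, coeff_scale_t, coeff_scale_dt]
    split_ifs <;> first | omega | simp [h1]
  | hdt i =>
    rw [d_dt, coeff_scale_dt]
    split_ifs <;> simp
  | hmul a b ha hb =>
    rw [d_mul, map_add, Polynomial.coeff_add]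
    simp only [coeff_scale_mul, ha, hb, map_sum, d_mul, coeff_scale_invol, Finset.sum_add_distrib]
  | hadd a b ha hb => simp [ha, hb]

/-- The Lie derivative along the Euler field is diagonal for the scaling weights. -/
theorem coeff_scale_lie (ω : PolyForms K n) (k : ℕ) :
    (scale (d (euler ω) + euler (d ω))).coeff k = k • (scale ω).coeff k := by
  induction ω using PolyForms.induction generalizing k with
  | halg r =>
    rw [coeff_scale_algebraMap]
    by_cases hk : k = 0 <;> simp [hk]
  | ht i =>
    rw [euler_t, d_t, euler_dt, map_zero, zero_add, coeff_scale_t, s, map_sub,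
      Polynomial.coeff_sub, coeff_scale_t]
    have : scale (if i = 0 then 1 else 0 : PolyForms K n) =
        Polynomial.C (if i = 0 then 1 else 0) := by split_ifs <;> simp
    rw [this, Polynomial.coeff_C, s]
    obtain _ | _ | k := k <;> simp
  | hdt i =>
    rw [euler_dt, d_dt, map_zero, add_zero, d_s, coeff_scale_dt]
    split_ifs with h <;> simp [h]
  | hmul a b ha hb =>
    -- The signs of the two antiderivations cancel, so `d ι + ι d` is a derivation; the factors `k`
    -- then add up because weights add under products.
    have h : d (euler (a * b)) + euler (d (a * b)) =
        (d (euler a) + euler (d a)) * b + a * (d (euler b) + euler (d b)) := by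
      simp only [euler_mul, d_mul, map_add, d_invol, euler_invol, invol_invol]
      noncomm_ring
    rw [h, map_add, Polynomial.coeff_add, coeff_scale_mul, coeff_scale_mul, coeff_scale_mul,
      Finset.smul_sum, ← Finset.sum_add_distrib]
    refine Finset.sum_congr rfl fun x hx => ?_
    rw [ha, hb, ← Finset.HasAntidiagonal.mem_antidiagonal.1 hx, smul_mul_assoc, mul_smul_comm, add_smul]
  | hadd a b ha hb =>
    have h : d (euler (a + b)) + euler (d (a + b)) =
        (d (euler a) + euler (d a)) + (d (euler b) + euler (d b)) := by
      simp only [map_add]; abel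
    rw [h, map_add, Polynomial.coeff_add, ha, hb, map_add, Polynomial.coeff_add, smul_add]

theorem coeff_scale_mem_gr {p : ℕ} {a : PolyForms K n} (ha : a ∈ gr K n p) (k : ℕ) :
    (scale a).coeff k ∈ gr K n p := by
  induction ha using gr_induction generalizing k with
  | hf f hf =>
    suffices h : (scale f).coeff k ∈ functions K n from functions_le_gr h
    induction hf using Algebra.adjoin_induction generalizing k with
    | mem x hx =>
      obtain ⟨i, rfl⟩ := hx
      rw [coeff_scale_t]
      split_ifs
      exacts [one_mem _, zero_mem _, s_mem_functions i, zero_mem _]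
    | algebraMap r => rw [coeff_scale_algebraMap]; exact Subalgebra.algebraMap_mem _ _
    | add x y _ _ hx hy => simpa using add_mem (hx k) (hy k)
    | mul x y _ _ hx hy =>
      rw [coeff_scale_mul]
      exact sum_mem fun z _ => mul_mem (hx _) (hy _)
  | hdt p a i _ ih =>
    rw [coeff_scale_mul]
    refine sum_mem fun z _ => mul_mem_gr (ih _) ?_
    rw [coeff_scale_dt]
    split_ifs
    exacts [dt_mem_gr i, zero_mem _]
  | hadd p a b _ _ iha ihb => simpa using add_mem (iha k) (ihb k)
  | hsmul p r a _ ih => simpa using Submodule.smul_mem _ r (ih k)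

/-- At `X = 0` the scaling collapses the simplex to the vertex `0`. -/
theorem coeff_zero_scale (ω : PolyForms K n) :
    (scale ω).coeff 0 = pullback (fun _ : Fin (n + 1) => (0 : Fin (n + 1))) ω := by
  induction ω using PolyForms.induction with
  | halg r => rw [coeff_scale_algebraMap, AlgHom.commutes, if_pos rfl]
  | ht i =>
    rw [coeff_scale_t, pullback_t]
    by_cases h : i = 0
    · simp [h, sum_t]
    · simp [h, Ne.symm h]
  | hdt i =>
    rw [coeff_scale_dt, pullback_dt]
    by_cases h : i = 0
    · simp [h, sum_dt]
    · simp [h, Ne.symm h]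
  | hmul a b ha hb => simp [ha, hb]
  | hadd a b ha hb => simp [ha, hb]

/-- The sum of the coefficients of `scale ω`, weighted by `c`. -/
noncomputable def scaleSum (c : ℕ → K) : PolyForms K n →ₗ[K] PolyForms K n where
  toFun ω := (scale ω).sum fun k a => c k • a
  map_add' a b := by
    rw [map_add, Polynomial.sum_add_index]
    · simp
    · simp
  map_smul' r a := by
    rw [map_smul, Polynomial.sum_smul_index']
    · simp only [RingHom.id_apply, Polynomial.sum_def, Finset.smul_sum]
      exact Finset.sum_congr rfl fun k _ => smul_comm _ _ _
    · simp

theorem scaleSum_eq (c : ℕ → K) (ω : PolyForms K n) {N : ℕ} (h : (scale ω).natDegree < N) :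
    scaleSum c ω = ∑ k ∈ Finset.range N, c k • (scale ω).coeff k :=
  Polynomial.sum_over_range' _ (by simp) _ h

/-- The sum of all coefficients is the value at `X = 1`, where the scaling is the identity.
Evaluation at `1` is multiplicative even though the coefficients do not commute, since `1` is
central. -/
theorem scaleSum_one (ω : PolyForms K n) : scaleSum 1 ω = ω := by
  have h : ∀ ω : PolyForms K n, scaleSum 1 ω =
      Polynomial.eval₂RingHom' (RingHom.id _) 1 (fun _ => Commute.one_right _) (scale ω) := by
    intro ω
    change (scale ω).sum _ = Polynomial.eval₂ _ _ _
    rw [Polynomial.eval₂_eq_sum]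
    exact congrArg (Polynomial.sum _) (funext₂ fun k a => by simp)
  rw [h]
  have h1 : ∀ p : PolyForms K n, Polynomial.eval₂RingHom' (RingHom.id _) (1 : PolyForms K n)
      (fun _ => Commute.one_right _) (Polynomial.C p) = p :=
    fun p => Polynomial.eval₂_C _ _
  have h2 : Polynomial.eval₂RingHom' (RingHom.id _) (1 : PolyForms K n)
      (fun _ => Commute.one_right _) Polynomial.X = 1 := Polynomial.eval₂_X _ _
  induction ω using PolyForms.induction with
  | halg r => rw [AlgHom.commutes, Polynomial.algebraMap_apply, h1]
  | ht i => rw [scale_t, map_add, map_mul, h1, h1, h2, mul_one, s, add_sub_cancel]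
  | hdt i => rw [scale_dt, map_mul, h1, h2, mul_one]
  | hmul a b ha hb => rw [map_mul, map_mul, ha, hb]
  | hadd a b ha hb => rw [map_add, map_add, ha, hb]

theorem scaleSum_mem_gr (c : ℕ → K) {p : ℕ} {a : PolyForms K n} (ha : a ∈ gr K n p) :
    scaleSum c a ∈ gr K n p :=
  sum_mem fun k _ => Submodule.smul_mem _ _ (coeff_scale_mem_gr ha k)

theorem scaleSum_d (c : ℕ → K) (ω : PolyForms K n) : scaleSum c (d ω) = d (scaleSum c ω) := by
  -- A common bound for both degrees, so that the two sums run over the same range.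
  set N := max (scale ω).natDegree (scale (d ω)).natDegree + 1
  rw [scaleSum_eq c ω (N := N) (by omega), scaleSum_eq c (d ω) (N := N) (by omega), map_sum]
  simp [coeff_scale_d]

/-- The homotopy that contracts the simplex to its vertex `0`. -/
noncomputable def cone : PolyForms K n →ₗ[K] PolyForms K n :=
  scaleSum (fun k => (k : K)⁻¹) ∘ₗ euler

theorem cone_mem_gr {p : ℕ} {a : PolyForms K n} (ha : a ∈ gr K n (p + 1)) :
    cone a ∈ gr K n p :=
  scaleSum_mem_gr _ (euler_mem_gr ha)

theorem cone_of_mem_gr_zero {a : PolyForms K n} (ha : a ∈ gr K n 0) : cone a = 0 := by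
  rw [gr, pow_zero, mul_one] at ha
  change scaleSum _ (euler a) = 0
  rw [euler_of_mem_functions ha, map_zero]

/-- Cartan's formula, integrated along the scaling. As `scaleSum` commutes with `d`, the left side
is the Lie derivative weighted by `k⁻¹`. Its part of weight `k` is `k` times that of `ω`, so in
characteristic zero every part of weight `k ≥ 1` is recovered. The part of weight `0`, where `0⁻¹ =
0` does no harm, is the value at the vertex `0`. -/
theorem d_cone_add_cone_d [CharZero K] (ω : PolyForms K n) : d (cone ω) + cone (d ω) =
    ω - pullback (fun _ : Fin (n + 1) => (0 : Fin (n + 1))) ω := by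
  change d (scaleSum _ (euler ω)) + scaleSum _ (euler (d ω)) = _
  rw [← scaleSum_d, ← map_add]
  set N := max (scale ω).natDegree (scale (d (euler ω) + euler (d ω))).natDegree + 1
  have h1 := scaleSum_one ω
  rw [scaleSum_eq _ _ (N := N) (by omega)] at h1
  rw [← coeff_zero_scale, scaleSum_eq _ _ (N := N) (by omega)]
  conv_rhs => enter [1]; rw [← h1]
  simp only [N, Finset.sum_range_succ', coeff_scale_lie]
  simp only [zero_smul, smul_zero, add_zero, Pi.one_apply, one_smul, add_sub_cancel_right]
  refine Finset.sum_congr rfl fun k _ => ?_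
  rw [← Nat.cast_smul_eq_nsmul K, smul_smul, inv_mul_cancel₀ (Nat.cast_ne_zero.2 k.succ_ne_zero), one_smul]

section pullback

variable {m : ℕ} {θ : Fin (m + 1) → Fin (n + 1)}

/-- The centred coordinates, and with them `euler`, `scale` and `cone`, are natural only for maps
that preserve the centre, the vertex `0`. -/
theorem pullback_s (hθ : θ 0 = 0) (i : Fin (n + 1)) :
    pullback θ (s i : PolyForms K n) = ∑ j with θ j = i, s j := by
  have : pullback (K := K) θ (if i = 0 then 1 else 0) = if i = 0 then 1 else 0 := by
    split_ifs <;> simp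
  rw [s, map_sub, pullback_t, this]
  simp only [s, Finset.sum_sub_distrib]
  congr 1
  rw [Finset.sum_ite_eq']
  simp [hθ, eq_comm]

theorem pullback_euler (hθ : θ 0 = 0) (ω : PolyForms K n) : pullback θ (euler ω) = euler (pullback θ ω) := by
  induction ω using PolyForms.induction with
  | halg r => simp
  | ht i => simp
  | hdt i => simp [pullback_s hθ]
  | hmul a b ha hb => simp [euler_mul, ha, hb, pullback_invol]
  | hadd a b ha hb => simp [ha, hb]

theorem coeff_scale_pullback (hθ : θ 0 = 0) (ω : PolyForms K n) (k : ℕ) :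
    (scale (pullback θ ω)).coeff k = pullback θ ((scale ω).coeff k) := by
  induction ω using PolyForms.induction generalizing k with
  | halg r => rw [AlgHom.commutes, coeff_scale_algebraMap, coeff_scale_algebraMap, AlgHom.commutes]
  | ht i =>
    rw [pullback_t, map_sum, Polynomial.finsetSum_coeff, coeff_scale_t]
    simp only [coeff_scale_t]
    split_ifs with h0 h1
    · rw [Finset.sum_ite_eq']; simp [hθ, h1]
    · rw [Finset.sum_ite_eq']; simp [hθ, Ne.symm h1]
    · rw [pullback_s hθ]
    · simp
  | hdt i =>
    rw [pullback_dt, map_sum, Polynomial.finsetSum_coeff, coeff_scale_dt]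
    simp only [coeff_scale_dt]
    split_ifs <;> simp
  | hmul a b ha hb => simp [Polynomial.coeff_mul, ha, hb]
  | hadd a b ha hb => simp [ha, hb]

theorem pullback_cone (hθ : θ 0 = 0) (ω : PolyForms K n) : pullback θ (cone ω) = cone (pullback θ ω) := by
  change pullback θ (scaleSum _ (euler ω)) = scaleSum _ (euler (pullback θ ω))
  rw [← pullback_euler hθ]
  set N := max (scale (euler ω)).natDegree (scale (pullback θ (euler ω))).natDegree + 1
  rw [scaleSum_eq _ _ (N := N) (by omega), scaleSum_eq _ _ (N := N) (by omega), map_sum]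
  simp [coeff_scale_pullback hθ]

end pullback

theorem exists_eq_algebraMap (ω : PolyForms K 0) : ∃ r : K, ω = algebraMap K _ r := by
  induction ω using PolyForms.induction with
  | halg r => exact ⟨r, rfl⟩
  | ht i => exact ⟨1, by simpa [Fin.fin_one_eq_zero i] using sum_t (K := K) (n := 0)⟩
  | hdt i => exact ⟨0, by simpa [Fin.fin_one_eq_zero i] using sum_dt (K := K) (n := 0)⟩
  | hmul a b ha hb =>
    obtain ⟨r, rfl⟩ := ha
    obtain ⟨r', rfl⟩ := hb
    exact ⟨r * r', by simp⟩
  | hadd a b ha hb =>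
    obtain ⟨r, rfl⟩ := ha
    obtain ⟨r', rfl⟩ := hb
    exact ⟨r + r', by simp⟩

theorem algebraMap_mem_gr (r : K) : algebraMap K (PolyForms K n) r ∈ gr K n 0 :=
  functions_le_gr (Subalgebra.algebraMap_mem _ r)

theorem eq_zero_of_mem_gr_of_dim_zero {p : ℕ} {ω : PolyForms K 0} (hω : ω ∈ gr K 0 (p + 1)) :
    ω = 0 := by
  obtain ⟨r, rfl⟩ := exists_eq_algebraMap ω
  rw [← proj_same hω, proj_ne (by omega) (algebraMap_mem_gr r)]

/-- A constant map factors through the `0`-simplex, whose forms are just scalars. -/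
theorem pullback_const {m : ℕ} (i : Fin (n + 1)) (ω : PolyForms K n) :
    pullback (fun _ : Fin (m + 1) => i) ω =
      pullback (fun _ => 0) (pullback (fun _ : Fin 1 => i) ω) := by
  rw [pullback_pullback]
  rfl

theorem pullback_mem_gr {m p : ℕ} (θ : Fin (m + 1) → Fin (n + 1)) {a : PolyForms K n}
    (ha : a ∈ gr K n p) : pullback θ a ∈ gr K m p := by
  induction ha using gr_induction with
  | hf f hf =>
    suffices h : pullback θ f ∈ functions K m from functions_le_gr h
    induction hf using Algebra.adjoin_induction with
    | mem x hx =>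
      obtain ⟨i, rfl⟩ := hx
      rw [pullback_t]
      exact sum_mem fun j _ => Algebra.subset_adjoin ⟨j, rfl⟩
    | algebraMap r => rw [AlgHom.commutes]; exact Subalgebra.algebraMap_mem _ _
    | add x y _ _ hx hy => simpa using add_mem hx hy
    | mul x y _ _ hx hy => simpa using mul_mem hx hy
  | hdt p a i _ ih =>
    rw [map_mul, pullback_dt]
    exact mul_mem_gr ih (sum_mem fun j _ => dt_mem_gr j)
  | hadd p a b _ _ iha ihb => simpa using add_mem iha ihb
  | hsmul p r a _ ih => simpa using Submodule.smul_mem _ r ih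

/-- The Poincaré lemma: a form of positive degree restricts to zero at a vertex, so the homotopy
formula exhibits `cone ω` as a primitive. -/
theorem exists_d_eq [CharZero K] {p : ℕ} {ω : PolyForms K n} (hω : ω ∈ gr K n (p + 1))
    (h : d ω = 0) : ∃ η ∈ gr K n p, d η = ω := by
  refine ⟨cone ω, cone_mem_gr hω, ?_⟩
  have := d_cone_add_cone_d ω
  rwa [h, map_zero, add_zero, pullback_const, eq_zero_of_mem_gr_of_dim_zero (pullback_mem_gr _ hω),
    map_zero, sub_zero] at this

theorem exists_eq_algebraMap_of_d_eq_zero [CharZero K] {ω : PolyForms K n} (hω : ω ∈ gr K n 0)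
    (h : d ω = 0) : ∃ r : K, ω = algebraMap K _ r := by
  obtain ⟨r, hr⟩ := exists_eq_algebraMap (pullback (fun _ : Fin 1 => 0) ω)
  refine ⟨r, ?_⟩
  have := d_cone_add_cone_d ω
  rw [h, map_zero, add_zero, pullback_const, cone_of_mem_gr_zero hω, map_zero, hr] at this
  simpa using (sub_eq_zero.1 this.symm)

/-- Evaluation at the vertex `0` is an algebra map to the field. -/
instance : Nontrivial (PolyForms K n) := by
  let ε : PolyForms K n →ₐ[K] K := lift (fun i => if i = 0 then 1 else 0) (fun _ => 0)
    (fun i j => mul_comm _ _) (by simp) (by simp) (by simp) (by simp)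
  exact ε.toRingHom.domain_nontrivial

end PolyForms

/-! ### Contractible simplicial sets: products of simplices and cone operators -/

namespace APL

variable {K : Type v} [Field K]

open Simplicial

/-- The product of two simplicial sets. -/
def prod (X Y : SSet.{u}) : SSet.{u} where
  obj a := X.obj a × Y.obj a
  map θ := TypeCat.ofHom fun x => (X.map θ x.1, Y.map θ x.2)
  map_id a := by
    ext x
    · exact ConcreteCategory.congr_hom (X.map_id a) x.1
    · exact ConcreteCategory.congr_hom (Y.map_id a) x.2
  map_comp θ ψ := by
    ext x
    · exact ConcreteCategory.congr_hom (X.map_comp θ ψ) x.1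
    · exact ConcreteCategory.congr_hom (Y.map_comp θ ψ) x.2

/-- The first projection. -/
def fst (X Y : SSet.{u}) : prod X Y ⟶ X where
  app _ := TypeCat.ofHom fun x => x.1
  naturality _ _ _ := rfl

/-- The second projection. -/
def snd (X Y : SSet.{u}) : prod X Y ⟶ Y where
  app _ := TypeCat.ofHom fun x => x.2
  naturality _ _ _ := rfl

/-- The standard simplex with vertices the elements of `a`. -/
def simplex (a : SimplexCategory) : SSet.{u} where
  obj c := ULift.{u} (c.unop ⟶ a)
  map θ := TypeCat.ofHom fun x => ⟨θ.unop ≫ x.down⟩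
  map_id c := by
    refine ConcreteCategory.hom_ext _ _ fun x => ?_
    exact congrArg ULift.up (Category.id_comp x.down)
  map_comp θ ψ := by
    refine ConcreteCategory.hom_ext _ _ fun x => ?_
    exact congrArg ULift.up (Category.assoc ψ.unop θ.unop x.down)

/-- The map `[n + 1] ⟶ [m + 1]` that extends `θ`, shifted, by `0 ↦ 0`. -/
def coneMap {a b : SimplexCategory} (θ : a ⟶ b) : ⦋a.len + 1⦌ ⟶ ⦋b.len + 1⦌ :=
  SimplexCategory.Hom.mk
    { toFun := Fin.cases 0 fun i => (θ.toOrderHom i).succ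
      monotone' := by
        intro i j
        induction i using Fin.cases with
        | zero => intro _; exact Fin.zero_le _
        | succ i =>
          induction j using Fin.cases with
          | zero => intro h; exact absurd h (by simp)
          | succ j =>
            intro h
            exact Fin.succ_le_succ_iff.2 (θ.toOrderHom.monotone (Fin.succ_le_succ_iff.1 h)) }

/-- The inclusion of the face opposite to the cone point. -/
def coneFace (a : SimplexCategory) : a ⟶ ⦋a.len + 1⦌ :=
  SimplexCategory.Hom.mk ⟨Fin.succ, fun _ _ h => Fin.succ_le_succ_iff.2 h⟩

/-- The inclusion of the cone point. -/
def conePoint (a : SimplexCategory) : ⦋0⦌ ⟶ ⦋a.len + 1⦌ :=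
  SimplexCategory.Hom.mk ⟨fun _ => 0, fun _ _ _ => le_rfl⟩

/-- Joining of all simplices of `X` with a vertex of `X`. -/
structure ConeOp (X : SSet.{u}) where
  join (a : SimplexCategory) : X.obj (op a) → X.obj (op ⦋a.len + 1⦌)
  point : X.obj (op ⦋0⦌)
  map_join {a b : SimplexCategory} (θ : a ⟶ b) (x : X.obj (op b)) :
    X.map (coneMap θ).op (join b x) = join a (X.map θ.op x)
  face (a : SimplexCategory) (x : X.obj (op a)) : X.map (coneFace a).op (join a x) = x
  vertex (a : SimplexCategory) (x : X.obj (op a)) : X.map (conePoint a).op (join a x) = point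

namespace ConeOp

variable {X Y : SSet.{u}}

/-- The product of two cone operators. -/
def prod (c : ConeOp X) (e : ConeOp Y) : ConeOp (prod X Y) where
  join a x := (c.join a x.1, e.join a x.2)
  point := (c.point, e.point)
  map_join θ x := Prod.ext (c.map_join θ x.1) (e.map_join θ x.2)
  face a x := Prod.ext (c.face a x.1) (e.face a x.2)
  vertex a x := Prod.ext (c.vertex a x.1) (e.vertex a x.2)

/-- The joining with the vertex `0` of a simplex. -/
def simplex (a : SimplexCategory) : ConeOp (simplex.{u} a) where
  join b x := ⟨SimplexCategory.Hom.mk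
    { toFun := Fin.cases 0 fun i => x.down.toOrderHom i
      monotone' := by
        intro i j
        induction i using Fin.cases with
        | zero => intro _; exact Fin.zero_le _
        | succ i =>
          induction j using Fin.cases with
          | zero => intro h; exact absurd h (by simp)
          | succ j =>
            intro h
            exact x.down.toOrderHom.monotone (Fin.succ_le_succ_iff.1 h) }⟩
  point := ⟨SimplexCategory.Hom.mk ⟨fun _ => 0, fun _ _ _ => le_rfl⟩⟩
  map_join {b b'} θ x := by
    refine congrArg ULift.up (SimplexCategory.Hom.ext _ _ (OrderHom.ext _ _ (funext fun i => ?_)))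
    induction i using Fin.cases with
    | zero => rfl
    | succ i => rfl
  face b x := congrArg ULift.up
    (SimplexCategory.Hom.ext _ _ (OrderHom.ext _ _ (funext fun _ => rfl)))
  vertex b x := congrArg ULift.up
    (SimplexCategory.Hom.ext _ _ (OrderHom.ext _ _ (funext fun _ => rfl)))

/-- The homotopy on forms that contracts `X` to the cone point. -/
noncomputable def homotopy (c : ConeOp X) (f : Families K X) : Families K X := fun a x =>
  PolyForms.pullback (coneFace a).toOrderHom (PolyForms.cone (f _ (c.join a x)))

/-- `coneMap θ` fixes the cone point, the vertex `0`, so it commutes with `cone`; on the opposite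
face it restricts to `θ`. -/
theorem homotopy_natural (c : ConeOp X) {p : ℕ} {f : Families K X} (hf : f ∈ gr K X p) {a b : SimplexCategory}
    (θ : a ⟶ b) (x : X.obj (op b)) : c.homotopy f a (X.map θ.op x) =
      PolyForms.pullback θ.toOrderHom (c.homotopy f b x) := by
  rw [homotopy, ← c.map_join, hf.2 _ _ (coneMap θ), homotopy, ← PolyForms.pullback_cone rfl]
  refine (PolyForms.pullback_pullback _ _ _).trans ?_
  refine Eq.trans ?_ (PolyForms.pullback_pullback _ _ _).symm
  rfl

/-- The homotopy formula on the joined simplex, restricted to the face opposite to the cone point.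
The restriction of `f` to that face is `f` on the original simplex, and the value at the cone vertex
does not depend on the simplex. -/
theorem d_homotopy [CharZero K] (c : ConeOp X) {p : ℕ} {f : Families K X} (hf : f ∈ gr K X p)
    (hd : familiesD f = 0) :
    familiesD (c.homotopy f) =
      f - fun _ _ => PolyForms.pullback (fun _ => 0) (f ⦋0⦌ c.point) := by
  funext a x
  have hd' : PolyForms.d (f _ (c.join a x)) = 0 := congrFun (congrFun hd _) _
  have h := PolyForms.d_cone_add_cone_d (f _ (c.join a x))
  rw [hd', map_zero, add_zero, PolyForms.pullback_const] at h
  change PolyForms.d (PolyForms.pullback _ _) = f a x - _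
  rw [← PolyForms.pullback_d, h, map_sub, ← hf.2, c.face]
  congr 1
  refine (PolyForms.pullback_pullback _ _ _).trans ?_
  rw [← c.vertex a x, hf.2]
  rfl

theorem exists_d_eq [CharZero K] (c : ConeOp X) {p : ℕ} {f : Families K X} (hf : f ∈ gr K X (p + 1))
    (hd : familiesD f = 0) : ∃ g ∈ gr K X p, familiesD g = f := by
  refine ⟨c.homotopy f, ⟨fun a x => PolyForms.pullback_mem_gr _ (PolyForms.cone_mem_gr (hf.1 _ _)),
    fun a b θ x => c.homotopy_natural hf θ x⟩, ?_⟩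
  rw [c.d_homotopy hf hd, PolyForms.eq_zero_of_mem_gr_of_dim_zero (hf.1 _ _)]
  funext a x
  simp

theorem exists_eq_algebraMap [CharZero K] (c : ConeOp X) {f : Families K X} (hf : f ∈ gr K X 0)
    (hd : familiesD f = 0) : ∃ r : K, f = algebraMap K _ r := by
  obtain ⟨r, hr⟩ := PolyForms.exists_eq_algebraMap (f ⦋0⦌ c.point)
  refine ⟨r, ?_⟩
  have h := c.d_homotopy hf hd
  rw [hr] at h
  have h0 : c.homotopy f = 0 := by
    funext a x
    change PolyForms.pullback _ _ = 0
    rw [PolyForms.cone_of_mem_gr_zero (hf.1 _ _), map_zero]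
  rw [h0, map_zero] at h
  rw [sub_eq_zero.1 h.symm]
  funext a x
  simp

end ConeOp

end APL

/-! ### Shifted gradings -/

section shiftGr

variable {K : Type v} [Field K] {M : Type*} [AddCommGroup M] [Module K M] {N : Type*}
  [AddCommGroup N] [Module K N]

/-- The part of degree `k - q` of a graded module. -/
def shiftGr (g : ℕ → Submodule K M) (q k : ℕ) : Submodule K M := if q ≤ k then g (k - q) else ⊥

theorem shiftGr_add (g : ℕ → Submodule K M) (q j : ℕ) : shiftGr g q (j + q) = g j := by
  simp [shiftGr]

theorem shiftGr_zero (g : ℕ → Submodule K M) (k : ℕ) : shiftGr g 0 k = g k := by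
  simp [shiftGr]

theorem shiftGr_one_succ (g : ℕ → Submodule K M) (k : ℕ) : shiftGr g 1 (k + 1) = g k := by
  simp [shiftGr]

theorem shiftGr_succ_succ (g : ℕ → Submodule K M) (q k : ℕ) :
    shiftGr g (q + 1) (k + 1) = shiftGr g q k := by
  simp [shiftGr]

theorem shiftGr_of_lt (g : ℕ → Submodule K M) {q k : ℕ} (h : k < q) : shiftGr g q k = ⊥ := by
  simp [shiftGr, h]

theorem map_mem_shiftGr {g : ℕ → Submodule K M} {g' : ℕ → Submodule K N} {f : M →ₗ[K] N} (e : ℕ)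
    (hf : ∀ j, ∀ x ∈ g j, f x ∈ g' (j + e)) {q k : ℕ} {x : M} (hx : x ∈ shiftGr g q k) :
    f x ∈ shiftGr g' q (k + e) := by
  rcases lt_or_ge k q with h | h
  · rw [shiftGr_of_lt g h, Submodule.mem_bot] at hx
    simp [hx]
  · obtain ⟨j, rfl⟩ := Nat.exists_eq_add_of_le' h
    rw [shiftGr_add] at hx
    rw [show j + q + e = (j + e) + q by omega, shiftGr_add]
    exact hf j x hx

end shiftGr

/-! ### The mapping cone that compares forms on `Δᵃ` with forms on `Δᵃ × Y` -/

namespace APL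

variable {K : Type v} [Field K]

open Simplicial

/-- The map `Δᵃ × Y ⟶ X × Y` given by an `a`-simplex of `X`. -/
def classify {X : SSet.{u}} (Y : SSet.{u}) {a : SimplexCategory} (σ : X.obj (op a)) :
    prod (simplex a) Y ⟶ prod X Y where
  app _ := TypeCat.ofHom fun z => (X.map z.1.down.op σ, z.2)
  naturality c e θ := by
    ext z
    have h : X.map (z.1.down.op ≫ θ) σ = X.map θ (X.map z.1.down.op σ) :=
      ConcreteCategory.congr_hom (X.map_comp z.1.down.op θ) σ
    exact Prod.ext h rfl

/-- The exterior product of a form on the simplex `Δᵃ` and a form on `Y`. -/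
noncomputable def cross {Y : SSet.{u}} (η : Families K Y) (a : SimplexCategory) :
    PolyForms K a.len →ₗ[K] Families K (prod (simplex a) Y) where
  toFun p c z := PolyForms.pullback z.1.down.toOrderHom p * η c z.2
  map_add' p q := by
    funext c z
    simp [add_mul]
  map_smul' r p := by
    funext c z
    simp

theorem cross_mem_gr {Y : SSet.{u}} {q : ℕ} {η : Families K Y} (hη : η ∈ gr K Y q)
    {a : SimplexCategory} {j : ℕ} {p : PolyForms K a.len} (hp : p ∈ PolyForms.gr K a.len j) :
    cross η a p ∈ gr K (prod (simplex a) Y) (j + q) := by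
  refine ⟨fun c z => PolyForms.mul_mem_gr (PolyForms.pullback_mem_gr _ hp) (hη.1 _ _),
    fun c e θ z => ?_⟩
  change PolyForms.pullback _ p * η c (Y.map θ.op z.2) = PolyForms.pullback _ (_ * _)
  rw [map_mul, hη.2, PolyForms.pullback_pullback]
  rfl

/-- With `η` closed the signed term of the Leibniz rule disappears, so crossing with `η` on the
right is a chain map. -/
theorem familiesD_cross {Y : SSet.{u}} {η : Families K Y} (hη : familiesD η = 0)
    {a : SimplexCategory} (p : PolyForms K a.len) :
    familiesD (cross η a p) = cross η a (PolyForms.d p) := by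
  funext c z
  change PolyForms.d (PolyForms.pullback _ p * η c z.2) = PolyForms.pullback _ _ * _
  have h : PolyForms.d (η c z.2) = 0 := congrFun (congrFun hη c) z.2
  rw [PolyForms.d_mul, h, mul_zero, add_zero, PolyForms.pullback_d]

theorem familiesMap_cross {Y : SSet.{u}} (η : Families K Y) {a b : SimplexCategory} (θ : a ⟶ b)
    (p : PolyForms K b.len) :
    familiesMap (classify (X := simplex b) Y ⟨θ⟩) (cross η b p) =
      cross η a (PolyForms.pullback θ.toOrderHom p) := by
  funext c z
  change PolyForms.pullback _ p * η c z.2 = PolyForms.pullback _ _ * η c z.2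
  rw [PolyForms.pullback_pullback]
  rfl

variable (K) in
/-- The simplicial module of pairs of a `β`-indexed family of forms on `Δᵃ` and a family of forms
on `Δᵃ × Y`. -/
noncomputable def kunnethModule (Y : SSet.{u}) (β : Type (max u v)) :
    SimplicialModule.{max u v} K where
  obj a := (β →₀ PolyForms K a.len) × Families K (prod (simplex a) Y)
  map θ := (Finsupp.mapRange.linearMap (PolyForms.pullback θ.toOrderHom).toLinearMap).prodMap
    (familiesMap (classify (X := simplex _) Y ⟨θ⟩)).toLinearMap
  map_id a x := by
    refine Prod.ext (Finsupp.ext fun b => ?_) (funext fun c => funext fun z => ?_)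
    · exact DFunLike.congr_fun PolyForms.pullback_id (x.1 b)
    · change x.2 c (⟨z.1.down ≫ 𝟙 a⟩, z.2) = x.2 c z
      rw [Category.comp_id]
      rfl
  map_comp θ ψ x := by
    refine Prod.ext (Finsupp.ext fun b => ?_) (funext fun c => funext fun z => ?_)
    · change PolyForms.pullback (θ ≫ ψ).toOrderHom (x.1 b) =
        PolyForms.pullback θ.toOrderHom (PolyForms.pullback ψ.toOrderHom (x.1 b))
      rw [PolyForms.pullback_pullback]
      rfl
    · change x.2 c (⟨z.1.down ≫ θ ≫ ψ⟩, z.2) = x.2 c (⟨(z.1.down ≫ θ) ≫ ψ⟩, z.2)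
      rw [Category.assoc]

/-- The map `(p_b) ↦ ∑ p_b × y_b`. -/
noncomputable def crossSum {Y : SSet.{u}} {β : Type*} (y : β → Families K Y)
    (a : SimplexCategory) : (β →₀ PolyForms K a.len) →ₗ[K] Families K (prod (simplex a) Y) :=
  Finsupp.lsum K fun b => cross (y b) a

theorem crossSum_apply {Y : SSet.{u}} {β : Type*} (y : β → Families K Y) (a : SimplexCategory)
    (x : β →₀ PolyForms K a.len) : crossSum y a x = x.sum fun b p => cross (y b) a p := rfl

theorem familiesD_crossSum {Y : SSet.{u}} {β : Type*} {y : β → Families K Y}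
    (hy : ∀ b, familiesD (y b) = 0) (a : SimplexCategory) (x : β →₀ PolyForms K a.len) :
    familiesD (crossSum y a x) =
      crossSum y a (Finsupp.mapRange.linearMap (PolyForms.d (K := K)) x) := by
  have : familiesD ∘ₗ crossSum y a =
      crossSum y a ∘ₗ Finsupp.mapRange.linearMap (PolyForms.d (K := K)) := by
    refine Finsupp.lhom_ext fun b p => ?_
    simp [crossSum, familiesD_cross (hy b)]
  exact DFunLike.congr_fun this x

theorem familiesMap_crossSum {Y : SSet.{u}} {β : Type*} (y : β → Families K Y)
    {a b : SimplexCategory} (θ : a ⟶ b) (x : β →₀ PolyForms K b.len) :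
    familiesMap (classify (X := simplex b) Y ⟨θ⟩) (crossSum y b x) =
      crossSum y a (Finsupp.mapRange.linearMap
        (PolyForms.pullback (K := K) θ.toOrderHom).toLinearMap x) := by
  have : (familiesMap (classify (X := simplex b) Y ⟨θ⟩)).toLinearMap ∘ₗ crossSum y b =
      crossSum y a ∘ₗ Finsupp.mapRange.linearMap
        (PolyForms.pullback (K := K) θ.toOrderHom).toLinearMap := by
    refine Finsupp.lhom_ext fun b p => ?_
    simp only [crossSum, LinearMap.comp_apply, Finsupp.lsum_single,
      Finsupp.mapRange.linearMap_apply, Finsupp.mapRange_single]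
    exact familiesMap_cross _ _ _
  exact DFunLike.congr_fun this x

theorem crossSum_mem_gr {Y : SSet.{u}} {β : Type*} {deg : β → ℕ} {y : β → Families K Y}
    (hy : ∀ b, y b ∈ gr K Y (deg b)) {a : SimplexCategory} {k : ℕ} {x : β →₀ PolyForms K a.len}
    (hx : ∀ b, x b ∈ shiftGr (PolyForms.gr K a.len) (deg b) k) :
    crossSum y a x ∈ gr K (prod (simplex a) Y) k := by
  rw [crossSum_apply]
  refine sum_mem fun b _ => ?_
  rcases lt_or_ge k (deg b) with h | h
  · have := hx b
    rw [shiftGr_of_lt _ h, Submodule.mem_bot] at this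
    simp [this]
  · obtain ⟨j, rfl⟩ := Nat.exists_eq_add_of_le' h
    have := hx b
    rw [shiftGr_add] at this
    exact cross_mem_gr (hy b) this

/-- The differential of the mapping cone of `(p_b) ↦ ∑ p_b × y_b`. -/
noncomputable def kunnethD {Y : SSet.{u}} {β : Type (max u v)} (y : β → Families K Y) :
    (kunnethModule K Y β).End where
  app a := ((-Finsupp.mapRange.linearMap (PolyForms.d (K := K))) ∘ₗ LinearMap.fst K _ _).prod
    (crossSum y a ∘ₗ LinearMap.fst K _ _ + familiesD ∘ₗ LinearMap.snd K _ _)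
  naturality {a b} θ x := by
    refine Prod.ext (Finsupp.ext fun i => ?_) ?_
    · change -PolyForms.d (PolyForms.pullback _ (x.1 i)) =
        PolyForms.pullback _ (-PolyForms.d (x.1 i))
      rw [map_neg, PolyForms.pullback_d]
    · change crossSum y a _ + familiesD (familiesMap _ x.2) =
        familiesMap _ (crossSum y b x.1 + familiesD x.2)
      rw [map_add, familiesMap_crossSum]
      rfl

theorem kunnethD_fst {Y : SSet.{u}} {β : Type (max u v)} (y : β → Families K Y)
    {a : SimplexCategory} (x : (kunnethModule K Y β).obj a) (b : β) :
    ((kunnethD y).app a x).1 b = -PolyForms.d (x.1 b) := rfl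

theorem kunnethD_snd {Y : SSet.{u}} {β : Type (max u v)} (y : β → Families K Y)
    {a : SimplexCategory} (x : (kunnethModule K Y β).obj a) :
    ((kunnethD y).app a x).2 = crossSum y a x.1 + familiesD x.2 := rfl

theorem kunnethD_kunnethD {Y : SSet.{u}} {β : Type (max u v)} {y : β → Families K Y}
    (hy : ∀ b, familiesD (y b) = 0) {a : SimplexCategory} (x : (kunnethModule K Y β).obj a) :
    (kunnethD y).app a ((kunnethD y).app a x) = 0 := by
  refine Prod.ext (Finsupp.ext fun b => ?_) ?_
  · rw [kunnethD_fst, kunnethD_fst, map_neg, PolyForms.d_d, neg_zero, neg_zero]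
    rfl
  · rw [kunnethD_snd, kunnethD_snd, map_add, familiesD_crossSum hy]
    have h1 : familiesD (familiesD x.2) = 0 := funext fun c => funext fun z => PolyForms.d_d _
    have h2 : ((kunnethD y).app a x).1 = -Finsupp.mapRange.linearMap (PolyForms.d (K := K)) x.1 :=
      rfl
    rw [h1, h2, map_neg, add_zero, neg_add_cancel]
    rfl

variable (K) in
/-- The part of degree `k` of the mapping cone. -/
noncomputable def kunnethSub (Y : SSet.{u}) {β : Type (max u v)} (deg : β → ℕ) (k : ℕ) :
    (kunnethModule K Y β).Sub where
  carrier a :=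
    (⨅ b, (shiftGr (PolyForms.gr K a.len) (deg b) k).comap
        (Finsupp.lapply b ∘ₗ LinearMap.fst K (β →₀ PolyForms K a.len) _)) ⊓
      -- As the target of a mapping cone, the forms on `Δᵃ × Y` are placed one degree lower.
      (shiftGr (gr K (prod (simplex a) Y)) 1 k).comap (LinearMap.snd K _ _)
  map_mem {a b} θ x hx := by
    refine ⟨Submodule.mem_iInf _ |>.2 fun i => ?_, ?_⟩
    · exact map_mem_shiftGr (f := (PolyForms.pullback θ.toOrderHom).toLinearMap) 0
        (fun j _ h => PolyForms.pullback_mem_gr _ h) ((Submodule.mem_iInf _).1 hx.1 i)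
    · exact map_mem_shiftGr (f := (familiesMap (classify (X := simplex b) Y ⟨θ⟩)).toLinearMap) 0
        (fun j _ h => familiesMap_mem_gr (classify (X := simplex b) Y ⟨θ⟩) h) hx.2

theorem mem_kunnethSub {Y : SSet.{u}} {β : Type (max u v)} {deg : β → ℕ} {k : ℕ}
    {a : SimplexCategory} {x : (kunnethModule K Y β).obj a} :
    x ∈ (kunnethSub K Y deg k).carrier a ↔
      (∀ b, x.1 b ∈ shiftGr (PolyForms.gr K a.len) (deg b) k) ∧
        x.2 ∈ shiftGr (gr K (prod (simplex a) Y)) 1 k :=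
  Submodule.mem_inf.trans (and_congr_left' (Submodule.mem_iInf _))

variable (K) in
/-- Multiplication by the barycentric coordinates of `Δᵃ`. -/
noncomputable def kunnethBary (Y : SSet.{u}) (β : Type (max u v)) : (kunnethModule K Y β).Bary where
  act a i := (Finsupp.mapRange.linearMap (LinearMap.mulLeft K (PolyForms.t i))).prodMap
    (LinearMap.mulLeft K (cross (1 : Families K Y) a (PolyForms.t i)))
  sum_act a x := by
    refine Prod.ext ?_ ?_
    · refine (map_sum (LinearMap.fst K (β →₀ PolyForms K a.len) (Families K (prod (simplex a) Y))) _ _).trans ?_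
      refine Finsupp.ext fun b => ?_
      refine (Finsupp.finsetSum_apply _ _ _).trans ?_
      change ∑ i, PolyForms.t i * x.1 b = x.1 b
      rw [← Finset.sum_mul, PolyForms.sum_t, one_mul]
    · refine (map_sum (LinearMap.snd K (β →₀ PolyForms K a.len) (Families K (prod (simplex a) Y))) _ _).trans ?_
      change ∑ i, cross (1 : Families K Y) a (PolyForms.t i) * x.2 = x.2
      rw [← Finset.sum_mul, ← map_sum, PolyForms.sum_t]
      funext c z
      change PolyForms.pullback _ 1 * 1 * x.2 c z = x.2 c z
      rw [map_one, mul_one, one_mul]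
  map_act {a b} θ i x := by
    refine Prod.ext ?_ ?_
    · refine Eq.trans ?_ (map_sum (LinearMap.fst K (β →₀ PolyForms K a.len) (Families K (prod (simplex a) Y))) _ _).symm
      refine Finsupp.ext fun k => ?_
      refine Eq.trans ?_ (Finsupp.finsetSum_apply _ _ _).symm
      change PolyForms.pullback _ (PolyForms.t i * x.1 k) =
        ∑ j with θ.toOrderHom j = i, PolyForms.t j * PolyForms.pullback _ (x.1 k)
      rw [← Finset.sum_mul, map_mul, PolyForms.pullback_t]
    · refine Eq.trans ?_ (map_sum (LinearMap.snd K (β →₀ PolyForms K a.len) (Families K (prod (simplex a) Y))) _ _).symm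
      change familiesMap _ (cross (1 : Families K Y) b (PolyForms.t i) * x.2) =
        ∑ j with θ.toOrderHom j = i, cross (1 : Families K Y) a (PolyForms.t j) * familiesMap _ x.2
      rw [← Finset.sum_mul, map_mul, familiesMap_cross, PolyForms.pullback_t, map_sum]

/-- The barycentric coordinates of `Δᵃ` have degree `0`, so multiplying by them, after pullback on
`Δᵃ × Y`, preserves each degree of the cone. -/
theorem kunnethSub_extendable (Y : SSet.{u}) {β : Type (max u v)} (deg : β → ℕ) (k : ℕ) :
    (kunnethSub K Y deg k).Extendable := by
  refine (kunnethBary K Y β).extendable _ fun a i x hx => ?_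
  rw [mem_kunnethSub] at hx ⊢
  refine ⟨fun b => ?_, ?_⟩
  · refine map_mem_shiftGr (f := LinearMap.mulLeft K (PolyForms.t i)) 0 (fun j x h => ?_) (hx.1 b)
    simpa using PolyForms.mul_mem_gr (PolyForms.t_mem_gr i) h
  · refine map_mem_shiftGr (f := LinearMap.mulLeft K (cross (1 : Families K Y) a (PolyForms.t i))) 0
      (fun j x h => ?_) hx.2
    simpa using mul_mem_gr (cross_mem_gr one_mem_gr (PolyForms.t_mem_gr i)) h

end APL

namespace SimplicialModule

/-- The version of `exists_preimage` for simplicial sets in a smaller universe. -/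
theorem exists_preimage' {K : Type v} [Field K] {E : SimplicialModule.{max u w} K} (D : E.End)
    (C : ℕ → E.Sub)
    (hD : ∀ k a, ∀ x ∈ (C k).carrier a, D.app a x ∈ (C (k + 1)).carrier a)
    (hDD : ∀ a x, D.app a (D.app a x) = 0) (hext : ∀ k, (C k).Extendable)
    (hzero : ∀ a, ∀ x ∈ (C 0).carrier a, D.app a x = 0 → x = 0)
    (hexact : ∀ k a, ∀ x ∈ (C (k + 1)).carrier a, D.app a x = 0 →
      ∃ y ∈ (C k).carrier a, D.app a y = x) (X : SSet.{u}) (k : ℕ)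
    (f : ∀ a : SimplexCategory, X.obj (op a) → E.obj a) (hf : E.IsNatural X f)
    (hfC : ∀ a x, f a x ∈ (C (k + 1)).carrier a) (hfD : ∀ a x, D.app a (f a x) = 0) :
    ∃ g : ∀ a : SimplexCategory, X.obj (op a) → E.obj a, E.IsNatural X g ∧
      (∀ a x, g a x ∈ (C k).carrier a) ∧ ∀ a x, D.app a (g a x) = f a x := by
  obtain ⟨g, hg, hgC, hgD⟩ := exists_preimage D C hD hDD hext hzero hexact
    (X ⋙ CategoryTheory.uliftFunctor.{w, u}) k (fun a x => f a x.down)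
    (fun a b θ x => hf a b θ x.down) (fun a x => hfC a x.down) fun a x => hfD a x.down
  exact ⟨fun a x => g a ⟨x⟩, fun a b θ x => hg a b θ ⟨x⟩, fun a x => hgC a ⟨x⟩,
    fun a x => hgD a ⟨x⟩⟩

end SimplicialModule

/-! ### Exactness of the mapping cone over each simplex -/

namespace APL

variable {K : Type v} [Field K]

open Simplicial

/-- Closed forms whose classes are a homogeneous basis of the cohomology of `Z`. -/
structure IsBasis (Z : SSet.{u}) {β : Type*} (deg : β → ℕ) (z : β → Families K Z) : Prop where
  mem : ∀ b, z b ∈ gr K Z (deg b)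
  closed : ∀ b, familiesD (z b) = 0
  span : ∀ k, ∀ ω ∈ gr K Z k, familiesD ω = 0 → ∃ c : β →₀ K, (∀ b, deg b ≠ k → c b = 0) ∧
    ∃ η ∈ shiftGr (gr K Z) 1 k, ω = Finsupp.linearCombination K z c + familiesD η
  indep : ∀ k (c : β →₀ K), (∀ b, deg b ≠ k → c b = 0) →
    (∃ η ∈ shiftGr (gr K Z) 1 k, familiesD η = Finsupp.linearCombination K z c) → c = 0

/-- The Poincaré lemma for each coefficient: a closed form is exact in positive degree and constant
in degree `0`, which occurs when `deg b = k`. -/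
theorem exists_split [CharZero K] {n k : ℕ} {β : Type*} {deg : β → ℕ} (x : β →₀ PolyForms K n)
    (hx : ∀ b, x b ∈ shiftGr (PolyForms.gr K n) (deg b) k) (hd : ∀ b, PolyForms.d (x b) = 0) :
    ∃ (c : β →₀ K) (ξ : β →₀ PolyForms K n), (∀ b, deg b ≠ k → c b = 0) ∧
      (∀ b, ξ b ∈ shiftGr (PolyForms.gr K n) (deg b + 1) k) ∧
      x = Finsupp.mapRange.linearMap (PolyForms.d (K := K)) ξ +
        Finsupp.mapRange.linearMap (Algebra.linearMap K _) c := by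
  -- The last clause makes the choices vanish with `x b`, so that they are again finitely supported.
  have key : ∀ b, ∃ (r : K) (p : PolyForms K n), (deg b ≠ k → r = 0) ∧
      p ∈ shiftGr (PolyForms.gr K n) (deg b + 1) k ∧ x b = PolyForms.d p + algebraMap K _ r ∧
      (x b = 0 → r = 0 ∧ p = 0) := by
    intro b
    by_cases h0 : x b = 0
    · exact ⟨0, 0, fun _ => rfl, zero_mem _, by simp [h0], fun _ => ⟨rfl, rfl⟩⟩
    have hb := hx b
    rcases lt_or_ge k (deg b) with h | h
    · rw [shiftGr_of_lt _ h, Submodule.mem_bot] at hb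
      exact absurd hb h0
    obtain ⟨j, rfl⟩ := Nat.exists_eq_add_of_le' h
    rw [shiftGr_add] at hb
    obtain _ | j := j
    · obtain ⟨r, hr⟩ := PolyForms.exists_eq_algebraMap_of_d_eq_zero hb (hd b)
      exact ⟨r, 0, fun h => absurd (by simp) h, zero_mem _, by simp [hr], fun h => absurd h h0⟩
    · obtain ⟨p, hp, hpx⟩ := PolyForms.exists_d_eq hb (hd b)
      refine ⟨0, p, fun _ => rfl, ?_, by simp [hpx], fun h => absurd h h0⟩
      rwa [show j + 1 + deg b = j + (deg b + 1) by omega, shiftGr_add]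
  choose r p hr hp hx' h0 using key
  refine ⟨Finsupp.onFinset x.support r fun b hb => ?_, Finsupp.onFinset x.support p fun b hb => ?_,
    hr, hp, Finsupp.ext hx'⟩
  · exact Finsupp.mem_support_iff.2 fun h => hb (h0 b h).1
  · exact Finsupp.mem_support_iff.2 fun h => hb (h0 b h).2

theorem crossSum_const {Y : SSet.{u}} {β : Type*} (y : β → Families K Y) (a : SimplexCategory)
    (c : β →₀ K) : crossSum y a (Finsupp.mapRange.linearMap (Algebra.linearMap K _) c) =
      Finsupp.linearCombination K (fun b => familiesMap (snd (simplex a) Y) (y b)) c := by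
  have : crossSum y a ∘ₗ Finsupp.mapRange.linearMap (Algebra.linearMap K _) =
      Finsupp.linearCombination K (fun b => familiesMap (snd (simplex a) Y) (y b)) := by
    refine Finsupp.lhom_ext fun b r => ?_
    simp only [crossSum, LinearMap.comp_apply, Finsupp.lsum_single,
      Finsupp.mapRange.linearMap_apply, Finsupp.mapRange_single, Finsupp.linearCombination_single]
    funext e z
    change PolyForms.pullback _ (algebraMap K _ r) * y b e z.2 = r • y b e z.2
    rw [AlgHom.commutes, Algebra.smul_def]
  exact DFunLike.congr_fun this c

theorem kunnethD_mem {Y : SSet.{u}} {β : Type (max u v)} {deg : β → ℕ}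
    {y : β → Families K Y} {a : SimplexCategory} (hy : ∀ b, y b ∈ gr K Y (deg b)) {k : ℕ}
    {x : (kunnethModule K Y β).obj a} (hx : x ∈ (kunnethSub K Y deg k).carrier a) :
    (kunnethD y).app a x ∈ (kunnethSub K Y deg (k + 1)).carrier a := by
  rw [mem_kunnethSub] at hx ⊢
  refine ⟨fun b => ?_, ?_⟩
  · rw [kunnethD_fst]
    exact neg_mem (map_mem_shiftGr 1 (fun j _ h => PolyForms.d_mem_gr h) (hx.1 b))
  · rw [kunnethD_snd]
    refine add_mem ?_ (map_mem_shiftGr 1 (fun j _ h => familiesD_mem_gr h) hx.2)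
    rw [shiftGr_one_succ]
    exact crossSum_mem_gr hy hx.1

section

variable [CharZero K] {Y : SSet.{u}} {β : Type (max u v)} {deg : β → ℕ} {y : β → Families K Y}

/-- The first component of a cocycle is exact up to constants `c`. The second component shows that
the combination of the `y_b` with coefficients `c` is exact on `Δᵃ × Y`, and independence of their
classes forces `c = 0`. -/
theorem exists_split_kunneth {a : SimplexCategory} (hy : ∀ b, y b ∈ gr K Y (deg b))
    (hdy : ∀ b, familiesD (y b) = 0)
    (hb : IsBasis (prod (simplex a) Y) deg fun b => familiesMap (snd (simplex a) Y) (y b)) {k : ℕ}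
    {x : (kunnethModule K Y β).obj a} (hx : x ∈ (kunnethSub K Y deg k).carrier a)
    (hD : (kunnethD y).app a x = 0) :
    ∃ ξ : β →₀ PolyForms K a.len, (∀ b, ξ b ∈ shiftGr (PolyForms.gr K a.len) (deg b + 1) k) ∧
      x.1 = Finsupp.mapRange.linearMap (PolyForms.d (K := K)) ξ := by
  rw [mem_kunnethSub] at hx
  have hd1 : ∀ b, PolyForms.d (x.1 b) = 0 := by
    intro b
    have := kunnethD_fst y x b
    rw [hD] at this
    exact neg_eq_zero.1 this.symm
  have hd2 : crossSum y a x.1 + familiesD x.2 = 0 := by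
    have := kunnethD_snd y x
    rw [hD] at this
    exact this.symm
  obtain ⟨c, ξ, hc, hξ, hxc⟩ := exists_split x.1 hx.1 hd1
  refine ⟨ξ, hξ, ?_⟩
  have hξ' : crossSum y a ξ ∈ shiftGr (gr K (prod (simplex a) Y)) 1 k := by
    obtain _ | k := k
    · have : ξ = 0 := Finsupp.ext fun b => by
        have := hξ b
        rwa [shiftGr_of_lt _ (by omega), Submodule.mem_bot] at this
      rw [this, map_zero]
      exact zero_mem _
    · rw [shiftGr_one_succ]
      exact crossSum_mem_gr hy fun b => by simpa [shiftGr_succ_succ] using hξ b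
  have hc0 : c = 0 := by
    -- From `x.1 = d ξ + c` and `∑ x.1 × y + d x.2 = 0` one gets `∑ c_b y_b = -d (x.2 + ∑ ξ × y)`.
    refine hb.indep k c hc ⟨-(x.2 + crossSum y a ξ), neg_mem (add_mem hx.2 hξ'), ?_⟩
    rw [← crossSum_const, map_neg, map_add, familiesD_crossSum hdy, neg_eq_iff_add_eq_zero,
      add_assoc, ← map_add, ← hxc, add_comm, hd2]
  rw [hxc, hc0, map_zero, add_zero]

theorem kunneth_zero {a : SimplexCategory} (hy : ∀ b, y b ∈ gr K Y (deg b))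
    (hdy : ∀ b, familiesD (y b) = 0)
    (hb : IsBasis (prod (simplex a) Y) deg fun b => familiesMap (snd (simplex a) Y) (y b))
    {x : (kunnethModule K Y β).obj a} (hx : x ∈ (kunnethSub K Y deg 0).carrier a)
    (hD : (kunnethD y).app a x = 0) : x = 0 := by
  obtain ⟨ξ, hξ, hξx⟩ := exists_split_kunneth hy hdy hb hx hD
  rw [mem_kunnethSub] at hx
  refine Prod.ext ?_ ?_
  · have : ξ = 0 := Finsupp.ext fun b => by
      have := hξ b
      rwa [shiftGr_of_lt _ (by omega), Submodule.mem_bot] at this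
    rw [hξx, this, map_zero]
    rfl
  · have := hx.2
    rw [shiftGr_of_lt _ (by omega), Submodule.mem_bot] at this
    exact this

/-- Given `x.1 = d ξ`, the form `x.2 + ∑ ξ × y` is closed, hence equal to `∑ c_b y_b + d η` because
the classes of the `y_b` span. -/
theorem kunneth_exact {a : SimplexCategory} (hy : ∀ b, y b ∈ gr K Y (deg b))
    (hdy : ∀ b, familiesD (y b) = 0)
    (hb : IsBasis (prod (simplex a) Y) deg fun b => familiesMap (snd (simplex a) Y) (y b)) {k : ℕ}
    {x : (kunnethModule K Y β).obj a} (hx : x ∈ (kunnethSub K Y deg (k + 1)).carrier a)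
    (hD : (kunnethD y).app a x = 0) :
    ∃ z ∈ (kunnethSub K Y deg k).carrier a, (kunnethD y).app a z = x := by
  obtain ⟨ξ, hξ, hξx⟩ := exists_split_kunneth hy hdy hb hx hD
  simp only [shiftGr_succ_succ] at hξ
  rw [mem_kunnethSub, shiftGr_one_succ] at hx
  have hd2 : crossSum y a x.1 + familiesD x.2 = 0 := by
    have := kunnethD_snd y x
    rw [hD] at this
    exact this.symm
  obtain ⟨c, hc, η, hη, hω⟩ := hb.span k (x.2 + crossSum y a ξ)
    (add_mem hx.2 (crossSum_mem_gr hy hξ)) (by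
      rw [map_add, familiesD_crossSum hdy, ← hξx, add_comm, hd2])
  -- The first component of `D` is `-d`, so `-ξ` accounts for `x.1`. The constants `c` do not affect
  -- it and supply the missing `∑ c_b y_b` in the second component.
  refine ⟨(-ξ + Finsupp.mapRange.linearMap (Algebra.linearMap K _) c, η), ?_, ?_⟩
  · refine mem_kunnethSub.2 ⟨fun b => add_mem (neg_mem (hξ b)) ?_, hη⟩
    change algebraMap K _ (c b) ∈ _
    by_cases h : deg b = k
    · have h2 : shiftGr (PolyForms.gr K a.len) (deg b) k = PolyForms.gr K a.len 0 := by
        simp [shiftGr, h]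
      rw [h2]
      exact PolyForms.algebraMap_mem_gr _
    · rw [hc b h, map_zero]
      exact zero_mem _
  · refine Prod.ext (Finsupp.ext fun b => ?_) ?_
    · rw [hξx]
      change -PolyForms.d (-ξ b + algebraMap K _ (c b)) = PolyForms.d (ξ b)
      simp
    · change crossSum y a (-ξ + _) + familiesD η = x.2
      rw [map_add, map_neg, crossSum_const, add_assoc, ← hω]
      abel

theorem kunneth_exists_preimage (hy : ∀ b, y b ∈ gr K Y (deg b)) (hdy : ∀ b, familiesD (y b) = 0)
    (hb : ∀ a, IsBasis (prod (simplex a) Y) deg fun b => familiesMap (snd (simplex a) Y) (y b))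
    (X : SSet.{u}) (k : ℕ)
    (f : ∀ a : SimplexCategory, X.obj (op a) → (kunnethModule K Y β).obj a)
    (hf : (kunnethModule K Y β).IsNatural X f)
    (hfC : ∀ a x, f a x ∈ (kunnethSub K Y deg (k + 1)).carrier a)
    (hfD : ∀ a x, (kunnethD y).app a (f a x) = 0) :
    ∃ g : ∀ a : SimplexCategory, X.obj (op a) → (kunnethModule K Y β).obj a,
      (kunnethModule K Y β).IsNatural X g ∧ (∀ a x, g a x ∈ (kunnethSub K Y deg k).carrier a) ∧
        ∀ a x, (kunnethD y).app a (g a x) = f a x :=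
  SimplicialModule.exists_preimage'.{v, v, u} (kunnethD y) (kunnethSub K Y deg)
    (fun _ _ _ hx => kunnethD_mem hy hx) (fun _ _ => kunnethD_kunnethD hdy _)
    (kunnethSub_extendable Y deg) (fun a _ hx => kunneth_zero hy hdy (hb a) hx)
    (fun _ a _ hx => kunneth_exact hy hdy (hb a) hx) X k f hf hfC hfD

end

end APL

/-! ### The Künneth theorem for forms on `X × Y` -/

namespace APL

variable {K : Type v} [Field K]

open Simplicial

variable (K) in
/-- The evaluation of families at a simplex. -/
def evalAt {X : SSet.{u}} {a : SimplexCategory} (x : X.obj (op a)) :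
    Families K X →ₗ[K] PolyForms K a.len where
  toFun f := f a x
  map_add' _ _ := rfl
  map_smul' _ _ := rfl

theorem families_sum_apply {X : SSet.{u}} {ι : Type*} (s : Finset ι) (F : ι → Families K X)
    (a : SimplexCategory) (x : X.obj (op a)) : (∑ i ∈ s, F i) a x = ∑ i ∈ s, F i a x :=
  map_sum (evalAt K x) F s

theorem natural_of_mem_shiftGr {X : SSet.{u}} {q k : ℕ} {f : Families K X}
    (hf : f ∈ shiftGr (gr K X) q k) (a b : SimplexCategory) (θ : a ⟶ b) (x : X.obj (op b)) :
    f a (X.map θ.op x) = PolyForms.pullback θ.toOrderHom (f b x) := by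
  rcases lt_or_ge k q with h | h
  · rw [shiftGr_of_lt _ h, Submodule.mem_bot] at hf
    simp [hf]
  · obtain ⟨j, rfl⟩ := Nat.exists_eq_add_of_le' h
    rw [shiftGr_add] at hf
    exact hf.2 a b θ x

theorem apply_mem_of_mem_shiftGr {X : SSet.{u}} {q k : ℕ} {f : Families K X}
    (hf : f ∈ shiftGr (gr K X) q k) (a : SimplexCategory) (x : X.obj (op a)) :
    f a x ∈ shiftGr (PolyForms.gr K a.len) q k :=
  map_mem_shiftGr (g := gr K X) (f := evalAt K x) 0 (fun _ _ h => h.1 a x) hf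

theorem mem_shiftGr_of_apply {X : SSet.{u}} {q k : ℕ} {f : Families K X}
    (hf : ∀ a x, f a x ∈ shiftGr (PolyForms.gr K a.len) q k)
    (hn : ∀ (a b : SimplexCategory) (θ : a ⟶ b) (x : X.obj (op b)),
      f a (X.map θ.op x) = PolyForms.pullback θ.toOrderHom (f b x)) :
    f ∈ shiftGr (gr K X) q k := by
  rcases lt_or_ge k q with h | h
  · have : f = 0 := funext fun a => funext fun x => by
      have := hf a x
      rwa [shiftGr_of_lt _ h, Submodule.mem_bot] at this
    rw [this]
    exact zero_mem _
  · obtain ⟨j, rfl⟩ := Nat.exists_eq_add_of_le' h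
    simp only [shiftGr_add] at hf ⊢
    exact ⟨hf, hn⟩

theorem crossSum_apply_apply {Y : SSet.{u}} {β : Type*} (y : β → Families K Y)
    {a : SimplexCategory} (p : β →₀ PolyForms K a.len) {c : SimplexCategory} (θ : c ⟶ a)
    (z : Y.obj (op c)) : crossSum y a p c (⟨θ⟩, z) =
      p.sum fun b q => PolyForms.pullback θ.toOrderHom q * y b c z := by
  rw [crossSum_apply]
  exact families_sum_apply _ _ _ _

variable [CharZero K] {Y : SSet.{u}} {β : Type (max u v)} {deg : β → ℕ} {y : β → Families K Y}

/-- Restricting `ω` along each simplex `σ` of `X` gives a compatible family of cocycles `(0, ω|σ)`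
of the cone. A preimage under `D` consists of closed coefficients on `X` and a form on `X × Y`, and
the second component of `D` is the required decomposition. -/
theorem kunneth_span (hy : ∀ b, y b ∈ gr K Y (deg b)) (hdy : ∀ b, familiesD (y b) = 0)
    (hb : ∀ a, IsBasis (prod (simplex a) Y) deg fun b => familiesMap (snd (simplex a) Y) (y b))
    (hfin : ∀ k, {b | deg b ≤ k}.Finite) (X : SSet.{u}) {k : ℕ} {ω : Families K (prod X Y)}
    (hω : ω ∈ gr K (prod X Y) k) (hdω : familiesD ω = 0) :
    ∃ x : β →₀ Families K X, (∀ b, x b ∈ shiftGr (gr K X) (deg b) k) ∧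
      (∀ b, familiesD (x b) = 0) ∧ ∃ η ∈ shiftGr (gr K (prod X Y)) 1 k,
        ω = (x.sum fun b p => familiesMap (fst X Y) p * familiesMap (snd X Y) (y b)) +
          familiesD η := by
  obtain ⟨g, hg, hgC, hgD⟩ := kunneth_exists_preimage hy hdy hb X k
    (fun a σ => (0, familiesMap (classify Y σ) ω))
    (fun a b θ σ => by
      refine Prod.ext (Finsupp.mapRange_zero (hf := map_zero _)).symm (funext fun c => funext fun z => ?_)
      exact congrArg (fun s => ω c (s, z.2))
        (ConcreteCategory.congr_hom (X.map_comp θ.op z.1.down.op) σ).symm)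
    (fun a σ => mem_kunnethSub.2 ⟨fun b => zero_mem _, by
      rw [shiftGr_one_succ]
      exact familiesMap_mem_gr _ hω⟩)
    (fun a σ => by
      refine Prod.ext (Finsupp.ext fun b => ?_) ?_
      · change -PolyForms.d 0 = 0
        simp
      · change crossSum y a 0 + familiesMap (classify Y σ) (familiesD ω) = 0
        rw [hdω, map_zero, map_zero, add_zero])
  have hgC' := fun a σ => mem_kunnethSub.1 (hgC a σ)
  have hg1 : ∀ b, (fun a σ => (g a σ).1 b : Families K X) ∈ shiftGr (gr K X) (deg b) k := by
    refine fun b => mem_shiftGr_of_apply (fun a σ => (hgC' a σ).1 b) fun a c θ σ => ?_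
    exact congrArg (fun t : (kunnethModule K Y β).obj a => t.1 b) (hg a c θ σ)
  -- Each simplex comes with its own finite support. A bound independent of the simplex holds
  -- because coefficients with `deg b > k` would have negative degree, and only finitely many `b`
  -- remain.
  have hsupp : ∀ b, (fun a σ => (g a σ).1 b : Families K X) ≠ 0 → b ∈ (hfin k).toFinset := by
    intro b hb'
    rw [Set.Finite.mem_toFinset, Set.mem_ofPred_eq]
    by_contra h
    have := hg1 b
    rw [shiftGr_of_lt _ (by omega), Submodule.mem_bot] at this
    exact hb' this
  -- The form on `X × Y` is recovered from the forms on the `Δᶜ × Y` by evaluation at the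
  -- tautological simplex of `Δᶜ`.
  refine ⟨Finsupp.onFinset (hfin k).toFinset (fun b => (fun a σ => (g a σ).1 b : Families K X))
    hsupp, hg1, fun b => ?_, fun c z => (g c z.1).2 c (⟨𝟙 c⟩, z.2), ?_, ?_⟩
  · funext a σ
    have := congrArg (fun t : (kunnethModule K Y β).obj a => t.1 b) (hgD a σ)
    exact neg_eq_zero.1 this
  · refine mem_shiftGr_of_apply
      (fun c z => apply_mem_of_mem_shiftGr (hgC' c z.1).2 _ _) fun c e θ z => ?_
    have h1 := congrArg (fun t : (kunnethModule K Y β).obj c => t.2 c (⟨𝟙 c⟩, Y.map θ.op z.2))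
      (hg c e θ z.1)
    refine h1.trans ?_
    refine Eq.trans ?_ (natural_of_mem_shiftGr (hgC' e z.1).2 c e θ (⟨𝟙 e⟩, z.2))
    change (g e z.1).2 c (⟨𝟙 c ≫ θ⟩, _) = (g e z.1).2 c (⟨θ ≫ 𝟙 e⟩, _)
    rw [Category.id_comp, Category.comp_id]
  · funext c z
    have h := congrArg (fun t : (kunnethModule K Y β).obj c => t.2 c (⟨𝟙 c⟩, z.2)) (hgD c z.1)
    have h1 : ω c (X.map (𝟙 c : c ⟶ c).op z.1, z.2) = ω c z :=
      congrArg (fun s => ω c (s, z.2)) (ConcreteCategory.congr_hom (X.map_id (op c)) z.1)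
    refine (h.trans h1).symm.trans ?_
    change crossSum y c (g c z.1).1 c (⟨𝟙 c⟩, z.2) + _ = _ + _
    refine congrArg (· + _) ?_
    rw [crossSum_apply_apply, Finsupp.onFinset_sum _ (by simp)]
    refine Eq.trans ?_ (families_sum_apply _ _ _ _).symm
    rw [Finsupp.sum_of_support_subset (s := (hfin k).toFinset) _ ?_ _ (by simp)]
    · refine Finset.sum_congr rfl fun b _ => ?_
      exact congrArg (· * y b c z.2) (DFunLike.congr_fun PolyForms.pullback_id ((g c z.1).1 b))
    · intro b hb'
      exact hsupp b fun h => Finsupp.mem_support_iff.1 hb' (congrFun (congrFun h c) z.1)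

/-- The relation says that `(x, -η)`, restricted to the simplices of `X`, is a compatible family of
cocycles of the cone; the first component of a preimage consists of primitives of the coefficients,
up to sign. In total degree `0` there is no preimage to take, and the cocycle itself is zero. -/
theorem kunneth_indep (hy : ∀ b, y b ∈ gr K Y (deg b)) (hdy : ∀ b, familiesD (y b) = 0)
    (hb : ∀ a, IsBasis (prod (simplex a) Y) deg fun b => familiesMap (snd (simplex a) Y) (y b))
    (X : SSet.{u}) {k : ℕ} {x : β →₀ Families K X}
    (hx : ∀ b, x b ∈ shiftGr (gr K X) (deg b) k) (hdx : ∀ b, familiesD (x b) = 0)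
    {η : Families K (prod X Y)} (hη : η ∈ shiftGr (gr K (prod X Y)) 1 k)
    (hηx : familiesD η =
      x.sum fun b p => familiesMap (fst X Y) p * familiesMap (snd X Y) (y b)) (b : β) :
    ∃ ξ ∈ shiftGr (gr K X) (deg b + 1) k, familiesD ξ = x b := by
  let f : ∀ a : SimplexCategory, X.obj (op a) → (kunnethModule K Y β).obj a := fun a σ =>
    (Finsupp.mapRange.linearMap (evalAt K σ) x, -familiesMap (classify Y σ) η)
  have hfC : ∀ a σ, f a σ ∈ (kunnethSub K Y deg k).carrier a := fun a σ =>
    mem_kunnethSub.2 ⟨fun b => apply_mem_of_mem_shiftGr (hx b) a σ, neg_mem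
      (map_mem_shiftGr (f := (familiesMap (classify Y σ)).toLinearMap) 0
        (fun _ _ h => familiesMap_mem_gr _ h) hη)⟩
  have hfD : ∀ a σ, (kunnethD y).app a (f a σ) = 0 := by
    intro a σ
    refine Prod.ext (Finsupp.ext fun b => ?_) (funext fun c => funext fun z => ?_)
    · change -PolyForms.d (x b a σ) = 0
      rw [neg_eq_zero]
      exact congrFun (congrFun (hdx b) a) σ
    · have h := congrFun (congrFun hηx c) (X.map z.1.down.op σ, z.2)
      replace h := h.trans (families_sum_apply _ _ _ _)
      change crossSum y a (Finsupp.mapRange (evalAt K σ) (map_zero _) x) c (⟨z.1.down⟩, z.2) +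
        familiesD (-familiesMap (classify Y σ) η) c z = 0
      rw [map_neg, crossSum_apply_apply, Finsupp.sum_of_support_subset (s := x.support) _
        Finsupp.support_mapRange _ (by simp)]
      change _ + -(familiesD η c (X.map z.1.down.op σ, z.2)) = 0
      rw [h, ← sub_eq_add_neg, sub_eq_zero]
      refine Finset.sum_congr rfl fun b _ => ?_
      exact congrArg (· * y b c z.2) (natural_of_mem_shiftGr (hx b) _ _ z.1.down σ).symm
  obtain _ | k := k
  · refine ⟨0, zero_mem _, ?_⟩
    rw [map_zero]
    funext a σ
    have := kunneth_zero hy hdy (hb a) (hfC a σ) (hfD a σ)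
    exact (congrArg (fun t : (kunnethModule K Y β).obj a => t.1 b) this).symm
  · obtain ⟨g, hg, hgC, hgD⟩ := kunneth_exists_preimage hy hdy hb X k f
      (fun a c θ σ => by
        refine Prod.ext (Finsupp.ext fun b => ?_) (funext fun e => funext fun z => ?_)
        · exact natural_of_mem_shiftGr (hx b) a c θ σ
        · exact congrArg (fun s => -η e (s, z.2))
            (ConcreteCategory.congr_hom (X.map_comp θ.op z.1.down.op) σ).symm) hfC hfD
    have hgC' := fun a σ => mem_kunnethSub.1 (hgC a σ)
    -- The sign compensates the `-d` in the first component of the cone differential.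
    refine ⟨-fun a σ => (g a σ).1 b, neg_mem ?_, ?_⟩
    · rw [shiftGr_succ_succ]
      refine mem_shiftGr_of_apply (fun a σ => (hgC' a σ).1 b) fun a c θ σ => ?_
      exact congrArg (fun t : (kunnethModule K Y β).obj a => t.1 b) (hg a c θ σ)
    · funext a σ
      rw [map_neg]
      exact congrArg (fun t : (kunnethModule K Y β).obj a => t.1 b) (hgD a σ)

end APL

/-! ### Homogeneous components -/

namespace CDGA

variable {K : Type v} [Field K] (A : CDGA.{w} K)

/-- The component of degree `k - q`. -/
noncomputable def shiftProj (q k : ℕ) : A →ₗ[K] A := if q ≤ k then A.proj (k - q) else 0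

theorem shiftProj_add (q j : ℕ) (a : A) : A.shiftProj q (j + q) a = A.proj j a := by
  simp [shiftProj]

theorem shiftProj_of_lt {q k : ℕ} (h : k < q) (a : A) : A.shiftProj q k a = 0 := by
  rw [shiftProj, if_neg (by omega), LinearMap.zero_apply]

theorem shiftProj_mem (q k : ℕ) (a : A) : A.shiftProj q k a ∈ shiftGr A.gr q k := by
  rcases lt_or_ge k q with h | h
  · rw [shiftProj_of_lt _ h]
    exact zero_mem _
  · obtain ⟨j, rfl⟩ := Nat.exists_eq_add_of_le' h
    rw [shiftProj_add, shiftGr_add]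
    exact A.proj_mem j a

theorem d_shiftProj_eq_zero (q k : ℕ) {a : A} (ha : A.d a = 0) : A.d (A.shiftProj q k a) = 0 := by
  rcases lt_or_ge k q with h | h
  · rw [shiftProj_of_lt _ h, map_zero]
  · obtain ⟨j, rfl⟩ := Nat.exists_eq_add_of_le' h
    rw [shiftProj_add, ← A.d_proj, ha, map_zero]

theorem d_shiftProj_one (k : ℕ) (a : A) : A.d (A.shiftProj 1 k a) = A.proj k (A.d a) := by
  obtain _ | k := k
  · rw [shiftProj_of_lt _ (by omega), map_zero, A.proj_zero_d]
  · rw [shiftProj_add, A.d_proj]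

theorem proj_mul_of_mem {q : ℕ} {y : A} (hy : y ∈ A.gr q) (k : ℕ) (a : A) :
    A.proj k (a * y) = A.shiftProj q k a * y := by
  induction a using homogeneous_induction with
  | h0 => simp
  | hm m a ha =>
    by_cases h : m + q = k
    · subst h
      rw [shiftProj_add, A.proj_same (A.mul_mem ha hy), A.proj_same ha]
    · rw [A.proj_ne h (A.mul_mem ha hy)]
      rcases lt_or_ge k q with h' | h'
      · rw [shiftProj_of_lt _ h', zero_mul]
      · obtain ⟨j, rfl⟩ := Nat.exists_eq_add_of_le' h'
        rw [shiftProj_add, A.proj_ne (by omega) ha, zero_mul]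
  | hadd a b iha ihb => simp [add_mul, iha, ihb]

/-- The component of degree `k - 1` of a primitive is still a primitive. For `k = 0` this component
is zero, in accordance with the absence of nonzero coboundaries in degree `0`. -/
theorem exists_homogeneous_primitive {k : ℕ} {a b : A} (ha : a ∈ A.gr k) (hb : A.d b = a) :
    ∃ c ∈ shiftGr A.gr 1 k, A.d c = a :=
  ⟨A.shiftProj 1 k b, A.shiftProj_mem 1 k b, by rw [d_shiftProj_one, hb, A.proj_same ha]⟩

end CDGA

/-! ### The cohomology of `Δᵃ × Y` -/

namespace APL

variable {K : Type v} [Field K]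

open Simplicial

theorem familiesD_one (X : SSet.{u}) : familiesD (1 : Families K X) = 0 := by
  funext a x
  change PolyForms.d 1 = 0
  simpa using PolyForms.d_algebraMap (K := K) (n := a.len) 1

theorem familiesMap_linearCombination {X Y : SSet.{u}} (φ : X ⟶ Y) {β : Type*}
    (y : β → Families K Y) (c : β →₀ K) :
    familiesMap φ (Finsupp.linearCombination K y c) =
      Finsupp.linearCombination K (fun b => familiesMap φ (y b)) c :=
  Finsupp.apply_linearCombination K (familiesMap φ).toLinearMap y c

/-- A simplicial set with a cone operator has the cohomology of a point, so the class of `1` is a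
basis. -/
theorem isBasis_of_coneOp [CharZero K] {Z : SSet.{u}} (e : ConeOp Z) {β : Type*} [Unique β] :
    IsBasis Z (fun _ : β => 0) fun _ => (1 : Families K Z) where
  mem _ := one_mem_gr
  closed _ := familiesD_one Z
  span k ω hω hd := by
    obtain _ | k := k
    · obtain ⟨r, hr⟩ := e.exists_eq_algebraMap hω hd
      refine ⟨Finsupp.single default r, fun _ h => absurd rfl h, 0, zero_mem _, ?_⟩
      rw [hr, map_zero, add_zero, Finsupp.linearCombination_single, Algebra.algebraMap_eq_smul_one]
    · obtain ⟨η, hη, h⟩ := e.exists_d_eq hω hd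
      refine ⟨0, fun _ _ => rfl, η, by rwa [shiftGr_one_succ], ?_⟩
      rw [map_zero, zero_add, h]
  indep k c hc := by
    rintro ⟨η, hη, h⟩
    obtain _ | k := k
    · rw [shiftGr_of_lt _ (by omega), Submodule.mem_bot] at hη
      rw [hη, map_zero, Finsupp.unique_single c, Finsupp.linearCombination_single] at h
      -- Evaluation at the cone point, where the forms are a nontrivial algebra.
      have h' : (0 : PolyForms K 0) = c default • 1 := congrFun (congrFun h ⦋0⦌) e.point
      refine Finsupp.ext fun b => ?_
      rw [Subsingleton.elim b default]
      exact (smul_eq_zero.1 h'.symm).resolve_right one_ne_zero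
    · exact Finsupp.ext fun b => hc b (by omega)

/-- The exchange of factors. -/
def swap (X Y : SSet.{u}) : prod X Y ⟶ prod Y X where
  app _ := TypeCat.ofHom fun z => (z.2, z.1)
  naturality _ _ _ := rfl

variable [CharZero K]

theorem isBasis_simplex_prod_simplex (a b : SimplexCategory) :
    IsBasis (prod (simplex.{u} a) (simplex b)) (fun _ : PUnit.{max u v + 1} => 0) fun _ =>
      familiesMap (snd (simplex a) (simplex b)) (1 : Families K (simplex b)) := by
  rw [map_one]
  exact isBasis_of_coneOp ((ConeOp.simplex a).prod (ConeOp.simplex b))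

/-- The Künneth argument with `Y` as base, `Δᵃ` as fibre and `1` as the only basis element; its
input is that products of two simplices are contractible. Exchanging the factors leads back to `Δᵃ ×
Y`. -/
theorem exists_eq_familiesMap_snd (Y : SSet.{u}) (a : SimplexCategory) {k : ℕ}
    {ω : Families K (prod (simplex a) Y)} (hω : ω ∈ gr K _ k) (hd : familiesD ω = 0) :
    ∃ x ∈ gr K Y k, familiesD x = 0 ∧ ∃ η ∈ shiftGr (gr K (prod (simplex a) Y)) 1 k,
      ω = familiesMap (snd (simplex a) Y) x + familiesD η := by
  obtain ⟨x, hx, hdx, η, hη, h⟩ := kunneth_span (Y := simplex a) (fun _ => one_mem_gr)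
    (fun _ => familiesD_one _) (fun b => isBasis_simplex_prod_simplex b a)
    (fun _ => Set.toFinite _) Y (familiesMap_mem_gr (swap Y (simplex a)) hω)
    (congrArg (familiesMap (swap Y (simplex a))) hd)
  refine ⟨x default, by simpa [shiftGr_zero] using hx default, hdx _,
    familiesMap (swap (simplex a) Y) η, map_mem_shiftGr
      (f := (familiesMap (swap (simplex a) Y)).toLinearMap) 0
      (fun _ _ h => familiesMap_mem_gr _ h) hη, ?_⟩
  have h' := congrArg (familiesMap (swap (simplex a) Y)) h
  rw [Finsupp.unique_single x, Finsupp.sum_single_index (by simp),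
    map_one (familiesMap (snd Y (simplex a))), mul_one, map_add] at h'
  exact h'

/-- Injectivity of the pullback `H(Y) → H(Δᵃ × Y)`, from `kunneth_indep` with the same exchange of
roles. -/
theorem exists_primitive_of_familiesMap_snd (Y : SSet.{u}) (a : SimplexCategory) {k : ℕ}
    {x : Families K Y} (hx : x ∈ gr K Y k) (hdx : familiesD x = 0)
    {η : Families K (prod (simplex a) Y)} (hη : η ∈ shiftGr (gr K (prod (simplex a) Y)) 1 k)
    (h : familiesD η = familiesMap (snd (simplex a) Y) x) :
    ∃ ξ ∈ shiftGr (gr K Y) 1 k, familiesD ξ = x := by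
  have := kunneth_indep (Y := simplex a) (fun _ => one_mem_gr)
    (fun _ => familiesD_one _) (fun b => isBasis_simplex_prod_simplex b a) Y (k := k)
    (x := Finsupp.single default x) (fun b => by
      rw [Subsingleton.elim b default, Finsupp.single_eq_same, shiftGr_zero]; exact hx)
    (fun b => by rw [Subsingleton.elim b default, Finsupp.single_eq_same]; exact hdx)
    (η := familiesMap (swap Y (simplex a)) η) (map_mem_shiftGr
      (f := (familiesMap (swap Y (simplex a))).toLinearMap) 0
      (fun _ _ h => familiesMap_mem_gr _ h) hη) (by
        rw [Finsupp.sum_single_index (by simp), map_one, mul_one]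
        exact congrArg (familiesMap (swap Y (simplex a))) h) default
  simpa using this

/-- The projection `Δᵃ × Y ⟶ Y` induces an isomorphism on cohomology. This supplies the hypothesis
on `Δᵃ × Y` in the Künneth argument for arbitrary `Y`. -/
theorem IsBasis.simplex_prod {Y : SSet.{u}} {β : Type*} {deg : β → ℕ} {y : β → Families K Y}
    (hb : IsBasis Y deg y) (a : SimplexCategory) :
    IsBasis (prod (simplex a) Y) deg fun b => familiesMap (snd (simplex a) Y) (y b) where
  mem b := familiesMap_mem_gr _ (hb.mem b)
  closed b := congrArg (familiesMap (snd (simplex a) Y)) (hb.closed b)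
  span k ω hω hd := by
    obtain ⟨x, hx, hdx, η, hη, h⟩ := exists_eq_familiesMap_snd Y a hω hd
    obtain ⟨c, hc, ζ, hζ, h'⟩ := hb.span k x hx hdx
    refine ⟨c, hc, familiesMap (snd (simplex a) Y) ζ + η, add_mem (map_mem_shiftGr
      (f := (familiesMap (snd (simplex a) Y)).toLinearMap) 0
      (fun _ _ h => familiesMap_mem_gr _ h) hζ) hη, ?_⟩
    rw [h, h', map_add, map_add, familiesMap_linearCombination, add_assoc]
    rfl
  indep k c hc := by
    rintro ⟨η, hη, h⟩
    rw [← familiesMap_linearCombination] at h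
    have hmem : Finsupp.linearCombination K y c ∈ gr K Y k := by
      rw [Finsupp.linearCombination_apply]
      refine sum_mem fun b _ => ?_
      by_cases hbk : deg b = k
      · exact Submodule.smul_mem _ _ (hbk ▸ hb.mem b)
      · simp [hc b hbk]
    have hcl : familiesD (Finsupp.linearCombination K y c) = 0 := by
      rw [Finsupp.apply_linearCombination]
      rw [Finsupp.linearCombination_apply]
      exact Finset.sum_eq_zero fun b _ => by simp [hb.closed]
    exact hb.indep k c hc (exists_primitive_of_familiesMap_snd Y a hmem hcl hη h)

end APL

/-! ### From families of forms to the Künneth property of `A_PL` -/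

namespace APL

variable {K : Type v} [Field K]

open Simplicial

theorem shiftGr_le_total {X : SSet.{u}} (q k : ℕ) :
    shiftGr (gr K X) q k ≤ Subalgebra.toSubmodule (total K X) := by
  rw [shiftGr]
  split_ifs
  · exact le_iSup (gr K X) _
  · exact bot_le

variable (K) in
/-- The family of forms underlying an element of `A_PL(X)`. -/
noncomputable def toFamilies (X : SSet.{u}) : obj K X →ₗ[K] Families K X :=
  (total K X).val.toLinearMap

theorem toFamilies_injective (X : SSet.{u}) : Function.Injective (toFamilies K X) :=
  Subtype.val_injective

theorem exists_toFamilies_eq {X : SSet.{u}} {q k : ℕ} {f : Families K X}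
    (hf : f ∈ shiftGr (gr K X) q k) : ∃ g, toFamilies K X g = f :=
  ⟨⟨f, shiftGr_le_total q k hf⟩, rfl⟩

theorem toFamilies_d {X : SSet.{u}} (f : obj K X) :
    toFamilies K X ((obj K X).d f) = familiesD (toFamilies K X f) := rfl

theorem toFamilies_mem_shiftGr {X : SSet.{u}} {q k : ℕ} {f : obj K X}
    (hf : f ∈ shiftGr (obj K X).gr q k) : toFamilies K X f ∈ shiftGr (gr K X) q k :=
  map_mem_shiftGr (f := toFamilies K X) 0 (fun _ _ h => h) hf

theorem toFamilies_sum {X Y : SSet.{u}} {β : Type*} (x : β →₀ obj K X) (y : β → obj K Y) :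
    toFamilies K (prod X Y) (x.sum fun b a => (APL.map (fst X Y)).toAlgHom a *
      (APL.map (snd X Y)).toAlgHom (y b)) =
    (Finsupp.mapRange.linearMap (toFamilies K X) x).sum fun b p =>
      familiesMap (fst X Y) p * familiesMap (snd X Y) (toFamilies K Y (y b)) := by
  rw [Finsupp.mapRange.linearMap_apply, Finsupp.sum_mapRange_index (by simp), Finsupp.sum, map_sum]
  rfl

/-- The basis is collected from bases of the separate `Hⁿ(Y)`, hence homogeneous. Finite type enters
here: each degree contributes finitely many elements. The indices are lifted to the universe that
`kunnethModule` asks for. -/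
theorem exists_basis {Y : SSet.{u}}
    (hfd : ∀ n, FiniteDimensional K ((obj K Y).cohomology.gr n)) :
    ∃ (β : Type (max u v)) (deg : β → ℕ) (y : β → (obj K Y).cocycles)
      (bas : Module.Basis β K (obj K Y).cohomology),
      (∀ b, bas b = CDGA.clsₗ (obj K Y) (y b)) ∧ (IsBasis Y deg fun b => toFamilies K Y (y b)) ∧
        ∀ k, {b | deg b ≤ k}.Finite := by
  let v : ∀ n, Module.Basis (ULift.{max u v} (Fin (Module.finrank K ((obj K Y).cohomology.gr n)))) K
      ((obj K Y).cohomology.gr n) := fun n => (Module.finBasis K _).reindex Equiv.ulift.symm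
  let bas := (obj K Y).cohomology.isInternal.collectedBasis v
  have hbas : ∀ b, bas b ∈ (obj K Y).cohomology.gr b.1 :=
    (obj K Y).cohomology.isInternal.collectedBasis_mem v
  choose y hy hyb using fun b => (CDGA.mem_cohomologyGr _).1 (hbas b)
  have hyb' : ∀ b, bas b = CDGA.clsₗ (obj K Y) (y b) := fun b => (hyb b).symm
  have hcls : ∀ c, CDGA.clsₗ (obj K Y) (Finsupp.linearCombination K y c) =
      Finsupp.linearCombination K bas c := by
    intro c
    rw [Finsupp.apply_linearCombination]
    exact congrArg (fun w => Finsupp.linearCombination K w c) (funext fun b => (hyb' b).symm)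
  have hcoe : ∀ c, toFamilies K Y (Finsupp.linearCombination K y c).1 =
      Finsupp.linearCombination K (fun b => toFamilies K Y (y b)) c := fun c =>
    Finsupp.apply_linearCombination K (toFamilies K Y ∘ₗ (obj K Y).cocycles.val.toLinearMap) y c
  have hmem : ∀ k c, (∀ b : (n : ℕ) × _, b.1 ≠ k → c b = 0) →
      (Finsupp.linearCombination K y c).1 ∈ (obj K Y).gr k := by
    intro k c hc
    change _ ∈ (obj K Y).cocyclesGr k
    rw [Finsupp.linearCombination_apply]
    refine sum_mem fun b _ => ?_
    by_cases hbk : b.1 = k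
    · exact Submodule.smul_mem _ _ (hbk ▸ hy b)
    · simp [hc b hbk]
  refine ⟨_, Sigma.fst, y, bas, hyb', ⟨hy, fun b => congrArg (toFamilies K Y) (y b).2, ?_, ?_⟩, ?_⟩
  · intro k ω hω hd
    obtain ⟨ω, rfl⟩ := exists_toFamilies_eq ((shiftGr_zero (gr K Y) k).symm ▸ hω)
    let z : (obj K Y).cocycles := ⟨ω, toFamilies_injective Y hd⟩
    have hz : CDGA.clsₗ (obj K Y) z ∈ (obj K Y).cohomology.gr k := ⟨z, hω, rfl⟩
    set c := bas.repr (CDGA.clsₗ (obj K Y) z) with hcdef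
    have hc : ∀ b, b.1 ≠ k → c b = 0 := fun b hb =>
      (obj K Y).cohomology.isInternal.collectedBasis_repr_of_mem_ne v (Ne.symm hb) hz
    have h0 : CDGA.clsₗ (obj K Y) (z - Finsupp.linearCombination K y c) = 0 := by
      rw [map_sub, hcls, bas.linearCombination_repr, sub_self]
    obtain ⟨η, hη⟩ := CDGA.clsₗ_eq_zero_iff.1 h0
    -- The primitive given by equality of classes need not be homogeneous, as `IsBasis` demands, so
    -- its component of the right degree is taken.
    obtain ⟨ζ, hζ, h⟩ := (obj K Y).exists_homogeneous_primitive (k := k)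
      (sub_mem (show z.1 ∈ (obj K Y).gr k from hω) (hmem k c hc)) hη
    refine ⟨c, hc, toFamilies K Y ζ, toFamilies_mem_shiftGr hζ, ?_⟩
    rw [← toFamilies_d, h, map_sub, hcoe]
    exact (add_sub_cancel _ _).symm
  · rintro k c hc ⟨η, hη, h⟩
    obtain ⟨η, rfl⟩ := exists_toFamilies_eq hη
    rw [← hcoe, ← toFamilies_d] at h
    have h0 := CDGA.clsₗ_eq_zero_iff.2 ⟨η, toFamilies_injective Y h⟩
    rw [hcls] at h0
    exact bas.linearIndependent (h0.trans (map_zero _).symm)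
  · intro k
    refine ((Set.finite_Iic k).biUnion fun n _ => Set.finite_range (Sigma.mk n)).subset ?_
    rintro ⟨n, i⟩ hn
    exact Set.mem_biUnion (x := n) hn ⟨i, rfl⟩

variable [CharZero K] {Y : SSet.{u}} {β : Type (max u v)} {deg : β → ℕ} {y : β → obj K Y}

/-- `kunneth_span` and `kunneth_indep` treat one total degree at a time; the general statement
follows by splitting into homogeneous components. -/
theorem isKunneth_prod (hb : IsBasis Y deg fun b => toFamilies K Y (y b)) (hfin : ∀ k, {b | deg b ≤ k}.Finite)
    (X : SSet.{u}) : CDGA.IsKunneth (APL.map (K := K) (fst X Y)) (APL.map (snd X Y)) y where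
  surj ω hω := by
    classical
    obtain ⟨s, hs⟩ := (obj K (prod X Y)).exists_sum_proj ω
    have hω' : ∀ n, (obj K (prod X Y)).d ((obj K (prod X Y)).proj n ω) = 0 := fun n => by
      rw [← CDGA.d_proj, hω, map_zero]
    rw [hs]
    refine Finset.sum_induction _ (fun ω => ∃ x : β →₀ obj K X, (∀ b, (obj K X).d (x b) = 0) ∧
      ∃ η, ω = (x.sum fun b a => (APL.map (fst X Y)).toAlgHom a *
        (APL.map (snd X Y)).toAlgHom (y b)) + (obj K (prod X Y)).d η) ?_ ?_ ?_
    · rintro _ _ ⟨x, hx, η, rfl⟩ ⟨x', hx', η', rfl⟩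
      refine ⟨x + x', fun b => by rw [Finsupp.add_apply, map_add, hx, hx', add_zero], η + η', ?_⟩
      rw [Finsupp.sum_add_index' (by simp) (by simp [add_mul]), map_add]
      abel
    · exact ⟨0, fun b => map_zero _, 0, by simp⟩
    · intro k _
      obtain ⟨x, hx, hdx, η, hη, h⟩ := kunneth_span hb.mem hb.closed hb.simplex_prod hfin X
        ((obj K (prod X Y)).proj_mem k ω) (congrArg (toFamilies K _) (hω' k))
      obtain ⟨η, rfl⟩ := exists_toFamilies_eq hη
      choose x' hx' using fun b => exists_toFamilies_eq (hx b)
      have hx0 : ∀ b, x' b ≠ 0 → b ∈ x.support := fun b h0 => Finsupp.mem_support_iff.2 fun h =>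
        h0 (toFamilies_injective X ((hx' b).trans (h.trans (map_zero _).symm)))
      have hxx : Finsupp.mapRange.linearMap (toFamilies K X) (Finsupp.onFinset x.support x' hx0) =
          x := Finsupp.ext hx'
      refine ⟨Finsupp.onFinset x.support x' hx0, fun b => toFamilies_injective X ?_, η,
        toFamilies_injective _ (h.trans ?_)⟩
      · exact (congrArg familiesD (hx' b)).trans (hdx b)
      · rw [map_add, toFamilies_sum, hxx, toFamilies_d]
  inj x hx := by
    rintro ⟨η, hη⟩ b
    -- The component of degree `j` of `x b` meets `y b` in total degree `j + deg b`, so the relation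
    -- is projected to that degree. This leaves the component of degree `k - deg b'` of each
    -- coefficient `x b'`.
    have key : ∀ j, ∃ ξ, (obj K X).d ξ = (obj K X).proj j (x b) := by
      intro j
      set k := j + deg b with hk
      let x' : β →₀ obj K X := Finsupp.onFinset x.support
        (fun b => (obj K X).shiftProj (deg b) k (x b)) fun b hb =>
          Finsupp.mem_support_iff.2 fun h => hb (by rw [h, map_zero])
      have hx' : (obj K (prod X Y)).d ((obj K (prod X Y)).shiftProj 1 k η) =
          x'.sum fun b a => (APL.map (fst X Y)).toAlgHom a *
            (APL.map (snd X Y)).toAlgHom (y b) := by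
        rw [CDGA.d_shiftProj_one, hη, Finsupp.sum, map_sum, Finsupp.onFinset_sum _ (by simp)]
        refine Finset.sum_congr rfl fun b _ => ?_
        rw [CDGA.proj_mul_of_mem _ ((APL.map (snd X Y)).map_gr (hb.mem b))]
        congr 1
        rcases lt_or_ge k (deg b) with h | h
        · rw [CDGA.shiftProj_of_lt _ h, CDGA.shiftProj_of_lt _ h, map_zero]
        · obtain ⟨i, hi⟩ := Nat.exists_eq_add_of_le' h
          rw [hi, CDGA.shiftProj_add, CDGA.shiftProj_add, CDGA.map_proj]
      obtain ⟨ξ, hξ, h⟩ := kunneth_indep hb.mem hb.closed hb.simplex_prod X (k := k)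
        (x := Finsupp.mapRange.linearMap (toFamilies K X) x')
        (fun b => toFamilies_mem_shiftGr ((obj K X).shiftProj_mem (deg b) k (x b)))
        (fun b => congrArg (toFamilies K X) ((obj K X).d_shiftProj_eq_zero (deg b) k (hx b)))
        (toFamilies_mem_shiftGr ((obj K (prod X Y)).shiftProj_mem 1 k η))
        ((congrArg (toFamilies K _) hx').trans (toFamilies_sum x' y)) b
      obtain ⟨ξ, rfl⟩ := exists_toFamilies_eq hξ
      refine ⟨ξ, toFamilies_injective X (h.trans ?_)⟩
      exact congrArg (toFamilies K X) ((obj K X).shiftProj_add (deg b) j (x b))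
    choose ξ hξ using key
    obtain ⟨s, hs⟩ := (obj K X).exists_sum_proj (x b)
    refine ⟨∑ j ∈ s, ξ j, ?_⟩
    conv_rhs => rw [hs]
    rw [map_sum]
    exact Finset.sum_congr rfl fun j _ => hξ j

end APL

/-! ### Constructions of coproduct cofans -/

namespace CategoryTheory.Limits

variable {C : Type*} [Category C] {ι ι' : Type*}

/-- A coproduct cofan on `Option ι` from a coproduct cofan on `ι` and a binary one. -/
noncomputable def isColimitCofanOption {A : Option ι → C} {P Q : C} (g : ∀ o, A o ⟶ P)
    (h : ∀ i, A (some i) ⟶ Q) (r : Q ⟶ P) (hr : ∀ i, g (some i) = h i ≫ r)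
    (hQ : IsColimit (Cofan.mk Q h)) (hP : IsColimit (BinaryCofan.mk r (g none))) :
    IsColimit (Cofan.mk P g) :=
  Cofan.IsColimit.mk _
    (fun c => (BinaryCofan.IsColimit.desc' hP
      (Cofan.IsColimit.desc hQ fun i => c.inj (some i)) (c.inj none)).1)
    (fun c o => by
      have h2 := (BinaryCofan.IsColimit.desc' hP
        (Cofan.IsColimit.desc hQ fun i => c.inj (some i)) (c.inj none)).2
      cases o with
      | none => exact h2.2
      | some i =>
        refine (congrArg (· ≫ _) (hr i)).trans ((Category.assoc _ _ _).trans ?_)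
        exact (congrArg (h i ≫ ·) h2.1).trans (Cofan.IsColimit.fac hQ _ i))
    fun c m hm => by
      have h2 := (BinaryCofan.IsColimit.desc' hP
        (Cofan.IsColimit.desc hQ fun i => c.inj (some i)) (c.inj none)).2
      refine BinaryCofan.IsColimit.hom_ext hP ?_ ((hm none).trans h2.2.symm)
      refine Eq.trans ?_ h2.1.symm
      refine Cofan.IsColimit.hom_ext hQ _ _ fun i => ?_
      refine Eq.trans ?_ (Cofan.IsColimit.fac hQ _ i).symm
      refine (Category.assoc _ _ _).symm.trans (Eq.trans ?_ (hm (some i)))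
      exact congrArg (· ≫ m) (hr i).symm

/-- Reindexing of a coproduct cofan. -/
noncomputable def isColimitCofanOfEquiv (e : ι ≃ ι') {A : ι' → C} {P : C} (g : ∀ j, A j ⟶ P)
    (h : IsColimit (Cofan.mk P fun i => g (e i))) : IsColimit (Cofan.mk P g) :=
  Cofan.IsColimit.mk _ (fun c => Cofan.IsColimit.desc h fun i => c.inj (e i))
    (fun c j => by
      obtain ⟨i, rfl⟩ := e.surjective j
      exact Cofan.IsColimit.fac h _ i)
    fun c m hm => Cofan.IsColimit.hom_ext h _ _ fun i =>
      (hm (e i)).trans (Cofan.IsColimit.fac h (fun i => c.inj (e i)) i).symm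

/-- An initial object is a coproduct of the empty family. -/
def isColimitCofanOfIsEmpty [IsEmpty ι] {A : ι → C} {P : C} (g : ∀ j, A j ⟶ P)
    (h : IsInitial P) : IsColimit (Cofan.mk P g) :=
  Cofan.IsColimit.mk _ (fun _ => h.to _) (fun _ j => isEmptyElim j) fun _ _ _ => h.hom_ext _ _

end CategoryTheory.Limits

/-! ### Cohomology of finite products of simplicial sets and of spaces -/

namespace APL

open Limits Simplicial

variable {K : Type v} [Field K] [CharZero K]

/-- A contractible simplicial set has only scalars as cohomology. This settles the empty product,
whose cohomology has to be initial. -/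
theorem algebraMap_bijective_of_coneOp {Z : SSet.{u}} (e : ConeOp Z) :
    Function.Bijective (algebraMap K (obj K Z).cohomology) := by
  constructor
  · rw [injective_iff_map_eq_zero]
    intro r hr
    have hr' : CDGA.clsₗ (obj K Z) (algebraMap K _ r) = 0 := hr
    obtain ⟨b, hb⟩ := CDGA.clsₗ_eq_zero_iff.1 hr'
    obtain ⟨c, hc, hcr⟩ := (obj K Z).exists_homogeneous_primitive (k := 0)
      (show algebraMap K (obj K Z) r ∈ (obj K Z).gr 0 by
        rw [Algebra.algebraMap_eq_smul_one]
        exact Submodule.smul_mem _ _ (obj K Z).one_mem) hb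
    rw [shiftGr_of_lt _ (by omega), Submodule.mem_bot] at hc
    rw [hc, map_zero] at hcr
    have h : (0 : PolyForms K 0) = algebraMap K _ r :=
      congrArg (fun f => toFamilies K Z f ⦋0⦌ e.point) hcr
    exact (map_eq_zero_iff _ (algebraMap K (PolyForms K 0)).injective).1 h.symm
  · intro q
    induction q using CDGA.homogeneous_induction with
    | h0 => exact ⟨0, map_zero _⟩
    | hm n q hq =>
      obtain ⟨z, hz, rfl⟩ := hq
      obtain _ | n := n
      · obtain ⟨r, hr⟩ := e.exists_eq_algebraMap hz (congrArg (toFamilies K Z) z.2)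
        exact ⟨r, congrArg (CDGA.clsₗ (obj K Z)) (Subtype.ext (toFamilies_injective Z hr.symm))⟩
      · obtain ⟨η, hη, h⟩ := e.exists_d_eq hz (congrArg (toFamilies K Z) z.2)
        obtain ⟨η, rfl⟩ := exists_toFamilies_eq ((shiftGr_zero (gr K Z) n).symm ▸ hη)
        refine ⟨0, (map_zero _).trans (Eq.symm ?_)⟩
        exact CDGA.clsₗ_eq_zero_iff.2 ⟨η, toFamilies_injective Z h⟩
    | hadd a b ha hb =>
      obtain ⟨r, rfl⟩ := ha
      obtain ⟨s, rfl⟩ := hb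
      exact ⟨r + s, map_add _ _ _⟩

/-- A simplicial set with the universal bijections of a product is isomorphic to `prod X Y`, so the
Künneth theorem carries over. Only the factor `Y` has to be of finite type. -/
theorem nonempty_isColimit_binary {P X Y : SSet.{u}}
    (hfd : ∀ n, FiniteDimensional K ((obj K Y).cohomology.gr n)) (f : P ⟶ X) (g : P ⟶ Y)
    (h : ∀ a, Function.Bijective fun p : P.obj a => (f.app a p, g.app a p)) :
    Nonempty (IsColimit (BinaryCofan.mk ((CDGA.cohomologyFunctor K).map (APL.map (K := K) f))
      ((CDGA.cohomologyFunctor K).map (APL.map g)))) := by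
  obtain ⟨β, deg, y, bas, hbas, hb, hfin⟩ := exists_basis hfd
  obtain ⟨hc⟩ := (isKunneth_prod hb hfin X).nonempty_isColimit bas hbas
  let φ : P ⟶ prod X Y :=
    { app := fun a => TypeCat.ofHom fun p => (f.app a p, g.app a p)
      naturality := fun a b θ => by
        ext p
        have hf := NatTrans.naturality_apply f θ p
        have hg := NatTrans.naturality_apply g θ p
        exact Prod.ext hf hg }
  have : IsIso φ := by
    rw [NatTrans.isIso_iff_isIso_app]
    intro a
    rw [isIso_iff_bijective]
    exact h a
  exact ⟨hc.ofIsoColimit (BinaryCofan.ext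
    ((APLSSet K ⋙ CDGA.cohomologyFunctor K).mapIso (asIso φ).op)
    ((APLSSet K ⋙ CDGA.cohomologyFunctor K).map_comp (fst X Y).op φ.op).symm
    ((APLSSet K ⋙ CDGA.cohomologyFunctor K).map_comp (snd X Y).op φ.op).symm)⟩

/-- The product of a family of simplicial sets. -/
def pi {ι : Type u} (X : ι → SSet.{u}) : SSet.{u} where
  obj a := ∀ i, (X i).obj a
  map θ := TypeCat.ofHom fun x i => (X i).map θ (x i)
  map_id a := by
    ext x i
    exact ConcreteCategory.congr_hom ((X i).map_id a) (x i)
  map_comp θ ψ := by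
    ext x i
    exact ConcreteCategory.congr_hom ((X i).map_comp θ ψ) (x i)

/-- Induction on the number of factors. The factor split off plays the part of the finite type
factor `Y`, so nothing has to be known about the size of the cohomology of the remaining product. -/
theorem nonempty_isColimit_of_finite {ι : Type u} [Finite ι] (X : ι → SSet.{u})
    (hfd : ∀ i n, FiniteDimensional K ((obj K (X i)).cohomology.gr n)) (P : SSet.{u})
    (π : ∀ i, P ⟶ X i) (h : ∀ a, Function.Bijective fun (p : P.obj a) i => (π i).app a p) :
    Nonempty (IsColimit (Cofan.mk ((CDGA.cohomologyFunctor K).obj (obj K P))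
      fun i => (CDGA.cohomologyFunctor K).map (APL.map (K := K) (π i)))) := by
  induction ι using Finite.induction_empty_option generalizing P with
  | of_equiv e ih =>
    obtain ⟨hc⟩ := ih (fun i => X (e i)) (fun i => hfd _) P (fun i => π (e i)) fun a =>
      (Equiv.piCongrLeft (fun i => (X i).obj a) e).symm.bijective.comp (h a)
    exact ⟨isColimitCofanOfEquiv e _ hc⟩
  | h_empty =>
    -- The empty product has exactly one simplex in each degree, so these simplices form a cone
    -- operator.
    choose p _ using fun a => (h a).2 isEmptyElim
    have hs : ∀ a, Subsingleton (P.obj a) := fun a => (h a).1.subsingleton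
    let e : ConeOp P :=
      { join := fun a _ => p _
        point := p _
        map_join := fun _ _ => Subsingleton.elim _ _
        face := fun _ _ => Subsingleton.elim _ _
        vertex := fun _ _ => Subsingleton.elim _ _ }
    exact ⟨isColimitCofanOfIsEmpty _
      (CDGA.isInitialOfBijective _ (algebraMap_bijective_of_coneOp e))⟩
  | h_option ih =>
    rename_i ι _
    let X' : ι → SSet.{u} := fun i => X (some i)
    let pr (i : ι) : pi X' ⟶ X' i :=
      { app := fun a => TypeCat.ofHom fun x => x i, naturality := fun _ _ _ => rfl }
    obtain ⟨hQ⟩ := ih X' (fun i => hfd _) (pi X') pr fun a => Function.bijective_id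
    let r : P ⟶ pi X' :=
      { app := fun a => TypeCat.ofHom fun p i => (π (some i)).app a p
        naturality := fun a b θ => by
          ext p
          exact funext fun i => NatTrans.naturality_apply (π (some i)) θ p }
    obtain ⟨hP⟩ := nonempty_isColimit_binary (hfd none) r (π none) fun a => by
      constructor
      · intro p q hpq
        refine (h a).1 (funext fun o => ?_)
        cases o with
        | none => exact congrArg Prod.snd hpq
        | some i => exact congrFun (congrArg Prod.fst hpq) i
      · rintro ⟨x, z⟩
        obtain ⟨p, hp⟩ := (h a).2 fun o => Option.rec z x o
        exact ⟨p, Prod.ext (funext fun i => congrFun hp (some i)) (congrFun hp none)⟩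
    have hr : ∀ i, (CDGA.cohomologyFunctor K).map (APL.map (K := K) (π (some i))) =
        (CDGA.cohomologyFunctor K).map (APL.map (pr i)) ≫
          (CDGA.cohomologyFunctor K).map (APL.map r) := by
      intro i
      have h : π (some i) = r ≫ pr i := by
        ext a p
        rfl
      rw [h]
      exact (APLSSet K ⋙ CDGA.cohomologyFunctor K).map_comp (pr i).op r.op
    exact ⟨isColimitCofanOption _ _ _ hr hQ hP⟩

end APL

/-- The singular simplicial set preserves products: a continuous map from a simplex to a product is
the same as a family of continuous maps to the factors. -/
theorem CDGA.nonempty_isColimit_APLTop_pi {K : Type v} [Field K] [CharZero K] {ι : Type u}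
    [Finite ι] (X : ι → TopCat.{u})
    (hfd : ∀ i n, FiniteDimensional K (((APLTop K).obj (op (X i))).cohomology.gr n)) :
    Nonempty (Limits.IsColimit (Limits.Cofan.mk
      ((cohomologyFunctor K).obj ((APLTop K).obj (op (TopCat.of (∀ i, X i)))))
      fun i => (cohomologyFunctor K).map ((APLTop K).map
        (TopCat.ofHom ⟨fun x : ∀ i, X i => x i, continuous_apply i⟩).op))) := by
  refine APL.nonempty_isColimit_of_finite (fun i => TopCat.toSSet.obj (X i)) hfd _
    (fun i => TopCat.toSSet.map (TopCat.ofHom ⟨fun x : ∀ i, X i => x i, continuous_apply i⟩))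
    fun a => ⟨?_, ?_⟩
  · intro p q hpq
    let p' : SimplexCategory.toTop.{u}.obj a.unop ⟶ TopCat.of (∀ i, X i) := p.down
    let q' : SimplexCategory.toTop.{u}.obj a.unop ⟶ TopCat.of (∀ i, X i) := q.down
    have h : p' = q' := by
      ext t i
      exact ConcreteCategory.congr_hom (congrArg ULift.down (congrFun hpq i)) t
    exact congrArg ULift.up h
  · intro x
    let x' (i : ι) : SimplexCategory.toTop.{u}.obj a.unop ⟶ X i := (x i).down
    exact ⟨⟨TopCat.ofHom ⟨fun t i => x' i t, continuous_pi fun i => (x' i).hom.continuous⟩⟩, rfl⟩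

theorem proposition3p3 {I : Type u} [SmallCategory I] [FinCategory I]
    (K : Type v) [Field K] [CharZero K] (F : I ⥤ TopCat.{u})
    (hfin : ∀ (i : I) (n : ℕ),
      FiniteDimensional K (((APLTop K).obj (op (F.obj i))).cohomology.gr n))
    (hF : IsFormalDiagram K F) :
    IsFormalDiagram K (cosimplicialReplacement F) :=
  CDGA.isFormalDiagram_cosimplicialReplacement hF fun a =>
    CDGA.nonempty_isColimit_APLTop_pi (fun s : CosimplicialReplacement.Strings I a =>
      F.obj (s.obj (op 0))) fun _ n => hfin _ n
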